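/- For $s\in\mathbb R$ let $H^s$ be the real-valued $L^2$ Sobolev space on $\mathbb R$, with norm $\|v\|_s^2=\int_{\mathbb R}(1+\xi^2)^s|\widehat v(\xi)|^2\,d\xi$. Let $\rho\ge 2$, $s>1/2$, and let $l:\mathbb R\to\mathbb R$ be a measurable even function such that, for some constants $c_1,c_2>0$, $$c_1^2(1+\xi^2)^{\rho/2}\le l(\xi)\le c_2^2(1+\xi^2)^{\rho/2}\qquad\text{for all }\xi\in\mathbb R .$$ Let $L$ be the Fourier multiplier operator with symbol $l$, that is $\widehat{Lv}(\xi)=l(\xi)\widehat v(\xi)$, where $\xi$ is the frequency variable for which $\widehat{v_x}(\xi)=i\xi\,\widehat v(\xi)$. Let $\varphi\in H^s$, $\psi\in H^{s-1-\rho/2}$ and $g\in C^{[s]+1}(\mathbb R)$ be real-valued, where $[s]$ is the integer part of $s$. Then there is some $T>0$ such that the Cauchy problem $$u_{tt}-Lu_{xx}=(g(u))_{xx},\qquad u(x,0)=\varphi(x),\quad u_t(x,0)=\psi(x),$$ has a unique solution $u$ in $C([0,T],H^s)\cap C^1([0,T],H^{s-1-\rho/2})$. Here the equation is understood in the sense of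 tempered distributions in $x$ for every $t\in[0,T]$, with $u_{tt}$ the time derivative (one-sided at the end points) of $u_t$ in that sense. -/

import Mathlib

open MeasureTheory Set
open scoped SchwartzMap FourierTransform

noncomputable section

namespace NonlocalWave

/-- A tempered distribution on `ℝ` is real if it takes real values on real test functions. -/
def IsReal (v : 𝓢'(ℝ, ℂ)) : Prop :=
  ∀ χ : 𝓢(ℝ, ℂ), (∀ x, (χ x).im = 0) → (v χ).im = 0

/-- The real linear space of real tempered distributions in Mathlib's `L²` Sobolev class of
order `s` on `ℝ`. -/
def sobolevSubmodule (s : ℝ) : Submodule ℝ 𝓢'(ℝ, ℂ) where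
  carrier := {v | TemperedDistribution.MemSobolev s 2 v ∧ IsReal v}
  add_mem' := by
    rintro v w ⟨hv, hv'⟩ ⟨hw, hw'⟩
    refine ⟨hv.add hw, fun χ hχ => ?_⟩
    have h1 := hv' χ hχ
    have h2 := hw' χ hχ
    change (v χ + w χ).im = 0
    rw [Complex.add_im, h1, h2, add_zero]
  zero_mem' := ⟨TemperedDistribution.memSobolev_fun_zero ℝ ℂ s 2, fun _ _ => by simp⟩
  smul_mem' := by
    rintro c v ⟨hv, hv'⟩
    refine ⟨?_, fun χ hχ => ?_⟩
    · have h := hv.smul (c : ℂ)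
      have e : (c : ℂ) • v = c • v := by
        ext χ
        change (c : ℂ) • v χ = c • v χ
        simp
      rwa [e] at h
    · have h1 := hv' χ hχ
      change (c • v χ).im = 0
      rw [Complex.smul_im, h1, smul_zero]

/-- The real-valued `L²` Sobolev space `H^s(ℝ)`, `s ∈ ℝ`. It is a type of its own, because it
carries the Sobolev norm below and not the topology of pointwise convergence of `𝓢'`. -/
def H (s : ℝ) : Type := ↥(sobolevSubmodule s)

instance (s : ℝ) : AddCommGroup (H s) := inferInstanceAs (AddCommGroup ↥(sobolevSubmodule s))

instance (s : ℝ) : Module ℝ (H s) := inferInstanceAs (Module ℝ ↥(sobolevSubmodule s))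

/-- The inclusion of `H^s(ℝ)` into the tempered distributions. -/
def H.dist {s : ℝ} : H s →ₗ[ℝ] 𝓢'(ℝ, ℂ) := (sobolevSubmodule s).subtype

theorem H.dist_injective {s : ℝ} : Function.Injective (H.dist (s := s)) :=
  (sobolevSubmodule s).subtype_injective

theorem H.memSobolev {s : ℝ} (v : H s) : TemperedDistribution.MemSobolev s 2 v.dist :=
  (Subtype.property (p := fun w => w ∈ sobolevSubmodule s) v).1

theorem lp_dist_injective :
    Function.Injective (Lp.toTemperedDistributionCLM ℂ (volume : Measure ℝ) 2) :=
  LinearMap.ker_eq_bot.mp Lp.ker_toTemperedDistributionCLM_eq_bot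

/-- The Bessel potential of order `s` of `v ∈ H^s(ℝ)`, as an element of `L²`. -/
def H.bessel {s : ℝ} (v : H s) : Lp ℂ 2 (volume : Measure ℝ) := v.memSobolev.choose

theorem H.bessel_spec {s : ℝ} (v : H s) :
    TemperedDistribution.besselPotential ℝ ℂ s v.dist =
      Lp.toTemperedDistributionCLM ℂ (volume : Measure ℝ) 2 v.bessel :=
  v.memSobolev.choose_spec

/-- The Bessel potential of order `s` as a linear map `H^s(ℝ) → L²`. -/
def H.besselₗ (s : ℝ) : H s →ₗ[ℝ] Lp ℂ 2 (volume : Measure ℝ) where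
  toFun := H.bessel
  map_add' v w := lp_dist_injective <| by
    rw [map_add, ← H.bessel_spec, ← H.bessel_spec, ← H.bessel_spec, map_add, map_add]
  map_smul' c v := lp_dist_injective <| by
    rw [RingHom.id_apply, ContinuousLinearMap.map_smul_of_tower, ← H.bessel_spec,
      ← H.bessel_spec, map_smul, ContinuousLinearMap.map_smul_of_tower]

theorem H.besselₗ_injective (s : ℝ) : Function.Injective (H.besselₗ s) := by
  intro v w h
  have h' : v.bessel = w.bessel := h
  apply H.dist_injective
  have e : TemperedDistribution.besselPotential ℝ ℂ s v.dist =
      TemperedDistribution.besselPotential ℝ ℂ s w.dist := by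
    rw [H.bessel_spec, H.bessel_spec, h']
  have e' := congrArg (TemperedDistribution.besselPotential ℝ ℂ (-s)) e
  simpa using e'

/-- The Sobolev norm: the `L²` norm of `(1 + η²)^(s/2) 𝓕 v(η)` (equivalently, by Plancherel, of the
Bessel potential), where `η = ξ / 2π` is the frequency variable of Mathlib's Fourier transform.
As `1 + η² ≤ 1 + ξ² ≤ 4π² (1 + η²)`, it is equivalent to the norm with the weight `(1 + ξ²)^s`. -/
instance (s : ℝ) : NormedAddCommGroup (H s) :=
  NormedAddCommGroup.induced (H s) (Lp ℂ 2 (volume : Measure ℝ)) (H.besselₗ s)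
    (H.besselₗ_injective s)

instance (s : ℝ) : NormedSpace ℝ (H s) :=
  NormedSpace.induced ℝ (H s) (Lp ℂ 2 (volume : Measure ℝ)) (H.besselₗ s)

/-- The tempered distribution `v` is (integration against) the function `f`. -/
def IsRegular (v : 𝓢'(ℝ, ℂ)) (f : ℝ → ℂ) : Prop :=
  ∀ χ : 𝓢(ℝ, ℂ), Integrable (fun x => f x * χ x) ∧ v χ = ∫ x, f x * χ x

/-- `w = L v` for the Fourier multiplier `L` with symbol `l`, that is `ℱ(L v)(ξ) = l(ξ) ℱ(v)(ξ)`.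
The symbol is a function of the angular frequency `ξ` (so that `∂ₓ` has the symbol `i ξ`), and
`ξ = 2πη` in terms of the variable `η` of Mathlib's Fourier transform. -/
def IsMultiplier (l : ℝ → ℝ) (v w : 𝓢'(ℝ, ℂ)) : Prop :=
  ∃ f : ℝ → ℂ, IsRegular (𝓕 v) f ∧ IsRegular (𝓕 w) (fun η => (l (2 * Real.pi * η) : ℂ) * f η)

/-- `w = g(v)`, the superposition of `g` with the real function `v`. -/
def IsSuperposition (g : ℝ → ℝ) (v w : 𝓢'(ℝ, ℂ)) : Prop :=
  ∃ f : ℝ → ℝ, IsRegular v (fun x => (f x : ℂ)) ∧ IsRegular w (fun x => (g (f x) : ℂ))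

/-- The second distributional derivative `v_xx`. -/
def dxx (v : 𝓢'(ℝ, ℂ)) : 𝓢'(ℝ, ℂ) :=
  TemperedDistribution.derivCLM ℂ (TemperedDistribution.derivCLM ℂ v)

/-- `u ∈ C([0,T], H^s) ∩ C¹([0,T], H^σ)` solves
`u_tt - L u_xx = g(u)_xx`, `u(0) = φ`, `u_t(0) = ψ` on `[0,T]`.
Here `w` is `u` regarded as a function with values in `H^σ`, and `u_t` is the derivative of `w`
(one-sided at the end points). The equation `u_tt = L u_xx + g(u)_xx` is an equation of
tempered distributions in `x` at every time, with `u_tt` the time derivative of `u_t` in `𝓢'(ℝ)`. -/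
def IsSolution {s σ : ℝ} (l g : ℝ → ℝ) (φ : H s) (ψ : H σ) (T : ℝ) (u : ℝ → H s) : Prop :=
  ContinuousOn u (Icc 0 T) ∧
  ∃ w : ℝ → H σ,
    (∀ t ∈ Icc 0 T, (w t).dist = (u t).dist) ∧
    ContDiffOn ℝ 1 w (Icc 0 T) ∧
    u 0 = φ ∧
    derivWithin w (Icc 0 T) 0 = ψ ∧
    ∀ t ∈ Icc 0 T, ∃ Luxx gu : 𝓢'(ℝ, ℂ),
      IsMultiplier l (dxx (u t).dist) Luxx ∧
      IsSuperposition g (u t).dist gu ∧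
      ∀ χ : 𝓢(ℝ, ℂ),
        HasDerivWithinAt (fun τ => (derivWithin w (Icc 0 T) τ).dist χ)
          (Luxx χ + dxx gu χ) (Icc 0 T) t

end NonlocalWave

end

/-!
Local well-posedness for `u_tt - L u_xx = g(u)_xx` is proved on the Fourier side. With
`k = |ξ| √l(ξ)`, `m = |ξ| / √l(ξ)`, `U = 𝓕 u` and `n = 𝓕 (g(u) - g(0))` the equation reads
`U_tt + k² U = - k m n`; the constant `g(0)` is annihilated by the derivatives. Duhamel's formula
`U(t) = cos(k t) U(0) + sin(k t)/k U_t(0) - ∫₀ᵗ sin(k (t - τ)) m n(τ) dτ` loses no derivatives, since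
`m` is bounded because of `ρ ≥ 2` (`exists_dispersion`), and `1/k` gains at high frequencies the
`1 + ρ/2` orders by which the initial velocity is less regular than the initial value.

With `g` only of class `C^([s]+1)`, the map `u ↦ g(u) - g(0)` is bounded on balls of `H^s`
(`wNorm_comp_le`) but is only used as a Lipschitz map in `L²`. Boundedness is proved by induction on
`[s]`: for `s < 1` the Gagliardo seminorm is compared with the Fourier weight
(`wNorm_le_of_lipschitz`), and otherwise the chain rule `g(u)ₓ = g'(u) uₓ` (`tendsto_diffQuot_comp`)
and the product estimate (`exists_wNorm_mul_le`) reduce the order by one. Truncation of the argument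
of `g` extends the nonlinearity from a ball of `H^s` to a Lipschitz map of `L²`
(`exists_nonlinearity`).

Existence is by contraction in `C([0,T], L²)`, on the set of functions with values in a ball of
`H^s`, which is closed in `L²` (`isClosed_wBall`, `Dispersion.exists_mild_eq`). The fixed point is
continuous in `H^s`, because Duhamel integrals of sources which are bounded in `H^s` and continuous in
`L²` are Lipschitz in `H^s` (`exists_integral_eq`, `Dispersion.exists_regular`). It is a solution in
the sense of distributions by `add_dxx_eq_distOf` and `exists_isSolution`.

For uniqueness, the second time derivative of an arbitrary solution, which exists at each test
function only, is first found to exist in `L²` after the loss of `2 (1 + ρ/2)` orders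
(`hasDerivWithinAt_of_separating`, `IsSolution.exists_velocity`). Testing with solutions of the backward
homogeneous equation gives Duhamel's formula for the difference of two solutions
(`Dispersion.eq_neg_integral`), and the lemma of Gronwall in `L²` concludes
(`Dispersion.eqOn_of_hasDeriv`).
-/

noncomputable section

namespace NonlocalWave

open Filter Topology ENNReal NNReal

/-! ### Multiplication operators on `L²` -/

/-- The complex Hilbert space `L²(ℝ)`. -/
abbrev L2 : Type := Lp ℂ 2 (volume : Measure ℝ)

/-- Bounded measurable functions, the admissible symbols of multiplication operators on `L²`. -/
structure BddMeas (m : ℝ → ℂ) : Prop where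
  meas : Measurable m
  bdd : ∃ C : ℝ, ∀ x, ‖m x‖ ≤ C

theorem BddMeas.of_le {m : ℝ → ℂ} (hm : Measurable m) {C : ℝ} (h : ∀ x, ‖m x‖ ≤ C) :
    BddMeas m := ⟨hm, C, h⟩

theorem BddMeas.memLp {m : ℝ → ℂ} (h : BddMeas m) (F : L2) :
    MemLp (fun x => m x * F x) 2 := by
  obtain ⟨C, hC⟩ := h.bdd
  refine (Lp.memLp F).of_le_mul (c := C)
    (h.meas.aestronglyMeasurable.mul (Lp.aestronglyMeasurable F)) (ae_of_all _ fun x => ?_)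
  rw [norm_mul]
  exact mul_le_mul_of_nonneg_right (hC x) (norm_nonneg _)

open Classical in
/-- Multiplication by the bounded measurable function `m`, as an operator on `L²`
(the zero operator if `m` is not bounded measurable). -/
def mulL (m : ℝ → ℂ) : L2 →L[ℂ] L2 :=
  if h : BddMeas m then
    LinearMap.mkContinuous
      { toFun := fun F => (h.memLp F).toLp _
        map_add' := fun F G => by
          apply Lp.ext
          filter_upwards [(h.memLp (F + G)).coeFn_toLp, (h.memLp F).coeFn_toLp,
            (h.memLp G).coeFn_toLp, Lp.coeFn_add F G,
            Lp.coeFn_add ((h.memLp F).toLp _) ((h.memLp G).toLp _)] with x h1 h2 h3 h4 h5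
          rw [h1, h5, Pi.add_apply, h2, h3, h4, Pi.add_apply, mul_add]
        map_smul' := fun c F => by
          apply Lp.ext
          filter_upwards [(h.memLp (c • F)).coeFn_toLp, (h.memLp F).coeFn_toLp,
            Lp.coeFn_smul c F, Lp.coeFn_smul c ((h.memLp F).toLp _)] with x h1 h2 h3 h4
          rw [h1, RingHom.id_apply, h4, Pi.smul_apply, h2, h3, Pi.smul_apply, smul_eq_mul,
            smul_eq_mul]
          ring }
      h.bdd.choose (fun F => by
        apply Lp.norm_le_mul_norm_of_ae_le_mul
        filter_upwards [(h.memLp F).coeFn_toLp] with x h1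
        change ‖((h.memLp F).toLp _ : L2) x‖ ≤ _
        rw [h1, norm_mul]
        exact mul_le_mul_of_nonneg_right (h.bdd.choose_spec x) (norm_nonneg _))
  else 0

theorem mulL_ae {m : ℝ → ℂ} (h : BddMeas m) (F : L2) :
    ∀ᵐ x, mulL m F x = m x * F x := by
  have : mulL m F = (h.memLp F).toLp _ := by
    rw [mulL, dif_pos h]; rfl
  rw [this]
  exact (h.memLp F).coeFn_toLp

theorem norm_mulL_le {m : ℝ → ℂ} (hm : Measurable m) {C : ℝ} (h : ∀ x, ‖m x‖ ≤ C) (F : L2) :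
    ‖mulL m F‖ ≤ C * ‖F‖ := by
  apply Lp.norm_le_mul_norm_of_ae_le_mul
  filter_upwards [mulL_ae (.of_le hm h) F] with x h1
  rw [h1, norm_mul]
  exact mul_le_mul_of_nonneg_right (h x) (norm_nonneg _)

theorem BddMeas.mul {m n : ℝ → ℂ} (hm : BddMeas m) (hn : BddMeas n) :
    BddMeas (fun x => m x * n x) := by
  obtain ⟨C, hC⟩ := hm.bdd
  obtain ⟨D, hD⟩ := hn.bdd
  refine .of_le (hm.meas.mul hn.meas) (C := C * D) fun x => ?_
  rw [norm_mul]
  exact mul_le_mul (hC x) (hD x) (norm_nonneg _) ((norm_nonneg _).trans (hC x))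

theorem BddMeas.sub {m n : ℝ → ℂ} (hm : BddMeas m) (hn : BddMeas n) :
    BddMeas (fun x => m x - n x) := by
  obtain ⟨C, hC⟩ := hm.bdd
  obtain ⟨D, hD⟩ := hn.bdd
  exact .of_le (hm.meas.sub hn.meas) (C := C + D)
    fun x => (norm_sub_le _ _).trans (add_le_add (hC x) (hD x))

theorem BddMeas.const_mul {m : ℝ → ℂ} (c : ℂ) (hm : BddMeas m) :
    BddMeas (fun x => c * m x) :=
  BddMeas.mul (.of_le measurable_const (C := ‖c‖) fun _ => le_rfl) hm

theorem BddMeas.ofReal {m : ℝ → ℝ} (hm : Measurable m) {C : ℝ} (h : ∀ x, |m x| ≤ C) :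
    BddMeas (fun x => (m x : ℂ)) :=
  .of_le (Complex.measurable_ofReal.comp hm) (C := C) fun x => by simpa using h x

theorem mulL_mulL {m n : ℝ → ℂ} (hm : BddMeas m) (hn : BddMeas n) (F : L2) :
    mulL m (mulL n F) = mulL (fun x => m x * n x) F := by
  apply Lp.ext
  filter_upwards [mulL_ae hm (mulL n F), mulL_ae hn F, mulL_ae (hm.mul hn) F] with x h1 h2 h3
  rw [h1, h2, h3, mul_assoc]

theorem mulL_sub {m n : ℝ → ℂ} (hm : BddMeas m) (hn : BddMeas n) (F : L2) :
    mulL (fun x => m x - n x) F = mulL m F - mulL n F := by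
  apply Lp.ext
  filter_upwards [mulL_ae hm F, mulL_ae hn F, mulL_ae (hm.sub hn) F,
    Lp.coeFn_sub (mulL m F) (mulL n F)] with x h1 h2 h3 h4
  rw [h3, h4, Pi.sub_apply, h1, h2, sub_mul]

theorem mulL_const_mul {m : ℝ → ℂ} (c : ℂ) (hm : BddMeas m) (F : L2) :
    mulL (fun x => c * m x) F = c • mulL m F := by
  apply Lp.ext
  filter_upwards [mulL_ae hm F, mulL_ae (hm.const_mul c) F,
    Lp.coeFn_smul c (mulL m F)] with x h1 h2 h3
  rw [h2, h3, Pi.smul_apply, h1, smul_eq_mul, mul_assoc]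

theorem mulL_injective {m : ℝ → ℂ} (hm : BddMeas m) (h0 : ∀ x, m x ≠ 0) :
    Function.Injective (mulL m) := by
  intro F G h
  apply Lp.ext
  filter_upwards [mulL_ae hm F, mulL_ae hm G] with x h1 h2
  have : mulL m F x = mulL m G x := by rw [h]
  rw [h1, h2] at this
  exact mul_left_cancel₀ (h0 x) this

/-- Dominated convergence: multiplication operators with uniformly bounded, pointwise convergent
symbols converge strongly. -/
theorem tendsto_mulL {ι : Type*} {l : Filter ι} [l.IsCountablyGenerated] {m : ι → ℝ → ℂ}
    {m₀ : ℝ → ℂ} {C : ℝ} (hm : ∀ᶠ i in l, Measurable (m i) ∧ ∀ x, ‖m i x‖ ≤ C)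
    (hm₀ : BddMeas m₀) (hlim : ∀ x, Tendsto (fun i => m i x) l (𝓝 (m₀ x))) (F : L2) :
    Tendsto (fun i => mulL (m i) F) l (𝓝 (mulL m₀ F)) := by
  obtain ⟨C₀, hC₀⟩ := hm₀.bdd
  rw [Lp.tendsto_Lp_iff_tendsto_eLpNorm']
  have key : Tendsto (fun i => ∫⁻ x, ‖(m i x - m₀ x) * F x‖ₑ ^ (2 : ℝ)) l (𝓝 0) := by
    have h0 : (∫⁻ _ : ℝ, (0 : ℝ≥0∞)) = 0 := by simp
    rw [← h0]
    have hfin : ∫⁻ x, ‖((C + C₀ : ℝ) : ℂ) * F x‖ₑ ^ (2 : ℝ) ≠ ∞ := by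
      have := ((Lp.memLp F).const_mul ((C + C₀ : ℝ) : ℂ)).2
      rw [eLpNorm_lt_top_iff_lintegral_rpow_enorm_lt_top (by norm_num) (by norm_num)] at this
      simpa using this.ne
    refine tendsto_lintegral_filter_of_dominated_convergence
      (fun x => ‖((C + C₀ : ℝ) : ℂ) * F x‖ₑ ^ (2 : ℝ)) ?_ ?_ hfin ?_
    · filter_upwards [hm] with i hi
      exact (((hi.1.sub hm₀.meas).mul (Lp.stronglyMeasurable F).measurable).enorm).pow_const _
    · filter_upwards [hm] with i hi
      refine ae_of_all _ fun x => ?_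
      gcongr
      rw [enorm_le_iff_norm_le, norm_mul, norm_mul]
      gcongr
      calc ‖m i x - m₀ x‖ ≤ C + C₀ := (norm_sub_le _ _).trans (add_le_add (hi.2 x) (hC₀ x))
        _ ≤ ‖((C + C₀ : ℝ) : ℂ)‖ := by
          rw [Complex.norm_real]; exact le_abs_self _
    · refine ae_of_all _ fun x => ?_
      have h1 : Tendsto (fun i => (m i x - m₀ x) * F x) l (𝓝 ((m₀ x - m₀ x) * F x)) :=
        ((hlim x).sub_const _).mul_const _
      have h2 := (ENNReal.continuous_rpow_const (y := 2)).continuousAt.tendsto.comp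
        (continuous_enorm.continuousAt.tendsto.comp h1)
      simpa [Function.comp_def] using h2
  have key2 := (ENNReal.continuous_rpow_const (y := 1 / 2)).continuousAt.tendsto.comp key
  rw [ENNReal.zero_rpow_of_pos (by norm_num)] at key2
  refine key2.congr' ?_
  filter_upwards [hm] with i hi
  have : eLpNorm (⇑(mulL (m i) F) - ⇑(mulL m₀ F)) 2 volume =
      eLpNorm (fun x => (m i x - m₀ x) * F x) 2 volume := by
    apply eLpNorm_congr_ae
    filter_upwards [mulL_ae (.of_le hi.1 hi.2) F, mulL_ae hm₀ F] with x h1 h2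
    rw [Pi.sub_apply, h1, h2, sub_mul]
  rw [this, eLpNorm_eq_lintegral_rpow_enorm_toReal (by norm_num) (by norm_num)]
  simp

/-- The strong convergence of multiplication operators, applied to a convergent sequence. -/
theorem tendsto_mulL_apply {ι : Type*} {l : Filter ι} [l.IsCountablyGenerated] {m : ι → ℝ → ℂ}
    {m₀ : ℝ → ℂ} {C : ℝ} (hm : ∀ᶠ i in l, Measurable (m i) ∧ ∀ x, ‖m i x‖ ≤ C)
    (hm₀ : BddMeas m₀) (hlim : ∀ x, Tendsto (fun i => m i x) l (𝓝 (m₀ x)))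
    {F : ι → L2} {F₀ : L2} (hF : Tendsto F l (𝓝 F₀)) :
    Tendsto (fun i => mulL (m i) (F i)) l (𝓝 (mulL m₀ F₀)) := by
  have h1 : Tendsto (fun i => mulL (m i) (F i - F₀)) l (𝓝 0) := by
    rw [tendsto_zero_iff_norm_tendsto_zero]
    have h2 : Tendsto (fun i => C * ‖F i - F₀‖) l (𝓝 0) := by
      have := (tendsto_iff_norm_sub_tendsto_zero.mp hF).const_mul C
      simpa using this
    refine squeeze_zero' (Eventually.of_forall fun _ => norm_nonneg _) ?_ h2
    filter_upwards [hm] with i hi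
    exact norm_mulL_le hi.1 hi.2 _
  have h3 := h1.add (tendsto_mulL hm hm₀ hlim F₀)
  simpa [map_sub] using h3

theorem continuousOn_mulL {S : Set ℝ} {m : ℝ → ℝ → ℂ} {C : ℝ}
    (hm : ∀ t ∈ S, Measurable (m t) ∧ ∀ x, ‖m t x‖ ≤ C) (hc : ∀ x, Continuous fun t => m t x)
    {F : ℝ → L2} (hF : ContinuousOn F S) :
    ContinuousOn (fun t => mulL (m t) (F t)) S := fun t ht =>
  tendsto_mulL_apply (eventually_mem_nhdsWithin.mono hm) (.of_le (hm t ht).1 (hm t ht).2)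
    (fun x => (hc x).continuousAt.continuousWithinAt) (hF t ht)

/-- The product rule for `t ↦ m(t) F(t)`, where the symbols `m(t)` are bounded and Lipschitz in `t`
uniformly in the frequency. Their operator norm derivative need not exist. -/
theorem hasDerivWithinAt_mulL {S : Set ℝ} {t₀ : ℝ} (ht₀ : t₀ ∈ S) {m : ℝ → ℝ → ℂ} {m' : ℝ → ℂ}
    {C : ℝ} (hm : ∀ t ∈ S, Measurable (m t) ∧ ∀ x, ‖m t x‖ ≤ C)
    (hlip : ∀ t ∈ S, ∀ x, ‖m t x - m t₀ x‖ ≤ C * |t - t₀|) (hm' : BddMeas m')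
    (hd : ∀ x, HasDerivAt (fun t => m t x) (m' x) t₀)
    {F : ℝ → L2} {F' : L2} (hF : HasDerivWithinAt F F' S t₀) :
    HasDerivWithinAt (fun t => mulL (m t) (F t)) (mulL m' (F t₀) + mulL (m t₀) F') S t₀ := by
  rw [hasDerivWithinAt_iff_tendsto_slope] at hF ⊢
  have hb : ∀ t ∈ S, BddMeas (m t) := fun t ht => .of_le (hm t ht).1 (hm t ht).2
  have hmem : ∀ᶠ t in 𝓝[S \ {t₀}] t₀, t ∈ S \ {t₀} := eventually_mem_nhdsWithin
  have h1 : Tendsto (fun t => mulL (m t) (slope F t₀ t)) (𝓝[S \ {t₀}] t₀) (𝓝 (mulL (m t₀) F')) :=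
    tendsto_mulL_apply (hmem.mono fun t ht => hm t ht.1) (hb t₀ ht₀)
      (fun x => (hd x).continuousAt.continuousWithinAt) hF
  have h2 : Tendsto (fun t => mulL (fun x => ((t - t₀ : ℝ) : ℂ)⁻¹ * (m t x - m t₀ x)) (F t₀))
      (𝓝[S \ {t₀}] t₀) (𝓝 (mulL m' (F t₀))) := by
    refine tendsto_mulL (C := C) ?_ hm' (fun x => ?_) _
    · filter_upwards [hmem] with t ht
      refine ⟨(((hm t ht.1).1.sub (hm t₀ ht₀).1)).const_mul _, fun x => ?_⟩
      have hne : 0 < |t - t₀| := abs_pos.mpr (sub_ne_zero.mpr ht.2)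
      rw [norm_mul, norm_inv, Complex.norm_real, Real.norm_eq_abs, inv_mul_le_iff₀ hne, mul_comm]
      exact hlip t ht.1 x
    · have := (hasDerivWithinAt_iff_tendsto_slope.mp ((hd x).hasDerivWithinAt (s := S)))
      refine this.congr fun t => ?_
      rw [slope_def_module, Complex.real_smul, Complex.ofReal_inv]
  refine (h2.add h1).congr' ?_
  filter_upwards [hmem] with t ht
  have e : ∀ z : L2, ((t - t₀ : ℝ) : ℂ)⁻¹ • z = (t - t₀)⁻¹ • z := fun z => by
    rw [← Complex.ofReal_inv]
    exact algebraMap_smul ℂ (t - t₀)⁻¹ z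
  rw [slope_def_module, slope_def_module, mulL_const_mul _ ((hb t ht.1).sub (hb t₀ ht₀)),
    mulL_sub (hb t ht.1) (hb t₀ ht₀), e, ContinuousLinearMap.map_smul_of_tower, map_sub, ← smul_add]
  congr 1
  abel

/-! ### Bessel weights and distributions given by weighted Fourier transforms -/

/-- The weight `(1 + η²)^(a/2)` of the Bessel potential of order `a`. -/
def jb (a η : ℝ) : ℝ := (1 + ‖η‖ ^ 2) ^ (a / 2)

theorem jb_eq (a η : ℝ) : jb a η = (1 + η ^ 2) ^ (a / 2) := by
  rw [jb, Real.norm_eq_abs, sq_abs]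

theorem jb_pos (a η : ℝ) : 0 < jb a η := by unfold jb; positivity

theorem jb_add (a b η : ℝ) : jb (a + b) η = jb a η * jb b η := by
  rw [jb, add_div, Real.rpow_add (by positivity)]; rfl

@[simp]
theorem jb_zero (η : ℝ) : jb 0 η = 1 := by simp [jb]

theorem jb_mul_neg (a η : ℝ) : jb a η * jb (-a) η = 1 := by rw [← jb_add]; simp

theorem jb_neg_mul (a η : ℝ) : jb (-a) η * jb a η = 1 := by rw [← jb_add]; simp

theorem jb_mono {a b : ℝ} (h : a ≤ b) (η : ℝ) : jb a η ≤ jb b η :=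
  Real.rpow_le_rpow_of_exponent_le (by nlinarith [sq_nonneg ‖η‖]) (by linarith)

theorem jb_le_one {a : ℝ} (h : a ≤ 0) (η : ℝ) : jb a η ≤ 1 := by
  simpa using jb_mono h η

theorem jb_even (a η : ℝ) : jb a (-η) = jb a η := by simp [jb]

theorem jb_two (η : ℝ) : jb 2 η = 1 + η ^ 2 := by simp [jb_eq]

theorem abs_le_jb_one (η : ℝ) : |η| ≤ jb 1 η := by
  have h : jb 1 η ^ 2 = 1 + η ^ 2 := by
    rw [← jb_two, sq, ← jb_add]; norm_num
  exact abs_le_of_sq_le_sq (by rw [h]; linarith) (jb_pos _ _).le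

theorem continuous_jb (a : ℝ) : Continuous (jb a) := by
  unfold jb
  exact (by fun_prop : Continuous fun η : ℝ => 1 + ‖η‖ ^ 2).rpow_const
    fun η => Or.inl (by positivity)

theorem measurable_jb (a : ℝ) : Measurable (jb a) := (continuous_jb a).measurable

theorem bddMeas_jb {a : ℝ} (h : a ≤ 0) : BddMeas (fun η => (jb a η : ℂ)) :=
  .ofReal (measurable_jb a) (C := 1) fun η => by
    rw [abs_of_pos (jb_pos _ _)]; exact jb_le_one h η

theorem hasTemperateGrowth_jb (a : ℝ) :
    Function.HasTemperateGrowth (fun η : ℝ => ((1 + ‖η‖ ^ 2) ^ (a / 2) : ℝ)) := by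
  fun_prop

/-- A tempered distribution is determined by its values on real test functions. -/
theorem eq_zero_of_real {v : 𝓢'(ℝ, ℂ)}
    (h : ∀ χ : 𝓢(ℝ, ℂ), (∀ x, (χ x).im = 0) → v χ = 0) : v = 0 := by
  ext χ
  let r : ℂ →L[ℝ] ℂ := Complex.ofRealCLM.comp Complex.reCLM
  let i : ℂ →L[ℝ] ℂ := Complex.ofRealCLM.comp Complex.imCLM
  have e : χ = SchwartzMap.postcompCLM r χ + Complex.I • SchwartzMap.postcompCLM i χ := by
    ext x
    simp [r, i, mul_comm Complex.I, Complex.re_add_im]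
  rw [e, map_add, map_smul, h _ (fun x => by simp [r]), h _ (fun x => by simp [i])]
  simp

/-- The tempered distribution whose Fourier transform is the function `(1 + η²)^(-a/2) F(η)`;
these are the distributions in the (complex) Sobolev space of order `a`. -/
def distOf (a : ℝ) : L2 →L[ℂ] 𝓢'(ℝ, ℂ) :=
  (TemperedDistribution.besselPotential ℝ ℂ (-a)).comp
    ((Lp.toTemperedDistributionCLM ℂ (volume : Measure ℝ) 2).comp
      (FourierTransform.fourierInvCLM ℂ L2))

theorem distOf_eq (a : ℝ) (F : L2) : distOf a F =
    TemperedDistribution.besselPotential ℝ ℂ (-a)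
      (Lp.toTemperedDistributionCLM ℂ (volume : Measure ℝ) 2 (𝓕⁻ F)) := rfl

theorem distOf_injective (a : ℝ) : Function.Injective (distOf a) := by
  intro F G h
  rw [distOf_eq, distOf_eq] at h
  have h1 := congrArg (TemperedDistribution.besselPotential ℝ ℂ a) h
  have h2 : Lp.toTemperedDistributionCLM ℂ (volume : Measure ℝ) 2 (𝓕⁻ F) =
      Lp.toTemperedDistributionCLM ℂ (volume : Measure ℝ) 2 (𝓕⁻ G) := by simpa using h1
  have h3 := congrArg (𝓕 : L2 → L2) (lp_dist_injective h2)
  simpa using h3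

theorem integrable_weight_mul (a : ℝ) (F : L2) (χ : 𝓢(ℝ, ℂ)) :
    Integrable (fun η => (jb a η : ℂ) * F η * χ η) := by
  have h1 : MemLp (⇑(SchwartzMap.smulLeftCLM ℂ
      (fun η : ℝ => ((1 + ‖η‖ ^ 2) ^ (a / 2) : ℝ)) χ)) 2 (volume : Measure ℝ) :=
    SchwartzMap.memLp _ _ _
  refine ((Lp.memLp F).integrable_mul h1).congr (ae_of_all _ fun η => ?_)
  simp only [Pi.mul_apply]
  rw [SchwartzMap.smulLeftCLM_apply_apply (hasTemperateGrowth_jb a), Complex.real_smul]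
  simp only [jb]
  ring

theorem distOf_apply (a : ℝ) (F : L2) (χ : 𝓢(ℝ, ℂ)) :
    distOf a F χ = ∫ η, (jb (-a) η : ℂ) * F η * (𝓕⁻ χ) η := by
  have h0 : distOf a F χ = (𝓕 (Lp.toTemperedDistribution (𝓕⁻ F : L2)) : 𝓢'(ℝ, ℂ))
      (SchwartzMap.smulLeftCLM ℂ (fun η : ℝ => (((1 + ‖η‖ ^ 2) ^ (-a / 2) : ℝ) : ℂ)) (𝓕⁻ χ)) := rfl
  have hg : Function.HasTemperateGrowth (fun η : ℝ => (((1 + ‖η‖ ^ 2) ^ (-a / 2) : ℝ) : ℂ)) := by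
    fun_prop
  rw [h0, Lp.fourier_toTemperedDistribution_eq, FourierTransform.fourier_fourierInv_eq,
    Lp.toTemperedDistribution_apply]
  refine integral_congr_ae (ae_of_all _ fun η => ?_)
  simp only
  rw [SchwartzMap.smulLeftCLM_apply_apply hg, smul_eq_mul, smul_eq_mul, jb]
  ring

/-- The Fourier transform of `distOf a F` is the function announced in the definition of `distOf`. -/
theorem isRegular_fourier_distOf (a : ℝ) (F : L2) :
    IsRegular (𝓕 (distOf a F)) (fun η => (jb (-a) η : ℂ) * F η) := fun χ =>
  ⟨integrable_weight_mul _ _ _, by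
    rw [TemperedDistribution.fourier_apply, distOf_apply,
      FourierTransform.fourierInv_fourier_eq]⟩

/-- `L²` is the case of order `0`. -/
theorem toTemperedDistribution_eq_distOf (u : L2) :
    Lp.toTemperedDistributionCLM ℂ (volume : Measure ℝ) 2 u = distOf 0 (𝓕 u) := by
  rw [distOf_eq]; simp

theorem isRegular_toTemperedDistribution (u : L2) :
    IsRegular (Lp.toTemperedDistributionCLM ℂ (volume : Measure ℝ) 2 u) u := fun χ => by
  constructor
  · simpa using integrable_weight_mul 0 u χ
  · rw [Lp.toTemperedDistributionCLM_apply, Lp.toTemperedDistribution_apply]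
    simp only [smul_eq_mul, mul_comm]

/-- The weights of `L²` functions can be moved into the order of the distribution. -/
theorem distOf_mulL_jb {b : ℝ} (hb : 0 ≤ b) (a : ℝ) (F : L2) :
    distOf a (mulL (fun η => (jb (-b) η : ℂ)) F) = distOf (a + b) F := by
  ext χ
  rw [distOf_apply, distOf_apply]
  refine integral_congr_ae ?_
  filter_upwards [mulL_ae (bddMeas_jb (neg_nonpos.mpr hb)) F] with η h
  rw [h, neg_add, jb_add]
  push_cast
  ring

/-! ### Regular distributions -/

theorem IsRegular.locallyIntegrable {v : 𝓢'(ℝ, ℂ)} {f : ℝ → ℂ} (h : IsRegular v f) :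
    LocallyIntegrable f := by
  intro x
  let b : ContDiffBump x := ⟨1, 2, by norm_num, by norm_num⟩
  have hc : HasCompactSupport (Complex.ofRealCLM ∘ b) := b.hasCompactSupport.comp_left rfl
  have hs : ContDiff ℝ (⊤ : ℕ∞) (Complex.ofRealCLM ∘ b) := Complex.ofRealCLM.contDiff.comp b.contDiff
  refine ⟨Metric.closedBall x 1, Metric.closedBall_mem_nhds x one_pos, ?_⟩
  refine ((h (hc.toSchwartzMap hs)).1.integrableOn (s := Metric.closedBall x 1)).congr_fun
    (fun y hy => ?_) measurableSet_closedBall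
  simp [b.one_of_mem_closedBall hy]

/-- The function representing a regular tempered distribution is unique almost everywhere. -/
theorem IsRegular.ae_eq {v : 𝓢'(ℝ, ℂ)} {f f' : ℝ → ℂ} (h : IsRegular v f)
    (h' : IsRegular v f') : f =ᵐ[volume] f' := by
  refine ae_eq_of_integral_contDiff_smul_eq h.locallyIntegrable h'.locallyIntegrable ?_
  intro χ hχ hc
  have hc' : HasCompactSupport (Complex.ofRealCLM ∘ χ) := hc.comp_left rfl
  have hs : ContDiff ℝ (⊤ : ℕ∞) (Complex.ofRealCLM ∘ χ) := Complex.ofRealCLM.contDiff.comp hχ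
  have h1 := (h (hc'.toSchwartzMap hs)).2
  rw [(h' (hc'.toSchwartzMap hs)).2] at h1
  simpa [mul_comm] using h1.symm

theorem IsRegular.congr {v : 𝓢'(ℝ, ℂ)} {f f' : ℝ → ℂ} (h : IsRegular v f)
    (h' : f =ᵐ[volume] f') : IsRegular v f' := fun χ => by
  have e : (fun x => f x * χ x) =ᵐ[volume] fun x => f' x * χ x := by
    filter_upwards [h'] with x hx
    rw [hx]
  exact ⟨(h χ).1.congr e, by rw [(h χ).2]; exact integral_congr_ae e⟩

/-! ### Reality and Hermitian symmetry -/

/-- Hermitian symmetry, the property of the Fourier transforms of real functions. -/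
def Hermitian (F : L2) : Prop := ∀ᵐ η, F (-η) = starRingEnd ℂ (F η)

/-- The function `η ↦ conj (F(-η))`. -/
def conjReflect (F : L2) : L2 :=
  (((Lp.memLp F).comp_measurePreserving (Measure.measurePreserving_neg volume)).star).toLp _

theorem conjReflect_ae (F : L2) : ∀ᵐ η, conjReflect F η = starRingEnd ℂ (F (-η)) :=
  (((Lp.memLp F).comp_measurePreserving (Measure.measurePreserving_neg volume)).star).coeFn_toLp

theorem hermitian_iff (F : L2) : Hermitian F ↔ conjReflect F = F := by
  constructor
  · intro h
    apply Lp.ext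
    filter_upwards [h, conjReflect_ae F] with η h1 h2
    rw [h2, h1, Complex.conj_conj]
  · intro h
    filter_upwards [conjReflect_ae F] with η h2
    rw [h] at h2
    rw [h2, Complex.conj_conj]

theorem fourierInv_neg_of_real {χ : 𝓢(ℝ, ℂ)} (hχ : ∀ x, (χ x).im = 0) (η : ℝ) :
    starRingEnd ℂ ((𝓕⁻ χ) η) = (𝓕⁻ χ) (-η) := by
  rw [SchwartzMap.fourierInv_coe, Real.fourierInv_eq', Real.fourierInv_eq', ← integral_conj]
  refine integral_congr_ae (ae_of_all _ fun x => ?_)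
  simp only [smul_eq_mul, map_mul, ← Complex.exp_conj, Complex.conj_ofReal, Complex.conj_I,
    Complex.conj_eq_iff_im.mpr (hχ x)]
  congr 2
  simp

/-- Conjugation of the distribution conjugates and reflects its Fourier transform. The test function
has to be real. -/
theorem conj_distOf (a : ℝ) (F : L2) {χ : 𝓢(ℝ, ℂ)} (hχ : ∀ x, (χ x).im = 0) :
    starRingEnd ℂ (distOf a F χ) = distOf a (conjReflect F) χ := by
  rw [distOf_apply, distOf_apply, ← integral_conj, ← integral_neg_eq_self]
  refine integral_congr_ae ?_
  filter_upwards [conjReflect_ae F] with η h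
  rw [h, map_mul, map_mul, Complex.conj_ofReal, fourierInv_neg_of_real hχ, jb_even, neg_neg]

/-- As the Bessel weights are even, `distOf a F` is real exactly if `F` is Hermitian. -/
theorem isReal_distOf_iff (a : ℝ) (F : L2) : IsReal (distOf a F) ↔ Hermitian F := by
  rw [hermitian_iff]
  constructor
  · intro h
    apply distOf_injective a
    rw [← sub_eq_zero, ← map_sub]
    apply eq_zero_of_real
    intro χ hχ
    rw [map_sub]
    change distOf a (conjReflect F) χ - distOf a F χ = 0
    rw [← conj_distOf a F hχ, Complex.conj_eq_iff_im.mpr (h χ hχ), sub_self]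
  · intro h χ hχ
    rw [← Complex.conj_eq_iff_im, conj_distOf a F hχ, h]

theorem isReal_toTemperedDistribution_iff (u : L2) :
    IsReal (Lp.toTemperedDistributionCLM ℂ (volume : Measure ℝ) 2 u) ↔ ∀ᵐ x, (u x).im = 0 := by
  let uc : L2 := (Lp.memLp u).star.toLp _
  have huc : ∀ᵐ x, uc x = starRingEnd ℂ (u x) := (Lp.memLp u).star.coeFn_toLp
  have key : ∀ χ : 𝓢(ℝ, ℂ), (∀ x, (χ x).im = 0) →
      starRingEnd ℂ (Lp.toTemperedDistributionCLM ℂ (volume : Measure ℝ) 2 u χ) =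
      Lp.toTemperedDistributionCLM ℂ (volume : Measure ℝ) 2 uc χ := by
    intro χ hχ
    rw [(isRegular_toTemperedDistribution u χ).2, (isRegular_toTemperedDistribution uc χ).2,
      ← integral_conj]
    refine integral_congr_ae ?_
    filter_upwards [huc] with x hx
    rw [hx, map_mul, Complex.conj_eq_iff_im.mpr (hχ x)]
  constructor
  · intro h
    have e : uc = u := by
      apply lp_dist_injective
      rw [← sub_eq_zero, ← map_sub]
      apply eq_zero_of_real
      intro χ hχ
      rw [map_sub]
      change Lp.toTemperedDistributionCLM ℂ (volume : Measure ℝ) 2 uc χ -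
        Lp.toTemperedDistributionCLM ℂ (volume : Measure ℝ) 2 u χ = 0
      rw [← key χ hχ, Complex.conj_eq_iff_im.mpr (h χ hχ), sub_self]
    filter_upwards [huc] with x hx
    rw [e] at hx
    exact Complex.conj_eq_iff_im.mp hx.symm
  · intro h χ hχ
    have e : uc = u := by
      apply Lp.ext
      filter_upwards [huc, h] with x hx h1
      rw [hx, Complex.conj_eq_iff_im.mpr h1]
    rw [← Complex.conj_eq_iff_im, key χ hχ, e]

/-- Real `L²` functions are those with Hermitian Fourier transform. -/
theorem hermitian_fourier_iff (u : L2) : Hermitian (𝓕 u) ↔ ∀ᵐ x, (u x).im = 0 := by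
  rw [← isReal_toTemperedDistribution_iff, toTemperedDistribution_eq_distOf, isReal_distOf_iff]

theorem Hermitian.mulL {F : L2} (hF : Hermitian F) {m : ℝ → ℝ}
    (hm : BddMeas (fun x => (m x : ℂ))) (he : ∀ x, m (-x) = m x) :
    Hermitian (mulL (fun x => (m x : ℂ)) F) := by
  have h2 : ∀ᵐ x, NonlocalWave.mulL (fun x => (m x : ℂ)) F (-x) = (m (-x) : ℂ) * F (-x) :=
    (Measure.measurePreserving_neg volume).quasiMeasurePreserving.ae (mulL_ae hm F)
  filter_upwards [hF, mulL_ae hm F, h2] with x h1 h2 h3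
  rw [h3, h2, h1, he, map_mul, Complex.conj_ofReal]

/-! ### The Fourier side of the Sobolev spaces -/

/-- The weighted Fourier transform `(1 + η²)^(s/2) 𝓕 v(η)` of `v ∈ H^s(ℝ)`. -/
def hat (s : ℝ) : H s →ₗᵢ[ℝ] L2 where
  toFun v := 𝓕 (H.besselₗ s v)
  map_add' v w := by rw [map_add, FourierTransform.fourier_add]
  map_smul' c v := by
    rw [RingHom.id_apply, map_smul]
    exact ((Lp.fourierTransformₗᵢ ℝ ℂ).toContinuousLinearEquiv : L2 →L[ℂ] L2).map_smul_of_tower c _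
  norm_map' v := by
    change ‖𝓕 (H.besselₗ s v)‖ = ‖v‖
    rw [Lp.norm_fourier_eq]
    rfl

/-- The distribution `v ∈ H^s(ℝ)` is recovered from its weighted Fourier transform. -/
theorem dist_eq_distOf {s : ℝ} (v : H s) : v.dist = distOf s (hat s v) := by
  rw [distOf_eq]
  have h : (𝓕⁻ (hat s v) : L2) = v.bessel := FourierTransform.fourierInv_fourier_eq _
  rw [h, ← H.bessel_spec]
  simp

theorem hermitian_hat {s : ℝ} (v : H s) : Hermitian (hat s v) := by
  rw [← isReal_distOf_iff s, ← dist_eq_distOf]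
  exact (Subtype.property (p := fun w => w ∈ sobolevSubmodule s) v).2

/-- The range of `hat s` consists of all Hermitian functions in `L²`. -/
theorem exists_hat_eq (s : ℝ) {F : L2} (hF : Hermitian F) : ∃ v : H s, hat s v = F := by
  have hm : distOf s F ∈ sobolevSubmodule s := by
    refine ⟨⟨𝓕⁻ F, ?_⟩, (isReal_distOf_iff s F).mpr hF⟩
    rw [distOf_eq]
    simp
  let v : H s := ⟨distOf s F, hm⟩
  exact ⟨v, distOf_injective s ((dist_eq_distOf v).symm.trans rfl)⟩

/-! ### Translations, the continuous representative, and Fourier transforms of products -/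

theorem measurable_L2 (F : L2) : Measurable F := (Lp.stronglyMeasurable F).measurable

/-- The character `η ↦ exp(2πi h η)`. -/
def ech (h η : ℝ) : ℂ := (Real.fourierChar (h * η) : ℂ)

theorem norm_ech (h η : ℝ) : ‖ech h η‖ = 1 := Circle.norm_coe _

theorem continuous_ech : Continuous fun p : ℝ × ℝ => ech p.1 p.2 := by
  unfold ech
  exact continuous_subtype_val.comp (Real.continuous_fourierChar.comp continuous_mul)

theorem ech_eq (h η : ℝ) : ech h η = Complex.exp ((2 * Real.pi * η * h : ℝ) * Complex.I) := by
  rw [ech, Real.fourierChar_apply]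
  congr 2
  push_cast
  ring

theorem measurable_ech (h : ℝ) : Measurable (ech h) :=
  (continuous_ech.comp (by fun_prop : Continuous fun η : ℝ => (h, η))).measurable

theorem bddMeas_ech (h : ℝ) : BddMeas (ech h) :=
  .of_le (measurable_ech h) (C := 1) fun η => (norm_ech h η).le

theorem hasDerivAt_ech (h η : ℝ) :
    HasDerivAt (fun h => ech h η) ((2 * Real.pi * η * Complex.I) * ech h η) h := by
  simp only [ech_eq]
  have h1 : HasDerivAt (fun h : ℝ => ((2 * Real.pi * η * h : ℝ) : ℂ) * Complex.I)
      ((2 * Real.pi * η : ℝ) * Complex.I) h := by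
    have := ((hasDerivAt_id h).const_mul (2 * Real.pi * η)).ofReal_comp.mul_const Complex.I
    simpa using this
  have := h1.cexp
  convert this using 1
  push_cast
  ring

theorem norm_ech_sub_one_le (h η : ℝ) : ‖ech h η - 1‖ ≤ 2 * Real.pi * |η| * |h| := by
  rw [ech_eq, mul_comm _ Complex.I]
  refine (Real.norm_exp_I_mul_ofReal_sub_one_le).trans ?_
  rw [Real.norm_eq_abs, abs_mul, abs_mul, abs_of_pos (by positivity : 0 < 2 * Real.pi)]

theorem norm_ech_sub_one_le_two (h η : ℝ) : ‖ech h η - 1‖ ≤ 2 := by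
  refine (norm_sub_le _ _).trans ?_
  rw [norm_ech, norm_one]; norm_num

/-- The translation `u ↦ u(· + h)` on `L²`. -/
def shift (h : ℝ) (u : L2) : L2 :=
  Lp.compMeasurePreserving (fun x => x + h) (measurePreserving_add_right volume h) u

theorem shift_ae (h : ℝ) (u : L2) : ∀ᵐ x, shift h u x = u (x + h) :=
  Lp.coeFn_compMeasurePreserving u (measurePreserving_add_right volume h)

theorem fourier_compSubConst (χ : 𝓢(ℝ, ℂ)) (h x : ℝ) :
    (𝓕 (SchwartzMap.compSubConstCLM ℂ (-h) χ)) x = ech h x * (𝓕 χ) x := by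
  have := congrFun (VectorFourier.fourierIntegral_comp_add_right Real.fourierChar volume
    (innerₗ ℝ) (⇑χ) h) x
  have e : (⇑(SchwartzMap.compSubConstCLM ℂ (-h) χ)) = ⇑χ ∘ fun v => v + h := by
    ext v; simp
  rw [SchwartzMap.fourier_coe, e, SchwartzMap.fourier_coe]
  refine this.trans ?_
  rw [Circle.smul_def, smul_eq_mul, ech, innerₗ_apply_apply,
    show inner ℝ h x = h * x by simp [mul_comm]]
  rfl

/-- Translation by `h` multiplies the Fourier transform by the character `η ↦ exp(2πi h η)`. This is
carried over from Schwartz functions by density. -/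
theorem fourier_shift (h : ℝ) (u : L2) : 𝓕 (shift h u) = mulL (ech h) (𝓕 u) := by
  have hc : Continuous (shift h) := (Lp.isometry_compMeasurePreserving _).continuous
  refine DenseRange.induction_on (p := fun u : L2 => 𝓕 (shift h u) = mulL (ech h) (𝓕 u))
    (SchwartzMap.denseRange_toLpCLM (F := ℂ) (p := 2) (μ := (volume : Measure ℝ))
      ENNReal.ofNat_ne_top) u ?_ ?_
  · exact isClosed_eq ((Lp.fourierTransformₗᵢ ℝ ℂ).continuous.comp hc)
      ((mulL (ech h)).continuous.comp (Lp.fourierTransformₗᵢ ℝ ℂ).continuous)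
  · intro χ
    have h1 : shift h (χ.toLp 2) = (SchwartzMap.compSubConstCLM ℂ (-h) χ).toLp 2 := by
      apply Lp.ext
      have h2 := (measurePreserving_add_right volume h).quasiMeasurePreserving.ae
        (χ.coeFn_toLp 2 volume)
      filter_upwards [shift_ae h (χ.toLp 2), h2,
        (SchwartzMap.compSubConstCLM ℂ (-h) χ).coeFn_toLp 2 volume] with x h3 h4 h5
      rw [h3, h4, h5]
      simp
    change 𝓕 (shift h (χ.toLp 2)) = mulL (ech h) (𝓕 (χ.toLp 2))
    rw [h1, SchwartzMap.toLp_fourier_eq, SchwartzMap.toLp_fourier_eq]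
    apply Lp.ext
    filter_upwards [mulL_ae (bddMeas_ech h) ((𝓕 χ).toLp 2), (𝓕 χ).coeFn_toLp 2 volume,
      (𝓕 (SchwartzMap.compSubConstCLM ℂ (-h) χ)).coeFn_toLp 2 volume] with x h3 h4 h5
    rw [h3, h4, h5, fourier_compSubConst]

/-- The function `x ↦ ∫ exp(2πi x η) 𝓕 u(η) dη`, the continuous representative of `u ∈ L²` if
`𝓕 u` is integrable. -/
def crep (u : L2) (x : ℝ) : ℂ := ∫ η, ech x η * (𝓕 u) η

theorem norm_crep_le (u : L2) (x : ℝ) : ‖crep u x‖ ≤ ∫ η, ‖(𝓕 u) η‖ := by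
  refine (norm_integral_le_integral_norm _).trans_eq ?_
  simp [norm_ech]

theorem integrable_ech_mul {f : ℝ → ℂ} (hf : Integrable f) (x : ℝ) :
    Integrable fun η => ech x η * f η :=
  hf.bdd_mul (c := 1) (measurable_ech x).aestronglyMeasurable
    (ae_of_all _ fun η => (norm_ech x η).le)

theorem continuous_crep {u : L2} (hu : Integrable (𝓕 u : L2)) : Continuous (crep u) := by
  refine continuous_of_dominated (bound := fun η => ‖(𝓕 u) η‖)
    (fun x => (integrable_ech_mul hu x).1) (fun x => ae_of_all _ fun η => ?_) hu.norm
    (ae_of_all _ fun η => ?_)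
  · rw [norm_mul, norm_ech, one_mul]
  · exact (continuous_ech.comp (by fun_prop : Continuous fun x : ℝ => (x, η))).mul
      continuous_const

theorem ech_comm (x η : ℝ) : ech x η = ech η x := by rw [ech, ech, mul_comm]

theorem fourierInv_eq_ech (χ : 𝓢(ℝ, ℂ)) (η : ℝ) : (𝓕⁻ χ) η = ∫ x, ech η x * χ x := by
  rw [SchwartzMap.fourierInv_coe, Real.fourierInv_eq]
  refine integral_congr_ae (ae_of_all _ fun x => ?_)
  simp only [ech, Circle.smul_def, smul_eq_mul]
  rfl

/-- Fourier inversion for `u ∈ L²` with integrable Fourier transform. -/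
theorem ae_eq_crep {u : L2} (hu : Integrable (𝓕 u : L2)) : u =ᵐ[volume] crep u := by
  refine (isRegular_toTemperedDistribution u).ae_eq fun χ => ?_
  constructor
  · exact χ.integrable.bdd_mul (c := ∫ η, ‖(𝓕 u) η‖)
      (continuous_crep hu).aestronglyMeasurable (ae_of_all _ (norm_crep_le u))
  · rw [toTemperedDistribution_eq_distOf, distOf_apply]
    have hint : Integrable (fun p : ℝ × ℝ => ech p.1 p.2 * (χ p.1 * (𝓕 u) p.2)) :=
      (χ.integrable.mul_prod hu).bdd_mul (c := 1) continuous_ech.aestronglyMeasurable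
        (ae_of_all _ fun p => (norm_ech _ _).le)
    have h1 : ∀ η, (jb (-0) η : ℂ) * (𝓕 u) η * (𝓕⁻ χ) η =
        ∫ x, ech x η * (χ x * (𝓕 u) η) := fun η => by
      rw [fourierInv_eq_ech, neg_zero, jb_zero, Complex.ofReal_one, one_mul,
        ← integral_const_mul]
      refine integral_congr_ae (ae_of_all _ fun x => ?_)
      simp only [ech_comm η x]
      ring
    simp_rw [h1]
    refine (integral_integral_swap hint).symm.trans ?_
    refine integral_congr_ae (ae_of_all _ fun x => ?_)
    simp only [crep]
    rw [← integral_mul_const]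
    refine integral_congr_ae (ae_of_all _ fun η => ?_)
    simp only
    ring

/-- The modulus of continuity of the continuous representative is controlled by `𝓕 u` alone. -/
theorem norm_crep_add_sub_le {u : L2} (hu : Integrable (𝓕 u : L2)) (x h : ℝ) :
    ‖crep u (x + h) - crep u x‖ ≤ ∫ η, ‖ech h η - 1‖ * ‖(𝓕 u) η‖ := by
  rw [crep, crep, ← integral_sub (integrable_ech_mul hu _) (integrable_ech_mul hu _)]
  refine (norm_integral_le_integral_norm _).trans_eq ?_
  refine integral_congr_ae (ae_of_all _ fun η => ?_)
  have : ech (x + h) η = ech x η * ech h η := by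
    simp only [ech, add_mul, AddChar.map_add_eq_mul, Circle.coe_mul]
  simp only
  rw [this, ← norm_mul]
  have e : ech x η * ech h η * (𝓕 u) η - ech x η * (𝓕 u) η =
    ech x η * ((ech h η - 1) * (𝓕 u) η) := by ring
  rw [e, norm_mul, norm_ech, one_mul]

/-- The modulus of continuity of the continuous representative tends to `0`. -/
theorem tendsto_modulus {u : L2} (hu : Integrable (𝓕 u : L2)) :
    Tendsto (fun h => ∫ η, ‖ech h η - 1‖ * ‖(𝓕 u) η‖) (𝓝 0) (𝓝 0) := by
  have h0 : (∫ η, ‖ech 0 η - 1‖ * ‖(𝓕 u) η‖) = 0 := by simp [ech]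
  have h1 : Continuous fun h => ∫ η, ‖ech h η - 1‖ * ‖(𝓕 u) η‖ := by
    refine continuous_of_dominated (bound := fun η => 2 * ‖(𝓕 u) η‖)
      (fun h => (((measurable_ech h).sub_const 1).norm.mul
        (measurable_L2 _).norm).aestronglyMeasurable) (fun h => ae_of_all _ fun η => ?_)
      (hu.norm.const_mul 2) (ae_of_all _ fun η => ?_)
    · rw [norm_mul, norm_norm, norm_norm]
      exact mul_le_mul_of_nonneg_right (norm_ech_sub_one_le_two h η) (norm_nonneg _)
    · exact ((continuous_ech.comp (by fun_prop : Continuous fun x : ℝ => (x, η))).sub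
        continuous_const).norm.mul continuous_const
  simpa only [h0] using h1.tendsto 0

theorem bddMeas_crep {u : L2} (hu : Integrable (𝓕 u : L2)) : BddMeas (crep u) :=
  .of_le (continuous_crep hu).measurable (norm_crep_le u)

/-- Modulating `v` translates its Fourier transform; tested against `χ`. -/
theorem integral_ech_mul_fourier (v : L2) (χ : 𝓢(ℝ, ℂ)) (ζ : ℝ) :
    ∫ x, ech ζ x * (v x * (𝓕 χ) x) = ∫ ξ, (𝓕 v) (ξ - ζ) * χ ξ := by
  have h1 := (isRegular_toTemperedDistribution v (𝓕 (SchwartzMap.compSubConstCLM ℂ (-ζ) χ))).2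
  have h2 := (isRegular_toTemperedDistribution (𝓕 v) (SchwartzMap.compSubConstCLM ℂ (-ζ) χ)).2
  have h3 : Lp.toTemperedDistributionCLM ℂ (volume : Measure ℝ) 2 v
      (𝓕 (SchwartzMap.compSubConstCLM ℂ (-ζ) χ)) =
    Lp.toTemperedDistributionCLM ℂ (volume : Measure ℝ) 2 (𝓕 v)
      (SchwartzMap.compSubConstCLM ℂ (-ζ) χ) := by
    rw [← TemperedDistribution.fourier_apply]
    exact congrArg (fun T : 𝓢'(ℝ, ℂ) => T (SchwartzMap.compSubConstCLM ℂ (-ζ) χ))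
      (Lp.fourier_toTemperedDistribution_eq v)
  rw [h1, h2] at h3
  rw [← integral_sub_right_eq_self _ ζ] at h3
  calc _ = ∫ x, v x * (𝓕 (SchwartzMap.compSubConstCLM ℂ (-ζ) χ)) x := by
        refine integral_congr_ae (ae_of_all _ fun x => ?_)
        simp only [fourier_compSubConst]
        ring
    _ = _ := by
        rw [← integral_sub_right_eq_self _ ζ, h3, ← integral_sub_right_eq_self _ ζ]
        simp

theorem lintegral_mul_le_L2 (F G : L2) : ∫⁻ x, ‖F x‖ₑ * ‖G x‖ₑ ≤ ‖F‖ₑ * ‖G‖ₑ := by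
  have := ENNReal.lintegral_mul_le_Lp_mul_Lq volume (p := 2) (q := 2)
    ⟨by norm_num, by norm_num, by norm_num⟩ (measurable_L2 F).enorm.aemeasurable
    (measurable_L2 G).enorm.aemeasurable
  refine this.trans_eq ?_
  rw [Lp.enorm_def, Lp.enorm_def, eLpNorm_eq_lintegral_rpow_enorm_toReal (by norm_num) (by norm_num),
    eLpNorm_eq_lintegral_rpow_enorm_toReal (by norm_num) (by norm_num)]
  simp

theorem integrable_convolution_test {f : ℝ → ℂ} (hf : Integrable f) (hfm : Measurable f) (G : L2)
    (χ : 𝓢(ℝ, ℂ)) :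
    Integrable (fun p : ℝ × ℝ => f p.1 * G (p.2 - p.1) * χ p.2) := by
  have hG := measurable_L2 G
  have hm : Measurable fun p : ℝ × ℝ => f p.1 * G (p.2 - p.1) * χ p.2 := by
    have := χ.continuous.measurable
    fun_prop
  refine ⟨hm.aestronglyMeasurable, ?_⟩
  rw [hasFiniteIntegral_iff_enorm, Measure.volume_eq_prod, lintegral_prod _ hm.enorm.aemeasurable]
  calc ∫⁻ ζ, ∫⁻ ξ, ‖f ζ * G (ξ - ζ) * χ ξ‖ₑ
      ≤ ∫⁻ ζ, ‖f ζ‖ₑ * (‖G‖ₑ * ‖χ.toLp 2‖ₑ) := by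
        refine lintegral_mono fun ζ => ?_
        simp_rw [enorm_mul, mul_assoc]
        rw [lintegral_const_mul' _ _ enorm_ne_top]
        gcongr
        have h1 : ‖shift (-ζ) G‖ₑ = ‖G‖ₑ := by
          rw [← ofReal_norm, ← ofReal_norm]
          congr 1
          exact Lp.norm_compMeasurePreserving _ _
        refine le_trans (le_of_eq ?_) ((lintegral_mul_le_L2 (shift (-ζ) G) (χ.toLp 2)).trans_eq
          (by rw [h1]))
        refine lintegral_congr_ae ?_
        filter_upwards [shift_ae (-ζ) G, χ.coeFn_toLp 2 volume] with ξ h2 h3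
        rw [h2, h3, sub_eq_add_neg]
    _ = (∫⁻ ζ, ‖f ζ‖ₑ) * (‖G‖ₑ * ‖χ.toLp 2‖ₑ) := lintegral_mul_const'' _ hfm.enorm.aemeasurable
    _ < ∞ := ENNReal.mul_lt_top hf.2 (ENNReal.mul_lt_top enorm_lt_top enorm_lt_top)

theorem integral_crep_mul_aux (u v : L2) (χ : 𝓢(ℝ, ℂ)) :
    ∫ x, crep u x * v x * (𝓕 χ) x =
      ∫ x, ∫ ζ, ech x ζ * ((v x * (𝓕 χ) x) * (𝓕 u) ζ) := by
  refine integral_congr_ae (ae_of_all _ fun x => ?_)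
  simp only
  rw [crep, mul_assoc, ← integral_mul_const]
  refine integral_congr_ae (ae_of_all _ fun ζ => ?_)
  simp only
  ring

theorem integral_mul_test_aux (u v : L2) (χ : 𝓢(ℝ, ℂ)) :
    ∫ ζ, ∫ x, ech x ζ * ((v x * (𝓕 χ) x) * (𝓕 u) ζ) =
      ∫ ζ, (𝓕 u) ζ * ∫ ξ, (𝓕 v) (ξ - ζ) * χ ξ := by
  refine integral_congr_ae (ae_of_all _ fun ζ => ?_)
  simp only
  rw [← integral_ech_mul_fourier v χ ζ, ← integral_const_mul]
  refine integral_congr_ae (ae_of_all _ fun x => ?_)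
  simp only [ech_comm x ζ]
  ring

/-- The convolution formula for `𝓕 (u v)`, tested against `χ`. -/
theorem integral_crep_mul {u : L2} (hu : Integrable (𝓕 u : L2)) (v : L2) (χ : 𝓢(ℝ, ℂ)) :
    ∫ x, crep u x * v x * (𝓕 χ) x = ∫ ζ, (𝓕 u) ζ * ∫ ξ, (𝓕 v) (ξ - ζ) * χ ξ := by
  have hvχ : Integrable fun x => v x * (𝓕 χ) x := (isRegular_toTemperedDistribution v (𝓕 χ)).1
  have hint2 : Integrable (fun p : ℝ × ℝ => ech p.1 p.2 * ((v p.1 * (𝓕 χ) p.1) * (𝓕 u) p.2)) :=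
    (hvχ.mul_prod hu).bdd_mul (c := 1) continuous_ech.aestronglyMeasurable
      (ae_of_all _ fun p => (norm_ech _ _).le)
  rw [integral_crep_mul_aux, ← integral_mul_test_aux]
  exact integral_integral_swap hint2

theorem toTemperedDistribution_fourier_apply (v : L2) (χ : 𝓢(ℝ, ℂ)) :
    Lp.toTemperedDistributionCLM ℂ (volume : Measure ℝ) 2 (𝓕 v) χ = ∫ x, v x * (𝓕 χ) x := by
  rw [← (isRegular_toTemperedDistribution v (𝓕 χ)).2, ← TemperedDistribution.fourier_apply]
  exact congrArg (fun T : 𝓢'(ℝ, ℂ) => T χ) (Lp.fourier_toTemperedDistribution_eq v).symm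

/-- The Fourier transform of a product is the convolution of the Fourier transforms. -/
theorem fourier_mulL_crep {u : L2} (hu : Integrable (𝓕 u : L2)) (v : L2) :
    ∀ᵐ ξ, (𝓕 (mulL (crep u) v)) ξ = ∫ ζ, (𝓕 u) ζ * (𝓕 v) (ξ - ζ) := by
  refine (isRegular_toTemperedDistribution (𝓕 (mulL (crep u) v))).ae_eq fun χ => ?_
  have hint := integrable_convolution_test hu (measurable_L2 _) (𝓕 v) χ
  have e1 : (fun ξ => (∫ ζ, (𝓕 u) ζ * (𝓕 v) (ξ - ζ)) * χ ξ) =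
      fun ξ => ∫ ζ, (𝓕 u) ζ * (𝓕 v) (ξ - ζ) * χ ξ := by
    ext ξ
    rw [integral_mul_const]
  rw [e1]
  have h1 : Integrable (fun ξ => ∫ ζ, (𝓕 u) ζ * (𝓕 v) (ξ - ζ) * χ ξ) := hint.integral_prod_right
  refine ⟨h1, ?_⟩
  have h2 : (∫ ζ, ∫ ξ, (𝓕 u) ζ * (𝓕 v) (ξ - ζ) * χ ξ) =
      ∫ ξ, ∫ ζ, (𝓕 u) ζ * (𝓕 v) (ξ - ζ) * χ ξ := integral_integral_swap hint
  rw [← h2, toTemperedDistribution_fourier_apply]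
  have h3 : (∫ x, (mulL (crep u) v) x * (𝓕 χ) x) = ∫ x, crep u x * v x * (𝓕 χ) x := by
    refine integral_congr_ae ?_
    filter_upwards [mulL_ae (bddMeas_crep hu) v] with x hx
    rw [hx]
  rw [h3, integral_crep_mul hu]
  refine integral_congr_ae (ae_of_all _ fun ζ => ?_)
  simp only [mul_assoc]
  rw [integral_const_mul]

/-! ### Weighted norms, the Sobolev embedding and the product estimate -/

/-- The weighted norm `‖(1 + η²)^(a/2) F‖` in `L²`, possibly infinite. For `F = 𝓕 u` this is the
Sobolev norm of order `a` of `u`. -/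
def wNorm (a : ℝ) (F : L2) : ℝ≥0∞ := eLpNorm (fun η => (jb a η : ℂ) * F η) 2 volume

theorem enorm_jb (a η : ℝ) : ‖(jb a η : ℂ)‖ₑ = ENNReal.ofReal (jb a η) := by
  rw [← ofReal_norm, Complex.norm_real, Real.norm_of_nonneg (jb_pos _ _).le]

theorem ofReal_jb_sq (a η : ℝ) : ENNReal.ofReal (jb a η) ^ 2 = ENNReal.ofReal (jb (2 * a) η) := by
  rw [← ENNReal.ofReal_pow (jb_pos _ _).le, two_mul, jb_add, sq]

theorem eLpNorm_two_sq (f : ℝ → ℂ) : eLpNorm f 2 volume ^ 2 = ∫⁻ x, ‖f x‖ₑ ^ 2 := by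
  rw [eLpNorm_eq_lintegral_rpow_enorm_toReal (by norm_num) (by norm_num)]
  rw [← ENNReal.rpow_natCast, ← ENNReal.rpow_mul]
  simp

theorem enorm_sq_eq (F : L2) : ‖F‖ₑ ^ 2 = ∫⁻ x, ‖F x‖ₑ ^ 2 := by
  rw [Lp.enorm_def, eLpNorm_two_sq]

theorem enorm_fourier (u : L2) : ‖(𝓕 u : L2)‖ₑ = ‖u‖ₑ := by
  rw [← ofReal_norm, ← ofReal_norm, Lp.norm_fourier_eq]

theorem wNorm_sq (a : ℝ) (F : L2) :
    wNorm a F ^ 2 = ∫⁻ η, ENNReal.ofReal (jb (2 * a) η) * ‖F η‖ₑ ^ 2 := by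
  rw [wNorm, eLpNorm_two_sq]
  refine lintegral_congr fun η => ?_
  rw [enorm_mul, enorm_jb, mul_pow, ofReal_jb_sq]

theorem le_of_sq_le_sq {x y : ℝ≥0∞} (h : x ^ 2 ≤ y ^ 2) : x ≤ y :=
  (ENNReal.pow_le_pow_left_iff two_ne_zero).mp h

theorem wNorm_mono {a b : ℝ} (h : a ≤ b) (F : L2) : wNorm a F ≤ wNorm b F := by
  apply le_of_sq_le_sq
  rw [wNorm_sq, wNorm_sq]
  gcongr
  exact jb_mono (by linarith) _

theorem wNorm_zero (F : L2) : wNorm 0 F = ‖F‖ₑ := by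
  rw [wNorm, Lp.enorm_def]; simp

/-- The Cauchy-Schwarz inequality. -/
theorem lintegral_mul_sq_le {f g : ℝ → ℝ≥0∞} (hf : Measurable f) (hg : Measurable g) :
    (∫⁻ x, f x * g x) ^ 2 ≤ (∫⁻ x, f x ^ 2) * ∫⁻ x, g x ^ 2 := by
  have := ENNReal.lintegral_mul_le_Lp_mul_Lq volume (p := 2) (q := 2)
    ⟨by norm_num, by norm_num, by norm_num⟩ hf.aemeasurable hg.aemeasurable
  calc _ ≤ ((∫⁻ x, f x ^ (2 : ℝ)) ^ (1 / 2 : ℝ) * (∫⁻ x, g x ^ (2 : ℝ)) ^ (1 / 2 : ℝ)) ^ 2 := by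
        gcongr; exact this
    _ = _ := by
      rw [mul_pow, ← ENNReal.rpow_natCast, ← ENNReal.rpow_natCast, ← ENNReal.rpow_mul,
        ← ENNReal.rpow_mul]
      simp

theorem lintegral_jb_lt_top {c : ℝ} (hc : 1 < c) : ∫⁻ η, ENNReal.ofReal (jb (-c) η) < ∞ := by
  have h : Integrable (fun x : ℝ => (1 + ‖x‖ ^ 2) ^ (-c / 2)) :=
    integrable_rpow_neg_one_add_norm_sq (by simpa using hc)
  exact h.lintegral_lt_top

/-- Sobolev embedding: the Fourier transforms of functions of order `a > 1/2` are integrable. -/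
theorem exists_lintegral_le_wNorm {a : ℝ} (ha : 1 / 2 < a) :
    ∃ C : ℝ≥0, ∀ F : L2, ∫⁻ η, ‖F η‖ₑ ≤ C * wNorm a F := by
  have hfin := lintegral_jb_lt_top (c := 2 * a) (by linarith)
  refine ⟨((∫⁻ η, ENNReal.ofReal (jb (-(2 * a)) η)) ^ (1 / 2 : ℝ)).toNNReal, fun F => ?_⟩
  rw [ENNReal.coe_toNNReal (ENNReal.rpow_lt_top_of_nonneg (by norm_num) hfin.ne).ne]
  apply le_of_sq_le_sq
  rw [mul_pow, ← ENNReal.rpow_natCast, ← ENNReal.rpow_natCast (_ ^ (1 / 2 : ℝ)),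
    ← ENNReal.rpow_mul, ENNReal.rpow_natCast, wNorm, eLpNorm_two_sq]
  have h1 : ∀ η, ‖F η‖ₑ = ENNReal.ofReal (jb (-a) η) * ‖(jb a η : ℂ) * F η‖ₑ := fun η => by
    rw [enorm_mul, ← mul_assoc, enorm_jb, ← ENNReal.ofReal_mul (jb_pos _ _).le, jb_neg_mul]
    simp
  have hF := measurable_L2 F
  have h2 := measurable_jb a
  calc (∫⁻ η, ‖F η‖ₑ) ^ 2
      = (∫⁻ η, ENNReal.ofReal (jb (-a) η) * ‖(jb a η : ℂ) * F η‖ₑ) ^ 2 := by simp_rw [← h1]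
    _ ≤ _ := lintegral_mul_sq_le (measurable_jb (-a)).ennreal_ofReal (by fun_prop)
    _ = _ := by
      simp only [ofReal_jb_sq, mul_neg]
      simp

/-- The pointwise bound behind the product estimate. The larger one of `|x|` and `|y|` is at least
`|x + y| / 2` and absorbs the weight of order `b`; the smaller one keeps a weight of order `-2a`,
which is integrable if `a > 1/2`. -/
theorem jb_kernel_le {a b : ℝ} (hb : 0 ≤ b) (hab : b ≤ a) (x y : ℝ) :
    jb (2 * b) (x + y) * jb (-(2 * a)) x * jb (-(2 * b)) y ≤
      4 ^ b * (jb (-(2 * a)) x + jb (-(2 * a)) y) := by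
  have e : 2 * b / 2 = b := by ring
  rcases le_total (y ^ 2) (x ^ 2) with hX | hX
  · have h1 : jb (2 * b) (x + y) ≤ 4 ^ b * jb (2 * b) x := by
      rw [jb_eq, jb_eq, e, ← Real.mul_rpow (by norm_num) (by positivity)]
      gcongr
      nlinarith [sq_nonneg (x - y)]
    have h2 : jb (-(2 * (a - b))) x ≤ jb (-(2 * (a - b))) y := by
      rw [jb_eq, jb_eq]
      exact Real.rpow_le_rpow_of_nonpos (by positivity) (by linarith) (by linarith)
    calc _ ≤ 4 ^ b * jb (2 * b) x * jb (-(2 * a)) x * jb (-(2 * b)) y := by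
          gcongr <;> exact (jb_pos _ _).le
      _ = 4 ^ b * (jb (-(2 * (a - b))) x * jb (-(2 * b)) y) := by
          have : jb (-(2 * (a - b))) x = jb (2 * b) x * jb (-(2 * a)) x := by
            rw [← jb_add]; congr 1; ring
          rw [this]; ring
      _ ≤ 4 ^ b * (jb (-(2 * (a - b))) y * jb (-(2 * b)) y) := by
          gcongr; exact (jb_pos _ _).le
      _ = 4 ^ b * jb (-(2 * a)) y := by
          rw [← jb_add]; congr 2; ring
      _ ≤ _ := by
          gcongr
          linarith [jb_pos (-(2 * a)) x]
  · have h1 : jb (2 * b) (x + y) ≤ 4 ^ b * jb (2 * b) y := by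
      rw [jb_eq, jb_eq, e, ← Real.mul_rpow (by norm_num) (by positivity)]
      gcongr
      nlinarith [sq_nonneg (x - y)]
    calc _ ≤ 4 ^ b * jb (2 * b) y * jb (-(2 * a)) x * jb (-(2 * b)) y := by
          gcongr <;> exact (jb_pos _ _).le
      _ = 4 ^ b * jb (-(2 * a)) x * (jb (2 * b) y * jb (-(2 * b)) y) := by ring
      _ = 4 ^ b * jb (-(2 * a)) x := by rw [jb_mul_neg, mul_one]
      _ ≤ _ := by
          gcongr
          linarith [jb_pos (-(2 * a)) y]

theorem lintegral_sub_left (f : ℝ → ℝ≥0∞) (ξ : ℝ) : ∫⁻ ζ, f (ξ - ζ) = ∫⁻ ζ, f ζ :=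
  lintegral_sub_left_eq_self f ξ

/-- A weighted Young inequality: Cauchy-Schwarz in `ζ` for each `ξ`, then Tonelli. -/
theorem lintegral_convolution_sq_le {A B p : ℝ → ℝ≥0∞} {k : ℝ → ℝ → ℝ≥0∞} {D : ℝ≥0∞}
    (hD : D ≠ ∞) (hA : Measurable A) (hB : Measurable B) (hk : ∀ ξ, Measurable (k ξ))
    (hkD : ∀ ξ, ∫⁻ ζ, k ξ ζ ^ 2 ≤ D) (hp : ∀ᵐ ξ, p ξ ≤ ∫⁻ ζ, k ξ ζ * (A ζ * B (ξ - ζ))) :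
    ∫⁻ ξ, p ξ ^ 2 ≤ D * ((∫⁻ ζ, A ζ ^ 2) * ∫⁻ ξ, B ξ ^ 2) := by
  have h1 : ∀ᵐ ξ, p ξ ^ 2 ≤ D * ∫⁻ ζ, A ζ ^ 2 * B (ξ - ζ) ^ 2 := by
    filter_upwards [hp] with ξ hξ
    have h2 := lintegral_mul_sq_le (hk ξ)
      (hA.mul (hB.comp (measurable_const.sub measurable_id) : Measurable fun ζ => B (ξ - ζ)))
    simp only [Pi.mul_apply, Function.comp_apply, mul_pow] at h2
    calc p ξ ^ 2 ≤ (∫⁻ ζ, k ξ ζ * (A ζ * B (ξ - ζ))) ^ 2 := by gcongr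
      _ ≤ _ := h2
      _ ≤ _ := by gcongr; exact hkD ξ
  have h3 : (∫⁻ ξ, ∫⁻ ζ, A ζ ^ 2 * B (ξ - ζ) ^ 2) = ∫⁻ ζ, ∫⁻ ξ, A ζ ^ 2 * B (ξ - ζ) ^ 2 :=
    lintegral_lintegral_swap
      (by fun_prop : Measurable fun p : ℝ × ℝ => A p.2 ^ 2 * B (p.1 - p.2) ^ 2).aemeasurable
  calc ∫⁻ ξ, p ξ ^ 2 ≤ ∫⁻ ξ, D * ∫⁻ ζ, A ζ ^ 2 * B (ξ - ζ) ^ 2 := lintegral_mono_ae h1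
    _ = D * ∫⁻ ζ, ∫⁻ ξ, A ζ ^ 2 * B (ξ - ζ) ^ 2 := by
        rw [lintegral_const_mul' _ _ hD, h3]
    _ = D * ∫⁻ ζ, A ζ ^ 2 * ∫⁻ ξ, B ξ ^ 2 := by
        congr 1
        refine lintegral_congr fun ζ => ?_
        rw [lintegral_const_mul _ (by fun_prop), lintegral_sub_right_eq_self (fun ξ => B ξ ^ 2)]
    _ = D * ((∫⁻ ζ, A ζ ^ 2) * ∫⁻ ξ, B ξ ^ 2) := by
        rw [lintegral_mul_const _ (by fun_prop)]

/-- The weighted convolution as an integral operator with the kernel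
`(1 + ξ²)^(b/2) (1 + ζ²)^(-a/2) (1 + (ξ-ζ)²)^(-b/2)` on the product of the weighted functions. -/
theorem enorm_convolution_le (a b : ℝ) (F G : L2) (ξ : ℝ) :
    ‖(jb b ξ : ℂ) * ∫ ζ, F ζ * G (ξ - ζ)‖ₑ ≤
      ∫⁻ ζ, ENNReal.ofReal (jb b ξ * jb (-a) ζ * jb (-b) (ξ - ζ)) *
        (‖(jb a ζ : ℂ) * F ζ‖ₑ * ‖(jb b (ξ - ζ) : ℂ) * G (ξ - ζ)‖ₑ) := by
  rw [enorm_mul, enorm_jb]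
  refine (mul_le_mul_right (enorm_integral_le_lintegral_enorm _) _).trans_eq ?_
  rw [← lintegral_const_mul' _ _ ENNReal.ofReal_ne_top]
  refine lintegral_congr fun ζ => ?_
  rw [enorm_mul, enorm_mul, enorm_mul, enorm_jb, enorm_jb,
    ENNReal.ofReal_mul (mul_pos (jb_pos _ _) (jb_pos _ _)).le, ENNReal.ofReal_mul (jb_pos _ _).le]
  have e1 : ENNReal.ofReal (jb (-a) ζ) * ENNReal.ofReal (jb a ζ) = 1 := by
    rw [← ENNReal.ofReal_mul (jb_pos _ _).le, jb_neg_mul, ENNReal.ofReal_one]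
  have e2 : ENNReal.ofReal (jb (-b) (ξ - ζ)) * ENNReal.ofReal (jb b (ξ - ζ)) = 1 := by
    rw [← ENNReal.ofReal_mul (jb_pos _ _).le, jb_neg_mul, ENNReal.ofReal_one]
  calc _ = ENNReal.ofReal (jb b ξ) * (1 * 1 * (‖F ζ‖ₑ * ‖G (ξ - ζ)‖ₑ)) := by ring
    _ = ENNReal.ofReal (jb b ξ) * ((ENNReal.ofReal (jb (-a) ζ) * ENNReal.ofReal (jb a ζ)) *
          (ENNReal.ofReal (jb (-b) (ξ - ζ)) * ENNReal.ofReal (jb b (ξ - ζ))) *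
          (‖F ζ‖ₑ * ‖G (ξ - ζ)‖ₑ)) := by rw [e1, e2]
    _ = _ := by ring

/-- The kernel of `enorm_convolution_le` is square integrable in `ζ`, uniformly in `ξ`. -/
theorem lintegral_kernel_le {a b : ℝ} (hb : 0 ≤ b) (hab : b ≤ a) (ξ : ℝ) :
    ∫⁻ ζ, ENNReal.ofReal (jb b ξ * jb (-a) ζ * jb (-b) (ξ - ζ)) ^ 2 ≤
      ENNReal.ofReal (4 ^ b) * ((∫⁻ η, ENNReal.ofReal (jb (-(2 * a)) η)) +
        ∫⁻ η, ENNReal.ofReal (jb (-(2 * a)) η)) := by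
  calc _ ≤ ∫⁻ ζ, ENNReal.ofReal (4 ^ b) *
        (ENNReal.ofReal (jb (-(2 * a)) ζ) + ENNReal.ofReal (jb (-(2 * a)) (ξ - ζ))) := by
        refine lintegral_mono fun ζ => ?_
        rw [← ENNReal.ofReal_pow (mul_pos (mul_pos (jb_pos _ _) (jb_pos _ _)) (jb_pos _ _)).le,
          ← ENNReal.ofReal_add (jb_pos _ _).le (jb_pos _ _).le,
          ← ENNReal.ofReal_mul (by positivity)]
        apply ENNReal.ofReal_le_ofReal
        refine le_trans (le_of_eq ?_) (jb_kernel_le hb hab ζ (ξ - ζ))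
        rw [add_sub_cancel, mul_pow, mul_pow, sq, sq, sq, ← jb_add, ← jb_add, ← jb_add]
        ring_nf
    _ = _ := by
        rw [lintegral_const_mul' _ _ ENNReal.ofReal_ne_top, lintegral_add_left
          (measurable_jb _).ennreal_ofReal,
          lintegral_sub_left (fun ζ => ENNReal.ofReal (jb (-(2 * a)) ζ))]

/-- The product of functions of order `a > 1/2` and `b ∈ [0, a]` is of order `b`. -/
theorem exists_wNorm_mul_le {a b : ℝ} (ha : 1 / 2 < a) (hb : 0 ≤ b) (hab : b ≤ a) :
    ∃ D : ℝ≥0, ∀ u v : L2, Integrable (𝓕 u : L2) →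
      wNorm b (𝓕 (mulL (crep u) v)) ≤ D * (wNorm a (𝓕 u) * wNorm b (𝓕 v)) := by
  have hfin := lintegral_jb_lt_top (c := 2 * a) (by linarith)
  obtain ⟨D₀, hD₀⟩ : ∃ D₀ : ℝ≥0∞, D₀ = ENNReal.ofReal (4 ^ b) *
    ((∫⁻ η, ENNReal.ofReal (jb (-(2 * a)) η)) + ∫⁻ η, ENNReal.ofReal (jb (-(2 * a)) η)) := ⟨_, rfl⟩
  have hD₀fin : D₀ ≠ ∞ := hD₀ ▸ ENNReal.mul_ne_top ENNReal.ofReal_ne_top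
    (ENNReal.add_ne_top.mpr ⟨hfin.ne, hfin.ne⟩)
  refine ⟨(D₀ ^ (1 / 2 : ℝ)).toNNReal, fun u v hu => ?_⟩
  rw [ENNReal.coe_toNNReal (ENNReal.rpow_lt_top_of_nonneg (by norm_num) hD₀fin).ne]
  apply le_of_sq_le_sq
  have hD₀sq : (D₀ ^ (1 / 2 : ℝ)) ^ 2 = D₀ := by
    rw [← ENNReal.rpow_natCast, ← ENNReal.rpow_mul]; simp
  rw [mul_pow, mul_pow, hD₀sq, wNorm, wNorm, wNorm, eLpNorm_two_sq, eLpNorm_two_sq,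
    eLpNorm_two_sq]
  have hum := measurable_L2 (𝓕 u)
  have hvm := measurable_L2 (𝓕 v)
  have h0 := measurable_jb a
  have h1 := measurable_jb (-a)
  have h2 := measurable_jb (-b)
  have h3 := measurable_jb b
  refine lintegral_convolution_sq_le
    (k := fun ξ ζ => ENNReal.ofReal (jb b ξ * jb (-a) ζ * jb (-b) (ξ - ζ)))
    hD₀fin (by fun_prop) (by fun_prop) (fun ξ => by fun_prop)
    (fun ξ => (lintegral_kernel_le hb hab ξ).trans_eq hD₀.symm) ?_
  filter_upwards [fourier_mulL_crep hu v] with ξ hξ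
  rw [hξ]
  exact enorm_convolution_le a b _ _ ξ

/-! ### The Gagliardo seminorm -/

/-- The symbol `∫₀^∞ h^(-1-2s) |exp(2πi h η) - 1|² dh` of the Gagliardo seminorm of order `s`, in which
it suffices to take `h > 0` as the integrand is even in `h`. -/
def gker (s η : ℝ) : ℝ≥0∞ :=
  ∫⁻ h in Ioi (0 : ℝ), ENNReal.ofReal (h ^ (-1 - 2 * s)) * ‖ech h η - 1‖ₑ ^ 2

/-- The upper bound for the symbol of the Gagliardo seminorm: `|exp(2πi h η) - 1|` is at most
`2π |η| h` for small `h` and at most `2` for large `h`. -/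
theorem gker_le {s : ℝ} (hs0 : 0 < s) (hs1 : s < 1) :
    ∃ C : ℝ≥0, ∀ η, gker s η ≤ C * ENNReal.ofReal (jb (2 * s) η) := by
  refine ⟨((2 * Real.pi) ^ 2 / (2 - 2 * s) + 4 / (2 * s)).toNNReal, fun η => ?_⟩
  have hJ := jb_pos 1 η
  set J := jb 1 η with hJdef
  have hJs : ∀ r : ℝ, J ^ r = jb r η := fun r => by
    rw [hJdef, jb, ← Real.rpow_mul (by positivity), jb]; congr 1; ring
  -- The two bounds for `|exp(2πi h η) - 1|` balance at `h` of order `(1 + η²)^(-1/2)`.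
  set δ : ℝ := J⁻¹ with hδ
  have hδ0 : 0 < δ := inv_pos.mpr hJ
  have hδr : ∀ r : ℝ, δ ^ r = J ^ (-r) := fun r => by
    rw [hδ, Real.inv_rpow hJ.le, Real.rpow_neg hJ.le]
  rw [gker, ← Ioc_union_Ioi_eq_Ioi hδ0.le]
  refine (lintegral_union_le _ _ _).trans ?_
  have A : ∫⁻ h in Ioc 0 δ, ENNReal.ofReal (h ^ (-1 - 2 * s)) * ‖ech h η - 1‖ₑ ^ 2 ≤
      ENNReal.ofReal ((2 * Real.pi) ^ 2 / (2 - 2 * s) * jb (2 * s) η) := by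
    have hint : IntegrableOn (fun h : ℝ => (2 * Real.pi * J) ^ 2 * h ^ (1 - 2 * s)) (Ioc 0 δ) := by
      have := (intervalIntegral.intervalIntegrable_rpow' (a := 0) (b := δ)
        (r := 1 - 2 * s) (by linarith)).const_mul ((2 * Real.pi * J) ^ 2)
      exact (intervalIntegrable_iff_integrableOn_Ioc_of_le hδ0.le).mp this
    calc _ ≤ ∫⁻ h in Ioc 0 δ, ENNReal.ofReal ((2 * Real.pi * J) ^ 2 * h ^ (1 - 2 * s)) := by
          refine setLIntegral_mono' measurableSet_Ioc fun h hh => ?_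
          have h0 : 0 < h := hh.1
          rw [← ofReal_norm, ← ENNReal.ofReal_pow (norm_nonneg _),
            ← ENNReal.ofReal_mul (by positivity)]
          apply ENNReal.ofReal_le_ofReal
          have h1 : ‖ech h η - 1‖ ≤ 2 * Real.pi * J * h := by
            refine (norm_ech_sub_one_le h η).trans ?_
            rw [abs_of_pos h0]
            gcongr
            exact abs_le_jb_one η
          have h2 : h ^ (1 - 2 * s) = h ^ (-1 - 2 * s) * h ^ 2 := by
            rw [← Real.rpow_natCast, ← Real.rpow_add h0]; congr 1; push_cast; ring
          calc _ ≤ h ^ (-1 - 2 * s) * (2 * Real.pi * J * h) ^ 2 := by gcongr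
            _ = _ := by rw [h2]; ring
      _ = ENNReal.ofReal (∫ h in Ioc 0 δ, (2 * Real.pi * J) ^ 2 * h ^ (1 - 2 * s)) := by
          rw [ofReal_integral_eq_lintegral_ofReal hint]
          filter_upwards [ae_restrict_mem measurableSet_Ioc] with h hh
          have h0 : 0 < h := hh.1
          change 0 ≤ _
          positivity
      _ = _ := by
          rw [integral_const_mul, ← intervalIntegral.integral_of_le hδ0.le,
            integral_rpow (Or.inl (by linarith)), Real.zero_rpow (by linarith), hδr, ← hJs]
          have e : J ^ (2 * s) = J ^ 2 * J ^ (-(1 - 2 * s + 1)) := by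
            rw [← Real.rpow_natCast, ← Real.rpow_add hJ]; congr 1; push_cast; ring
          rw [e]
          congr 1
          have : 1 - 2 * s + 1 = 2 - 2 * s := by ring
          rw [this]
          ring
  have B : ∫⁻ h in Ioi δ, ENNReal.ofReal (h ^ (-1 - 2 * s)) * ‖ech h η - 1‖ₑ ^ 2 ≤
      ENNReal.ofReal (4 / (2 * s) * jb (2 * s) η) := by
    have hint : IntegrableOn (fun h : ℝ => 4 * h ^ (-1 - 2 * s)) (Ioi δ) :=
      (integrableOn_Ioi_rpow_of_lt (by linarith) hδ0).const_mul 4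
    calc _ ≤ ∫⁻ h in Ioi δ, ENNReal.ofReal (4 * h ^ (-1 - 2 * s)) := by
          refine setLIntegral_mono' measurableSet_Ioi fun h hh => ?_
          have h0 : 0 < h := hδ0.trans hh
          rw [← ofReal_norm, ← ENNReal.ofReal_pow (norm_nonneg _),
            ← ENNReal.ofReal_mul (by positivity)]
          apply ENNReal.ofReal_le_ofReal
          have h1 := norm_ech_sub_one_le_two h η
          calc _ ≤ h ^ (-1 - 2 * s) * 2 ^ 2 := by gcongr
            _ = _ := by ring
      _ = ENNReal.ofReal (∫ h in Ioi δ, 4 * h ^ (-1 - 2 * s)) := by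
          rw [ofReal_integral_eq_lintegral_ofReal hint]
          filter_upwards [ae_restrict_mem measurableSet_Ioi] with h hh
          have h0 : 0 < h := hδ0.trans hh
          change 0 ≤ _
          positivity
      _ = _ := by
          rw [integral_const_mul, integral_Ioi_rpow_of_lt (by linarith) hδ0, hδr, ← hJs]
          congr 1
          have h1 : -(-1 - 2 * s + 1) = 2 * s := by ring
          have h2 : -1 - 2 * s + 1 = -(2 * s) := by ring
          rw [h1, h2]
          field_simp
  refine (add_le_add A B).trans_eq ?_
  have h1 : 0 ≤ (2 * Real.pi) ^ 2 / (2 - 2 * s) := div_nonneg (by positivity) (by linarith)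
  have h2 : 0 ≤ 4 / (2 * s) := by positivity
  rw [← ENNReal.ofReal_add (mul_nonneg h1 (jb_pos _ _).le) (mul_nonneg h2 (jb_pos _ _).le),
    ← add_mul, ENNReal.ofReal_mul (add_nonneg h1 h2)]
  rfl

theorem norm_ech_sub_one_sq (h η : ℝ) :
    ‖ech h η - 1‖ ^ 2 = 2 - 2 * Real.cos (2 * Real.pi * η * h) := by
  rw [ech_eq]
  generalize 2 * Real.pi * η * h = θ
  have h1 : (Complex.exp (θ * Complex.I) - 1).re = Real.cos θ - 1 := by
    simp [Complex.exp_ofReal_mul_I_re]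
  have h2 : (Complex.exp (θ * Complex.I) - 1).im = Real.sin θ := by
    simp [Complex.exp_ofReal_mul_I_im]
  rw [Complex.sq_norm, Complex.normSq_apply, h1, h2]
  nlinarith [Real.sin_sq_add_cos_sq θ]

/-- The lower bound for the symbol of the Gagliardo seminorm, from the range
`1/(4|η|) < h ≤ 1/(2|η|)`, where `cos (2π h η) ≤ 0` and hence `|exp(2πi h η) - 1|² ≥ 2`. -/
theorem le_gker {s : ℝ} (hs0 : 0 < s) (η : ℝ) : ENNReal.ofReal (|η| ^ (2 * s)) ≤ gker s η := by
  rcases eq_or_ne η 0 with rfl | hη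
  · rw [abs_zero, Real.zero_rpow (by positivity)]; simp
  have ha : 0 < |η| := abs_pos.mpr hη
  set a := |η| with hadef
  have hlt : 1 / (4 * a) ≤ 1 / (2 * a) := by gcongr; norm_num
  calc ENNReal.ofReal (a ^ (2 * s))
      ≤ ENNReal.ofReal ((2 * a) ^ (1 + 2 * s) * 2) * ENNReal.ofReal (1 / (2 * a) - 1 / (4 * a)) := by
        rw [← ENNReal.ofReal_mul (by positivity)]
        apply ENNReal.ofReal_le_ofReal
        rw [Real.rpow_add (by positivity), Real.rpow_one]
        have : 2 * a * (2 * a) ^ (2 * s) * 2 * (1 / (2 * a) - 1 / (4 * a)) = (2 * a) ^ (2 * s) := by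
          field_simp; ring
        rw [this]
        gcongr
        linarith
    _ = ∫⁻ _ in Ioc (1 / (4 * a)) (1 / (2 * a)), ENNReal.ofReal ((2 * a) ^ (1 + 2 * s) * 2) := by
        rw [setLIntegral_const, Real.volume_Ioc]
    _ ≤ ∫⁻ h in Ioc (1 / (4 * a)) (1 / (2 * a)),
          ENNReal.ofReal (h ^ (-1 - 2 * s)) * ‖ech h η - 1‖ₑ ^ 2 := by
        refine setLIntegral_mono' measurableSet_Ioc fun h hh => ?_
        have h0 : 0 < h := lt_trans (by positivity) hh.1
        rw [← ofReal_norm, ← ENNReal.ofReal_pow (norm_nonneg _),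
          ← ENNReal.ofReal_mul (by positivity)]
        apply ENNReal.ofReal_le_ofReal
        have hh1 : 1 ≤ 4 * a * h := by
          have := hh.1.le
          rw [div_le_iff₀ (by positivity)] at this
          linarith
        have hh2 : 2 * a * h ≤ 1 := by
          have := hh.2
          rw [le_div_iff₀ (by positivity)] at this
          linarith
        have h1 : 2 ≤ ‖ech h η - 1‖ ^ 2 := by
          rw [norm_ech_sub_one_sq, ← Real.cos_abs]
          have e : |2 * Real.pi * η * h| = 2 * Real.pi * a * h := by
            rw [abs_mul, abs_mul, abs_of_pos h0, abs_of_pos Real.two_pi_pos]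
          rw [e]
          have := Real.cos_nonpos_of_pi_div_two_le_of_le (x := 2 * Real.pi * a * h)
            (by nlinarith [Real.pi_pos]) (by nlinarith [Real.pi_pos])
          linarith
        have h2 : (2 * a) ^ (1 + 2 * s) ≤ h ^ (-1 - 2 * s) := by
          have e : -1 - 2 * s = -(1 + 2 * s) := by ring
          rw [e, Real.rpow_neg h0.le, ← Real.inv_rpow h0.le]
          gcongr
          rw [le_inv_comm₀ (by positivity) h0, ← one_div, le_div_iff₀ (by positivity)]
          linarith
        gcongr
    _ ≤ _ := by
        refine lintegral_mono_set fun h hh => ?_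
        exact lt_trans (by positivity : 0 < 1 / (4 * a)) hh.1

theorem jb_two_mul_le {s : ℝ} (hs0 : 0 < s) (hs1 : s < 1) (η : ℝ) :
    jb (2 * s) η ≤ 1 + |η| ^ (2 * s) := by
  have h := Real.rpow_add_le_add_rpow (p := s) zero_le_one (sq_nonneg η) hs0.le hs1.le
  rw [jb_eq, mul_div_cancel_left₀ s (two_ne_zero' ℝ)]
  refine h.trans_eq ?_
  rw [Real.one_rpow, Real.rpow_mul (abs_nonneg η)]
  congr 2
  rw [Real.rpow_two, sq_abs]

theorem enorm_shift_sub_sq (h : ℝ) (u : L2) :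
    ‖shift h u - u‖ₑ ^ 2 = ∫⁻ η, ‖ech h η - 1‖ₑ ^ 2 * ‖(𝓕 u) η‖ₑ ^ 2 := by
  have h2 : (𝓕 (shift h u - u) : L2) = mulL (ech h) (𝓕 u) - 𝓕 u := by
    rw [← fourier_shift]
    exact (Lp.fourierTransformₗᵢ ℝ ℂ).map_sub _ _
  rw [← enorm_fourier, h2, enorm_sq_eq]
  refine lintegral_congr_ae ?_
  filter_upwards [mulL_ae (bddMeas_ech h) (𝓕 u), Lp.coeFn_sub (mulL (ech h) (𝓕 u)) (𝓕 u)]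
    with η h3 h4
  rw [h4, Pi.sub_apply, h3, ← sub_one_mul, enorm_mul, mul_pow]

/-- The square of the Gagliardo seminorm of order `s` of `u`. -/
def gagliardo (s : ℝ) (u : L2) : ℝ≥0∞ :=
  ∫⁻ h in Ioi (0 : ℝ), ENNReal.ofReal (h ^ (-1 - 2 * s)) * ‖shift h u - u‖ₑ ^ 2

/-- The Gagliardo seminorm on the Fourier side, by Plancherel and Tonelli. -/
theorem gagliardo_eq (s : ℝ) (u : L2) :
    gagliardo s u = ∫⁻ η, gker s η * ‖(𝓕 u) η‖ₑ ^ 2 := by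
  have hu := measurable_L2 (𝓕 u)
  have he : Measurable fun p : ℝ × ℝ => ech p.1 p.2 := continuous_ech.measurable
  have h1 : ∀ h : ℝ, Measurable (ech h) := measurable_ech
  have h1' : ∀ η : ℝ, Measurable fun h => ech h η := fun η => by
    simp_rw [fun h => ech_comm h η]; exact measurable_ech η
  simp only [gagliardo, enorm_shift_sub_sq]
  have h2 : ∀ h : ℝ, ENNReal.ofReal (h ^ (-1 - 2 * s)) *
      (∫⁻ η, ‖ech h η - 1‖ₑ ^ 2 * ‖(𝓕 u) η‖ₑ ^ 2) =
      ∫⁻ η, ENNReal.ofReal (h ^ (-1 - 2 * s)) * ‖ech h η - 1‖ₑ ^ 2 * ‖(𝓕 u) η‖ₑ ^ 2 := by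
    intro h
    rw [← lintegral_const_mul' _ _ ENNReal.ofReal_ne_top]
    simp_rw [mul_assoc]
  simp_rw [h2]
  rw [lintegral_lintegral_swap]
  · refine lintegral_congr fun η => ?_
    rw [gker, lintegral_mul_const]
    have := h1' η
    fun_prop
  · exact (by fun_prop : Measurable fun p : ℝ × ℝ => ENNReal.ofReal (p.1 ^ (-1 - 2 * s)) *
      ‖ech p.1 p.2 - 1‖ₑ ^ 2 * ‖(𝓕 u) p.2‖ₑ ^ 2).aemeasurable

/-- Together with `gagliardo_le_wNorm_sq`: for `0 < s < 1` the Sobolev norm is equivalent to the `L²`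
norm plus the Gagliardo seminorm. -/
theorem wNorm_sq_le_gagliardo {s : ℝ} (hs0 : 0 < s) (hs1 : s < 1) (u : L2) :
    wNorm s (𝓕 u) ^ 2 ≤ ‖u‖ₑ ^ 2 + gagliardo s u := by
  have hu := measurable_L2 (𝓕 u)
  rw [wNorm_sq, ← enorm_fourier u, enorm_sq_eq, gagliardo_eq, ← lintegral_add_left (by fun_prop)]
  refine lintegral_mono fun η => ?_
  calc _ ≤ (1 + gker s η) * ‖(𝓕 u) η‖ₑ ^ 2 := by
        gcongr
        calc _ ≤ ENNReal.ofReal (1 + |η| ^ (2 * s)) :=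
              ENNReal.ofReal_le_ofReal (jb_two_mul_le hs0 hs1 η)
          _ = 1 + ENNReal.ofReal (|η| ^ (2 * s)) := by
              rw [ENNReal.ofReal_add zero_le_one (by positivity), ENNReal.ofReal_one]
          _ ≤ _ := by gcongr; exact le_gker hs0 η
    _ = _ := by rw [add_mul, one_mul]

theorem gagliardo_le_wNorm_sq {s : ℝ} (hs0 : 0 < s) (hs1 : s < 1) :
    ∃ C : ℝ≥0, ∀ u : L2, gagliardo s u ≤ C * wNorm s (𝓕 u) ^ 2 := by
  obtain ⟨C, hC⟩ := gker_le hs0 hs1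
  refine ⟨C, fun u => ?_⟩
  rw [gagliardo_eq, wNorm_sq, ← lintegral_const_mul' _ _ ENNReal.coe_ne_top]
  refine lintegral_mono fun η => ?_
  rw [← mul_assoc]
  gcongr
  exact hC η

/-- If `w` and its translation differences are bounded in `L²` by those of `u`, as is the case for
`w = f(u)` with `f` Lipschitz and `f(0) = 0`, then so is the Sobolev norm of order `s ∈ (0, 1)`. -/
theorem wNorm_le_of_lipschitz {s : ℝ} (hs0 : 0 < s) (hs1 : s < 1) :
    ∃ C : ℝ≥0, ∀ (M : ℝ≥0) (u w : L2), ‖w‖ₑ ≤ M * ‖u‖ₑ →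
      (∀ h, ‖shift h w - w‖ₑ ≤ M * ‖shift h u - u‖ₑ) →
      wNorm s (𝓕 w) ≤ C * M * wNorm s (𝓕 u) := by
  obtain ⟨C, hC⟩ := gagliardo_le_wNorm_sq hs0 hs1
  refine ⟨1 + C, fun M u w h1 h2 => ?_⟩
  have h3 : gagliardo s w ≤ (M : ℝ≥0∞) ^ 2 * gagliardo s u := by
    rw [gagliardo, gagliardo, ← lintegral_const_mul' _ _ (ENNReal.pow_ne_top ENNReal.coe_ne_top)]
    refine lintegral_mono fun h => ?_
    calc _ ≤ ENNReal.ofReal (h ^ (-1 - 2 * s)) * (M * ‖shift h u - u‖ₑ) ^ 2 := by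
          gcongr; exact h2 h
      _ = _ := by rw [mul_pow]; ring
  have h4 : ‖u‖ₑ ≤ wNorm s (𝓕 u) := by
    rw [← enorm_fourier, ← wNorm_zero]
    exact wNorm_mono hs0.le _
  apply le_of_sq_le_sq
  calc wNorm s (𝓕 w) ^ 2 ≤ ‖w‖ₑ ^ 2 + gagliardo s w := wNorm_sq_le_gagliardo hs0 hs1 w
    _ ≤ (M * wNorm s (𝓕 u)) ^ 2 + (M : ℝ≥0∞) ^ 2 * (C * wNorm s (𝓕 u) ^ 2) := by
        gcongr
        · exact h1.trans (by gcongr)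
        · exact h3.trans (by gcongr; exact hC u)
    _ = (1 + C) * (M * wNorm s (𝓕 u)) ^ 2 := by rw [mul_pow]; ring
    _ ≤ (1 + C) ^ 2 * (M * wNorm s (𝓕 u)) ^ 2 := by
        gcongr
        exact le_self_pow₀ (by simp) two_ne_zero
    _ = _ := by push_cast; rw [← mul_pow]; ring

/-! ### Superposition: orders below one and the chain rule -/

theorem enorm_le_of_ae_le {F G : L2} {M : ℝ≥0} (h : ∀ᵐ x, ‖F x‖ ≤ M * ‖G x‖) :
    ‖F‖ₑ ≤ M * ‖G‖ₑ := by
  rw [Lp.enorm_def, Lp.enorm_def]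
  exact eLpNorm_le_nnreal_smul_eLpNorm_of_ae_le_mul h 2

theorem wNorm_add_le (a : ℝ) (F G : L2) : wNorm a (F + G) ≤ wNorm a F + wNorm a G := by
  have h1 : wNorm a (F + G) = eLpNorm ((fun η => (jb a η : ℂ) * F η) +
      fun η => (jb a η : ℂ) * G η) 2 volume := by
    refine eLpNorm_congr_ae ?_
    filter_upwards [Lp.coeFn_add F G] with η h
    rw [h, Pi.add_apply, Pi.add_apply, mul_add]
  have hj := Complex.measurable_ofReal.comp (measurable_jb a)
  rw [h1]
  exact eLpNorm_add_le (hj.mul (measurable_L2 F)).aestronglyMeasurable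
    (hj.mul (measurable_L2 G)).aestronglyMeasurable (by norm_num)

theorem wNorm_le_of_ae_le {a b : ℝ} {F G : L2} {C : ℝ≥0}
    (h : ∀ᵐ η, jb a η * ‖F η‖ ≤ C * (jb b η * ‖G η‖)) : wNorm a F ≤ C * wNorm b G := by
  refine eLpNorm_le_nnreal_smul_eLpNorm_of_ae_le_mul (c := C) ?_ 2
  filter_upwards [h] with η hη
  rw [← NNReal.coe_le_coe]
  push_cast
  rw [norm_mul, norm_mul, Complex.norm_real, Complex.norm_real,
    Real.norm_of_nonneg (jb_pos _ _).le, Real.norm_of_nonneg (jb_pos _ _).le]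
  exact hη

theorem wNorm_mulL_le (a : ℝ) {m : ℝ → ℂ} (hm : Measurable m) {C : ℝ≥0} (hC : ∀ x, ‖m x‖ ≤ C)
    (F : L2) : wNorm a (mulL m F) ≤ C * wNorm a F := by
  refine wNorm_le_of_ae_le ?_
  filter_upwards [mulL_ae (.of_le hm hC) F] with η h
  rw [h, norm_mul]
  calc _ = ‖m η‖ * (jb a η * ‖F η‖) := by ring
    _ ≤ _ := mul_le_mul_of_nonneg_right (hC η) (mul_nonneg (jb_pos _ _).le (norm_nonneg _))

theorem wNorm_smul_le (a : ℝ) (c : ℂ) (F : L2) : wNorm a (c • F) ≤ ‖c‖₊ * wNorm a F := by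
  refine wNorm_le_of_ae_le ?_
  filter_upwards [Lp.coeFn_smul c F] with η h
  rw [h, Pi.smul_apply, norm_smul, coe_nnnorm]
  exact le_of_eq (by ring)

/-- A function of finite weighted norm is a weight times an `L²` function. -/
theorem exists_mulL_jb_eq {a : ℝ} (ha : 0 ≤ a) {F : L2} (hF : wNorm a F ≠ ∞) :
    ∃ Z : L2, F = mulL (fun η => (jb (-a) η : ℂ)) Z ∧ ‖Z‖ₑ = wNorm a F := by
  have hj := Complex.measurable_ofReal.comp (measurable_jb a)
  have hm : MemLp (fun η => (jb a η : ℂ) * F η) 2 :=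
    ⟨(hj.mul (measurable_L2 F)).aestronglyMeasurable, hF.lt_top⟩
  refine ⟨hm.toLp, ?_, ?_⟩
  · apply Lp.ext
    filter_upwards [mulL_ae (bddMeas_jb (neg_nonpos.mpr ha)) (hm.toLp), hm.coeFn_toLp] with η h1 h2
    rw [h1, h2, ← mul_assoc, ← Complex.ofReal_mul, jb_neg_mul, Complex.ofReal_one, one_mul]
  · rw [Lp.enorm_def]
    exact eLpNorm_congr_ae hm.coeFn_toLp

theorem wNorm_mulL_jb {a : ℝ} (ha : 0 ≤ a) (Z : L2) :
    wNorm a (mulL (fun η => (jb (-a) η : ℂ)) Z) = ‖Z‖ₑ := by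
  rw [Lp.enorm_def]
  refine eLpNorm_congr_ae ?_
  filter_upwards [mulL_ae (bddMeas_jb (neg_nonpos.mpr ha)) Z] with η h1
  rw [h1, ← mul_assoc, ← Complex.ofReal_mul, jb_mul_neg, Complex.ofReal_one, one_mul]

/-- Sobolev embedding: for `s > 1/2` the functions of order `s` are bounded and continuous. -/
theorem exists_norm_crep_le {s : ℝ} (hs : 1 / 2 < s) :
    ∃ C : ℝ≥0, ∀ (R : ℝ≥0) (u : L2), wNorm s (𝓕 u) ≤ R →
      Integrable (𝓕 u : L2) ∧ ∀ x, ‖crep u x‖ ≤ C * R := by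
  obtain ⟨C, hC⟩ := exists_lintegral_le_wNorm hs
  refine ⟨C, fun R u hu => ?_⟩
  have h1 : ∫⁻ η, ‖(𝓕 u) η‖ₑ ≤ C * R := (hC _).trans (by gcongr)
  have hi : Integrable (𝓕 u : L2) :=
    ⟨(measurable_L2 _).aestronglyMeasurable, h1.trans_lt (by finiteness)⟩
  refine ⟨hi, fun x => (norm_crep_le u x).trans ?_⟩
  rw [integral_norm_eq_lintegral_enorm hi.1]
  exact ENNReal.toReal_le_of_le_ofReal (by positivity) (h1.trans_eq (by
    rw [ENNReal.ofReal_mul (by positivity)]; simp))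

/-- `w = g(u) - g(0)` for the real part of `u`. Without the constant `g(0)` the superposition is in
`L²`, and the constant is annihilated by the derivatives in the equation. -/
def IsComp (g : ℝ → ℝ) (u w : L2) : Prop := ∀ᵐ x, w x = ((g (u x).re - g 0 : ℝ) : ℂ)

theorem exists_lipschitzOnWith {g : ℝ → ℝ} (hg : ContDiff ℝ 1 g) (K : ℝ) :
    ∃ M : ℝ≥0, LipschitzOnWith M g (Icc (-K) K) := by
  have hc : Continuous (deriv g) := hg.continuous_deriv le_rfl
  obtain ⟨M, hM⟩ := isCompact_Icc.exists_bound_of_continuousOn (s := Icc (-K) K) hc.continuousOn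
  refine ⟨M.toNNReal, (convex_Icc _ _).lipschitzOnWith_of_nnnorm_deriv_le
    (fun x _ => (hg.differentiable one_ne_zero).differentiableAt) fun x hx => ?_⟩
  rw [← NNReal.coe_le_coe]
  exact (hM x hx).trans (Real.le_coe_toNNReal M)

theorem norm_sub_le_of_lipschitz {g : ℝ → ℝ} {K : ℝ} {M : ℝ≥0}
    (hM : LipschitzOnWith M g (Icc (-K) K)) {a b : ℂ} (ha : ‖a‖ ≤ K) (hb : ‖b‖ ≤ K) :
    ‖((g a.re - g b.re : ℝ) : ℂ)‖ ≤ M * ‖a - b‖ := by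
  have h := hM.dist_le_mul a.re (abs_le.mp ((Complex.abs_re_le_norm a).trans ha)) b.re
    (abs_le.mp ((Complex.abs_re_le_norm b).trans hb))
  rw [Complex.norm_real]
  rw [Real.dist_eq, Real.dist_eq] at h
  refine h.trans ?_
  gcongr
  rw [← Complex.sub_re]
  exact Complex.abs_re_le_norm _

/-- For bounded `u ∈ L²` the function `g(u) - g(0)` is in `L²`, because `g` is Lipschitz on the range. -/
theorem exists_isComp {g : ℝ → ℝ} (hg : Continuous g) {K : ℝ} {M : ℝ≥0}
    (hM : LipschitzOnWith M g (Icc (-K) K)) {u : L2} (hK : 0 ≤ K) (hu : ∀ᵐ x, ‖u x‖ ≤ K) :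
    ∃ w : L2, IsComp g u w := by
  have hmem : MemLp (fun x => ((g (u x).re - g 0 : ℝ) : ℂ)) 2 := by
    refine (Lp.memLp u).of_le_mul (c := M) ?_ ?_
    · exact (Complex.measurable_ofReal.comp ((hg.measurable.comp
        (Complex.measurable_re.comp (measurable_L2 u))).sub_const _)).aestronglyMeasurable
    · filter_upwards [hu] with x hx
      simpa using norm_sub_le_of_lipschitz hM hx (b := 0) (by simpa using hK)
  exact ⟨hmem.toLp, hmem.coeFn_toLp⟩

/-- Boundedness of superposition in `H^s` for `1/2 < s < 1`: there `g` is Lipschitz on the range of `u`,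
and the Gagliardo seminorm only sees differences. -/
theorem wNorm_comp_le_of_lt_one {s : ℝ} (hs : 1 / 2 < s) (hs1 : s < 1) {g : ℝ → ℝ}
    (hg : ContDiff ℝ 1 g) (R : ℝ≥0) :
    ∃ C : ℝ≥0, ∀ u w : L2, IsComp g u w → wNorm s (𝓕 u) ≤ R → wNorm s (𝓕 w) ≤ C := by
  obtain ⟨C₁, hC₁⟩ := exists_norm_crep_le hs
  obtain ⟨M, hM⟩ := exists_lipschitzOnWith hg (C₁ * R)
  obtain ⟨C₂, hC₂⟩ := wNorm_le_of_lipschitz (by linarith) hs1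
  refine ⟨C₂ * M * R, fun u w hw hu => ?_⟩
  obtain ⟨hi, hb⟩ := hC₁ R u hu
  have hbd : ∀ᵐ x, ‖u x‖ ≤ C₁ * R := by
    filter_upwards [ae_eq_crep hi] with x hx
    rw [hx]; exact hb x
  have h1 : ‖w‖ₑ ≤ M * ‖u‖ₑ := by
    refine enorm_le_of_ae_le ?_
    filter_upwards [hw, hbd] with x h2 h3
    rw [h2]
    simpa using norm_sub_le_of_lipschitz hM h3 (b := 0) (by simp; positivity)
  have h2 : ∀ h, ‖shift h w - w‖ₑ ≤ M * ‖shift h u - u‖ₑ := fun h => by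
    refine enorm_le_of_ae_le ?_
    have q := (measurePreserving_add_right (volume : Measure ℝ) h).quasiMeasurePreserving
    filter_upwards [hw, hbd, q.ae hw, q.ae hbd, shift_ae h w, shift_ae h u,
      Lp.coeFn_sub (shift h w) w, Lp.coeFn_sub (shift h u) u] with x e1 e2 e3 e4 e5 e6 e7 e8
    rw [e7, e8, Pi.sub_apply, Pi.sub_apply, e5, e6, e1, e3, ← Complex.ofReal_sub,
      sub_sub_sub_cancel_right]
    exact norm_sub_le_of_lipschitz hM e4 e2
  calc _ ≤ C₂ * M * wNorm s (𝓕 u) := hC₂ M u w h1 h2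
    _ ≤ _ := by push_cast; gcongr

/-- The bounded symbol `2πi η (1 + η²)^(-1/2)`: the derivative after a Bessel potential of order `-1`. -/
def dsym (η : ℝ) : ℂ := 2 * Real.pi * η * Complex.I * jb (-1) η

theorem norm_deriv_symbol (η : ℝ) : ‖2 * (Real.pi : ℂ) * η * Complex.I‖ = 2 * Real.pi * |η| := by
  simp [abs_of_pos Real.pi_pos]

theorem abs_mul_jb_neg_one_le (η : ℝ) : |η| * jb (-1) η ≤ 1 := by
  calc |η| * jb (-1) η ≤ jb 1 η * jb (-1) η :=
        mul_le_mul_of_nonneg_right (abs_le_jb_one η) (jb_pos _ _).le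
    _ = 1 := jb_mul_neg 1 η

theorem norm_dsym_le (η : ℝ) : ‖dsym η‖ ≤ 2 * Real.pi := by
  rw [dsym, norm_mul, norm_deriv_symbol, Complex.norm_real, Real.norm_of_nonneg (jb_pos _ _).le,
    mul_assoc]
  exact mul_le_of_le_one_right (by positivity) (abs_mul_jb_neg_one_le η)

theorem measurable_dsym : Measurable dsym := by
  have := measurable_jb (-1)
  unfold dsym
  fun_prop

theorem bddMeas_dsym : BddMeas dsym := .of_le measurable_dsym norm_dsym_le

/-- The difference quotient `(u(· + h) - u)/h`. -/
def diffQuot (h : ℝ) (u : L2) : L2 := (h : ℂ)⁻¹ • (shift h u - u)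

theorem fourier_diffQuot (h : ℝ) (u : L2) :
    𝓕 (diffQuot h u) = mulL (fun η => (h : ℂ)⁻¹ * (ech h η - 1)) (𝓕 u) := by
  have h1 : BddMeas (fun _ => (1 : ℂ)) := .of_le measurable_const (C := 1) (by simp)
  have h2 : mulL (fun _ => (1 : ℂ)) (𝓕 u) = 𝓕 u := by
    apply Lp.ext
    filter_upwards [mulL_ae h1 (𝓕 u)] with x hx
    rw [hx, one_mul]
  have h3 : (𝓕 (shift h u - u) : L2) = mulL (ech h) (𝓕 u) - 𝓕 u := by
    rw [← fourier_shift]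
    exact (Lp.fourierTransformₗᵢ ℝ ℂ).map_sub _ _
  rw [mulL_const_mul _ ((bddMeas_ech h).sub h1), mulL_sub (bddMeas_ech h) h1, h2, ← h3, diffQuot]
  exact (Lp.fourierTransformₗᵢ ℝ ℂ).map_smul _ _

theorem tendsto_diffQuot_symbol (Z : L2) :
    Tendsto (fun h : ℝ => mulL (fun η => (h : ℂ)⁻¹ * (ech h η - 1) * jb (-1) η) Z) (𝓝[≠] 0)
      (𝓝 (mulL dsym Z)) := by
  have hj := measurable_jb (-1)
  refine tendsto_mulL (C := 2 * Real.pi) ?_ bddMeas_dsym (fun η => ?_) Z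
  · filter_upwards [self_mem_nhdsWithin] with h hh
    have hh' : 0 < |h| := abs_pos.mpr hh
    refine ⟨?_, fun η => ?_⟩
    · have := measurable_ech h
      fun_prop
    · rw [norm_mul, norm_mul, norm_inv, Complex.norm_real, Complex.norm_real, Real.norm_eq_abs,
        Real.norm_of_nonneg (jb_pos _ _).le]
      calc _ ≤ |h|⁻¹ * (2 * Real.pi * |η| * |h|) * jb (-1) η := by
            gcongr
            · exact (jb_pos _ _).le
            · exact norm_ech_sub_one_le h η
        _ = 2 * Real.pi * (|η| * jb (-1) η) := by field_simp
        _ ≤ 2 * Real.pi := mul_le_of_le_one_right (by positivity) (abs_mul_jb_neg_one_le η)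
  · have h1 := hasDerivAt_iff_tendsto_slope.mp (hasDerivAt_ech 0 η)
    have h2 : ech 0 η = 1 := by simp [ech]
    rw [h2, mul_one] at h1
    refine (h1.mul_const (jb (-1) η : ℂ)).congr fun h => ?_
    rw [slope_def_module, Complex.real_smul, h2]
    simp

/-- A function `u` of order `1` has a derivative in `L²`: the `L²` limit of its difference quotients,
with Fourier transform `2πi η 𝓕 u`. -/
theorem exists_deriv {u : L2} (hu : wNorm 1 (𝓕 u) ≠ ∞) :
    ∃ ux : L2, (∀ᵐ η : ℝ, (𝓕 ux) η = 2 * Real.pi * η * Complex.I * (𝓕 u) η) ∧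
      Tendsto (fun h => diffQuot h u) (𝓝[≠] 0) (𝓝 ux) := by
  obtain ⟨Z, hZ, -⟩ := exists_mulL_jb_eq zero_le_one hu
  refine ⟨𝓕⁻ (mulL dsym Z), ?_, ?_⟩
  · rw [FourierTransform.fourier_fourierInv_eq, hZ]
    filter_upwards [mulL_ae bddMeas_dsym Z, mulL_ae (bddMeas_jb (by norm_num : (-1 : ℝ) ≤ 0)) Z]
      with η h1 h2
    rw [h1, h2, dsym, mul_assoc]
  · have h1 := (Lp.fourierTransformₗᵢ ℝ ℂ).symm.continuous.continuousAt.tendsto.comp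
      (tendsto_diffQuot_symbol Z)
    refine h1.congr fun h => ?_
    have h2 : 𝓕 (diffQuot h u) = mulL (fun η => (h : ℂ)⁻¹ * (ech h η - 1) * jb (-1) η) Z := by
      have h1 : BddMeas (fun _ => (1 : ℂ)) := .of_le measurable_const (C := 1) (by simp)
      rw [fourier_diffQuot, hZ, mulL_mulL (((bddMeas_ech h).sub h1).const_mul _)
        (bddMeas_jb (by norm_num))]
    rw [Function.comp_apply, ← h2]
    exact (Lp.fourierTransformₗᵢ ℝ ℂ).symm_apply_apply (diffQuot h u)

/-- If the difference quotients of `w` converge in `L²`, the limit is the derivative of `w`. -/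
theorem fourier_eq_of_tendsto_diffQuot {w q : L2}
    (h : Tendsto (fun h => diffQuot h w) (𝓝[≠] 0) (𝓝 q)) :
    ∀ᵐ η : ℝ, (𝓕 q) η = 2 * Real.pi * η * Complex.I * (𝓕 w) η := by
  have hj : BddMeas (fun η => (jb (-1) η : ℂ)) := bddMeas_jb (by norm_num)
  have h1 := ((mulL (fun η => (jb (-1) η : ℂ))).continuous.comp
    (Lp.fourierTransformₗᵢ ℝ ℂ).continuous).continuousAt.tendsto.comp h
  have h2 : mulL (fun η => (jb (-1) η : ℂ)) (𝓕 q) = mulL dsym (𝓕 w) := by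
    refine tendsto_nhds_unique h1 ((tendsto_diffQuot_symbol (𝓕 w)).congr fun h => ?_)
    have h1 : BddMeas (fun _ => (1 : ℂ)) := .of_le measurable_const (C := 1) (by simp)
    change _ = mulL (fun η => (jb (-1) η : ℂ)) (𝓕 (diffQuot h w))
    rw [fourier_diffQuot, mulL_mulL hj (((bddMeas_ech h).sub h1).const_mul _)]
    congr 2
    ext η
    ring
  filter_upwards [mulL_ae hj (𝓕 q), mulL_ae bddMeas_dsym (𝓕 w)] with η e1 e2
  rw [h2, e2, dsym] at e1
  have : (jb (-1) η : ℂ) ≠ 0 := by exact_mod_cast (jb_pos _ _).ne'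
  apply mul_left_cancel₀ this
  rw [← e1]
  ring

/-- The first order Taylor remainder of `g` is bounded by the modulus of continuity of `g'`. -/
theorem abs_sub_sub_le_of_modulus {g : ℝ → ℝ} (hg : ContDiff ℝ 1 g) {K δ ε : ℝ}
    (hδ : ∀ a ∈ Icc (-K) K, ∀ b ∈ Icc (-K) K, |a - b| < δ → |deriv g a - deriv g b| ≤ ε)
    {a b : ℝ} (ha : a ∈ Icc (-K) K) (hb : b ∈ Icc (-K) K) (hab : |b - a| < δ) :
    |g b - g a - deriv g a * (b - a)| ≤ ε * |b - a| := by
  have hd : ∀ x ∈ uIcc a b, HasDerivWithinAt (fun y => g y - deriv g a * y)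
      (deriv g x - deriv g a) (uIcc a b) x := fun x _ => by
    have h1 := ((hg.differentiable one_ne_zero) x).hasDerivAt
    have h2 : HasDerivAt (fun y => deriv g a * y) (deriv g a) x := by
      simpa using (hasDerivAt_id x).const_mul (deriv g a)
    exact (h1.sub h2).hasDerivWithinAt
  have h := (convex_uIcc a b).norm_image_sub_le_of_norm_hasDerivWithin_le hd
    (C := ε) (fun x hx => ?_) left_mem_uIcc right_mem_uIcc
  · rw [Real.norm_eq_abs, Real.norm_eq_abs] at h
    convert h using 2
    ring
  · rw [Real.norm_eq_abs]
    refine hδ x ?_ a ha ?_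
    · exact (uIcc_subset_Icc ha hb) hx
    · have := abs_sub_left_of_mem_uIcc hx
      exact this.trans_lt hab

/-- The chain rule `g(u)ₓ = g'(u) uₓ`, with convergence of difference quotients in `L²`. As the
continuous representative of `u` is uniformly continuous, the Taylor remainder of `g` is `o(1)` times
the difference quotient of `u`, uniformly in `x`. -/
theorem tendsto_diffQuot_comp {u w ux : L2} {g : ℝ → ℝ} (hg : ContDiff ℝ 1 g)
    (hi : Integrable (𝓕 u : L2)) (hre : ∀ᵐ x, (u x).im = 0) (hw : IsComp g u w)
    (hux : Tendsto (fun h => diffQuot h u) (𝓝[≠] 0) (𝓝 ux))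
    (hb : BddMeas fun x => ((deriv g (crep u x).re : ℝ) : ℂ)) :
    Tendsto (fun h => diffQuot h w) (𝓝[≠] 0)
      (𝓝 (mulL (fun x => ((deriv g (crep u x).re : ℝ) : ℂ)) ux)) := by
  set G := fun x => ((deriv g (crep u x).re : ℝ) : ℂ) with hG
  set K : ℝ := ∫ η, ‖(𝓕 u) η‖ with hK
  have hKb : ∀ x, (crep u x).re ∈ Icc (-K) K := fun x =>
    abs_le.mp ((Complex.abs_re_le_norm _).trans (norm_crep_le u x))
  have h1 : Tendsto (fun h => mulL G (diffQuot h u)) (𝓝[≠] 0) (𝓝 (mulL G ux)) :=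
    (mulL G).continuous.continuousAt.tendsto.comp hux
  have hpt : ∀ ε : ℝ≥0, 0 < ε → ∀ᶠ h in 𝓝[≠] (0 : ℝ),
      ‖diffQuot h w - mulL G (diffQuot h u)‖ₑ ≤ ε * ‖diffQuot h u‖ₑ := by
    intro ε hε
    have huc : UniformContinuousOn (deriv g) (Icc (-K) K) :=
      isCompact_Icc.uniformContinuousOn_of_continuous (hg.continuous_deriv le_rfl).continuousOn
    obtain ⟨δ, hδ0, hδ⟩ := Metric.uniformContinuousOn_iff.mp huc ε (by exact_mod_cast hε)
    have hmod := (tendsto_modulus hi).eventually_lt_const hδ0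
    filter_upwards [hmod.filter_mono nhdsWithin_le_nhds] with h hh
    refine enorm_le_of_ae_le ?_
    have q := (measurePreserving_add_right (volume : Measure ℝ) h).quasiMeasurePreserving
    have hc := ae_eq_crep hi
    filter_upwards [hw, hc, hre, q.ae hw, q.ae hc, q.ae hre, shift_ae h w, shift_ae h u,
      Lp.coeFn_sub (shift h w) w, Lp.coeFn_sub (shift h u) u,
      Lp.coeFn_smul (h : ℂ)⁻¹ (shift h w - w), Lp.coeFn_smul (h : ℂ)⁻¹ (shift h u - u),
      Lp.coeFn_sub (diffQuot h w) (mulL G (diffQuot h u)), mulL_ae hb (diffQuot h u)]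
      with x e1 e2 e3 e4 e5 e6 e7 e8 e9 e10 e11 e12 e13 e14
    have ew : diffQuot h w x = (h : ℂ)⁻¹ * ((g (u (x + h)).re - g (u x).re : ℝ) : ℂ) := by
      change ((h : ℂ)⁻¹ • (shift h w - w)) x = _
      rw [e11, Pi.smul_apply, e9, Pi.sub_apply, e7, e4, e1, ← Complex.ofReal_sub,
        sub_sub_sub_cancel_right, smul_eq_mul]
    have eu : diffQuot h u x = (h : ℂ)⁻¹ * (((u (x + h)).re - (u x).re : ℝ) : ℂ) := by
      change ((h : ℂ)⁻¹ • (shift h u - u)) x = _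
      rw [e12, Pi.smul_apply, e10, Pi.sub_apply, e8, smul_eq_mul]
      congr 1
      apply Complex.ext <;> simp [e3, e6]
    have key := abs_sub_sub_le_of_modulus hg (K := K) (δ := δ) (ε := ε)
      (fun a ha b hb hab => (hδ a ha b hb hab).le) (hKb x) (hKb (x + h)) (by
        rw [← Complex.sub_re]
        exact (Complex.abs_re_le_norm _).trans_lt ((norm_crep_add_sub_le hi x h).trans_lt hh))
    rw [e13, Pi.sub_apply, e14, ew, eu]
    simp only [hG]
    rw [e2, e5]
    have e : (h : ℂ)⁻¹ * ((g (crep u (x + h)).re - g (crep u x).re : ℝ) : ℂ) -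
        ((deriv g (crep u x).re : ℝ) : ℂ) *
          ((h : ℂ)⁻¹ * (((crep u (x + h)).re - (crep u x).re : ℝ) : ℂ)) =
        (h : ℂ)⁻¹ * ((g (crep u (x + h)).re - g (crep u x).re -
          deriv g (crep u x).re * ((crep u (x + h)).re - (crep u x).re) : ℝ) : ℂ) := by
      push_cast; ring
    rw [e, norm_mul, norm_mul, Complex.norm_real, Complex.norm_real, Real.norm_eq_abs,
      Real.norm_eq_abs]
    calc _ ≤ ‖(h : ℂ)⁻¹‖ * (ε * |(crep u (x + h)).re - (crep u x).re|) := by gcongr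
      _ = _ := by ring
  have h2 : Tendsto (fun h => diffQuot h w - mulL G (diffQuot h u)) (𝓝[≠] 0) (𝓝 0) := by
    rw [Metric.tendsto_nhds]
    intro ε hε
    have hB : 0 < ‖ux‖ + 1 := by positivity
    have hbd := hux.norm.eventually_lt_const (lt_add_one ‖ux‖)
    have hε' : 0 < ε / (‖ux‖ + 1) := by positivity
    filter_upwards [hpt ⟨_, hε'.le⟩ hε', hbd] with h h3 h4
    rw [dist_zero_right]
    have h5 : ‖diffQuot h w - mulL G (diffQuot h u)‖ ≤ ε / (‖ux‖ + 1) * ‖diffQuot h u‖ := by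
      rw [← ofReal_norm, ← ofReal_norm] at h3
      rw [← ENNReal.ofReal_le_ofReal_iff (by positivity), ENNReal.ofReal_mul hε'.le]
      refine h3.trans_eq ?_
      congr 1
      rw [ENNReal.ofReal, Real.toNNReal_of_nonneg hε'.le]
      rfl
    calc _ ≤ ε / (‖ux‖ + 1) * ‖diffQuot h u‖ := h5
      _ < ε / (‖ux‖ + 1) * (‖ux‖ + 1) := by gcongr
      _ = ε := by field_simp
  simpa using h2.add h1

/-! ### Superposition: boundedness in every order above one half -/

theorem jb_one_le (η : ℝ) : jb 1 η ≤ 1 + |η| := by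
  have h : jb 1 η ^ 2 = 1 + η ^ 2 := by
    rw [← jb_two, sq, ← jb_add]; norm_num
  refine (le_abs_self _).trans (abs_le_of_sq_le_sq ?_ (by positivity))
  rw [h]
  nlinarith [abs_nonneg η, sq_abs η]

/-- A function is of order `s` if it and its derivative are of order `s - 1`. -/
theorem wNorm_le_add_deriv (s : ℝ) {F Q : L2}
    (h : ∀ᵐ η : ℝ, Q η = 2 * Real.pi * η * Complex.I * F η) :
    wNorm s F ≤ wNorm (s - 1) F + wNorm (s - 1) Q := by
  have hj := Complex.measurable_ofReal.comp (measurable_jb (s - 1))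
  have hF := (hj.mul (measurable_L2 F)).norm
  have hQ := (hj.mul (measurable_L2 Q)).norm
  have h1 : wNorm s F ≤ eLpNorm ((fun η => ‖(jb (s - 1) η : ℂ) * F η‖) +
      fun η => ‖(jb (s - 1) η : ℂ) * Q η‖) 2 volume := by
    refine eLpNorm_mono_ae ?_
    filter_upwards [h] with η hη
    rw [Pi.add_apply, norm_mul, norm_mul, norm_mul, hη, norm_mul, norm_deriv_symbol,
      Complex.norm_real, Complex.norm_real, Real.norm_of_nonneg (jb_pos _ _).le,
      Real.norm_of_nonneg (jb_pos _ _).le]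
    refine le_trans ?_ (le_abs_self _)
    have e : jb s η = jb (s - 1) η * jb 1 η := by rw [← jb_add]; simp
    have h2 : jb 1 η ≤ 1 + 2 * Real.pi * |η| := by
      have := jb_one_le η
      nlinarith [Real.pi_gt_three, abs_nonneg η]
    have h3 := mul_le_mul_of_nonneg_left h2
      (mul_nonneg (jb_pos (s - 1) η).le (norm_nonneg (F η)))
    rw [e]
    linarith
  refine h1.trans ((eLpNorm_add_le hF.aestronglyMeasurable hQ.aestronglyMeasurable
    (by norm_num)).trans_eq ?_)
  rw [eLpNorm_norm, eLpNorm_norm]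
  rfl

theorem wNorm_deriv_le (s : ℝ) {F Q : L2}
    (h : ∀ᵐ η : ℝ, Q η = 2 * Real.pi * η * Complex.I * F η) :
    wNorm (s - 1) Q ≤ (2 * Real.pi).toNNReal * wNorm s F := by
  refine wNorm_le_of_ae_le ?_
  filter_upwards [h] with η hη
  rw [hη, norm_mul, norm_deriv_symbol, Real.coe_toNNReal _ (by positivity)]
  have e : jb s η = jb (s - 1) η * jb 1 η := by rw [← jb_add]; simp
  have h3 := mul_le_mul_of_nonneg_left (abs_le_jb_one η)
    (mul_nonneg (jb_pos (s - 1) η).le (norm_nonneg (F η)))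
  have h4 := mul_le_mul_of_nonneg_left h3 (by positivity : 0 ≤ 2 * Real.pi)
  rw [e]
  linarith

/-- The inductive step in the order: `g(u)ₓ = (g'(u) - g'(0)) uₓ + g'(0) uₓ`, where `uₓ` is of order
`s - 1`, and `g'(u) - g'(0)` is by induction of order `a = max (s - 1) (3/4)`, so that the product
estimate with the orders `a > 1/2` and `s - 1 ≤ a` applies. -/
theorem wNorm_comp_le_succ {n : ℕ} {s : ℝ} (hns : (n : ℝ) + 1 ≤ s) (hsn : s < n + 2) {g : ℝ → ℝ}
    (hg : ContDiff ℝ ((n + 2 : ℕ) : ℕ∞) g)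
    (ih : ∀ a : ℝ, 1 / 2 < a → a < n + 1 → ∀ f : ℝ → ℝ, ContDiff ℝ ((n + 1 : ℕ) : ℕ∞) f →
      ∀ R : ℝ≥0, ∃ C : ℝ≥0, ∀ u w : L2, (∀ᵐ x, (u x).im = 0) → IsComp f u w →
        wNorm a (𝓕 u) ≤ R → wNorm a (𝓕 w) ≤ C) (R : ℝ≥0) :
    ∃ C : ℝ≥0, ∀ u w : L2, (∀ᵐ x, (u x).im = 0) → IsComp g u w →
      wNorm s (𝓕 u) ≤ R → wNorm s (𝓕 w) ≤ C := by
  have hn : (0 : ℝ) ≤ n := Nat.cast_nonneg n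
  -- The exponent `3/4` may be any number between `1/2` and `1`.
  obtain ⟨a, ha⟩ : ∃ a : ℝ, a = max (s - 1) (3 / 4) := ⟨_, rfl⟩
  have ha1 : 1 / 2 < a := by rw [ha]; exact lt_max_of_lt_right (by norm_num)
  have ha2 : a < n + 1 := by rw [ha]; exact max_lt (by linarith) (by linarith)
  have ha3 : s - 1 ≤ a := by rw [ha]; exact le_max_left _ _
  have ha4 : a ≤ s := by rw [ha]; exact max_le (by linarith) (by linarith)
  have hg' : ContDiff ℝ ((n + 1 : ℕ) : ℕ∞) (deriv g) := by
    have : ContDiff ℝ (((n + 1 : ℕ) : ℕ∞) + 1 : WithTop ℕ∞) g := by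
      convert hg using 1
      norm_cast
    exact (contDiff_succ_iff_deriv.mp this).2.2
  have hg1 : ContDiff ℝ 1 g := hg.of_le (by exact_mod_cast (by omega : 1 ≤ n + 2))
  have hg1' : ContDiff ℝ 1 (deriv g) := hg'.of_le (by exact_mod_cast (by omega : 1 ≤ n + 1))
  have hgn : ContDiff ℝ ((n + 1 : ℕ) : ℕ∞) g :=
    hg.of_le (by exact_mod_cast (by omega : n + 1 ≤ n + 2))
  obtain ⟨C₁, hC₁⟩ := ih a ha1 ha2 (deriv g) hg' R
  obtain ⟨C₂, hC₂⟩ := ih a ha1 ha2 g hgn R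
  obtain ⟨D, hD⟩ := exists_wNorm_mul_le ha1 (b := s - 1) (by linarith) ha3
  obtain ⟨E, hE⟩ := exists_norm_crep_le ha1
  refine ⟨C₂ + (D * (C₁ * ((2 * Real.pi).toNNReal * R)) +
    ‖((deriv g 0 : ℝ) : ℂ)‖₊ * ((2 * Real.pi).toNNReal * R)), fun u w hre hw hu => ?_⟩
  have hua : wNorm a (𝓕 u) ≤ R := (wNorm_mono ha4 _).trans hu
  obtain ⟨hi, hb⟩ := hE R u hua
  have hc := ae_eq_crep hi
  have hbd : ∀ᵐ x, ‖u x‖ ≤ E * R := by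
    filter_upwards [hc] with x hx
    rw [hx]; exact hb x
  obtain ⟨M, hM⟩ := exists_lipschitzOnWith hg1' (E * R)
  obtain ⟨z, hz⟩ := exists_isComp hg1'.continuous hM (by positivity) hbd
  have hza := hC₁ u z hre hz hua
  obtain ⟨hzi, -⟩ := hE C₁ z hza
  have hu1 : wNorm 1 (𝓕 u) ≠ ∞ :=
    (((wNorm_mono (by linarith : (1 : ℝ) ≤ s) _).trans hu).trans_lt ENNReal.coe_lt_top).ne
  obtain ⟨ux, hux, hlim⟩ := exists_deriv hu1
  have hGb : BddMeas fun x => ((deriv g (crep u x).re : ℝ) : ℂ) := by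
    obtain ⟨B, hB⟩ := isCompact_Icc.exists_bound_of_continuousOn
      (s := Icc (-(E * R : ℝ)) (E * R)) hg1'.continuous.continuousOn
    refine .ofReal (C := B) (hg1'.continuous.measurable.comp
      (Complex.measurable_re.comp (continuous_crep hi).measurable)) fun x => ?_
    exact hB _ (abs_le.mp ((Complex.abs_re_le_norm _).trans (hb x)))
  have hQ := fourier_eq_of_tendsto_diffQuot (tendsto_diffQuot_comp hg1 hi hre hw hlim hGb)
  have hW : wNorm (s - 1) (𝓕 ux) ≤ (2 * Real.pi).toNNReal * R :=
    (wNorm_deriv_le s hux).trans (by gcongr)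
  have hsplit : mulL (fun x => ((deriv g (crep u x).re : ℝ) : ℂ)) ux =
      mulL (crep z) ux + ((deriv g 0 : ℝ) : ℂ) • ux := by
    apply Lp.ext
    filter_upwards [mulL_ae hGb ux, mulL_ae (bddMeas_crep hzi) ux, ae_eq_crep hzi, hz, hc,
      Lp.coeFn_add (mulL (crep z) ux) (((deriv g 0 : ℝ) : ℂ) • ux),
      Lp.coeFn_smul ((deriv g 0 : ℝ) : ℂ) ux] with x e1 e2 e3 e4 e5 e6 e7
    rw [e6, Pi.add_apply, e7, Pi.smul_apply, e1, e2, ← e3, e4, e5, smul_eq_mul]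
    push_cast
    ring
  have hQn : wNorm (s - 1) (𝓕 (mulL (fun x => ((deriv g (crep u x).re : ℝ) : ℂ)) ux)) ≤
      D * (C₁ * ((2 * Real.pi).toNNReal * R)) +
        ‖((deriv g 0 : ℝ) : ℂ)‖₊ * ((2 * Real.pi).toNNReal * R) := by
    have e : (𝓕 (mulL (crep z) ux + ((deriv g 0 : ℝ) : ℂ) • ux) : L2) =
        𝓕 (mulL (crep z) ux) + ((deriv g 0 : ℝ) : ℂ) • 𝓕 ux := by
      rw [FourierTransform.fourier_add, FourierTransform.fourier_smul]
    rw [hsplit, e]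
    refine (wNorm_add_le _ _ _).trans (add_le_add ?_ ?_)
    · exact (hD z ux hzi).trans (by gcongr)
    · exact (wNorm_smul_le _ _ _).trans (by gcongr)
  refine (wNorm_le_add_deriv s hQ).trans ?_
  push_cast
  exact add_le_add ((wNorm_mono ha3 _).trans (hC₂ u w hre hw hua)) hQn

/-- The superposition operator `u ↦ g(u) - g(0)` is bounded on bounded subsets of `H^s`, `s > 1/2`,
if `g` is of class `C^([s]+1)`. Lipschitz bounds, which in the norm of `H^s` would in general need
a smoother `g`, are only used in `L²`. -/
theorem wNorm_comp_le (n : ℕ) : ∀ s : ℝ, 1 / 2 < s → s < n + 1 → ∀ g : ℝ → ℝ,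
    ContDiff ℝ ((n + 1 : ℕ) : ℕ∞) g → ∀ R : ℝ≥0, ∃ C : ℝ≥0, ∀ u w : L2,
      (∀ᵐ x, (u x).im = 0) → IsComp g u w → wNorm s (𝓕 u) ≤ R → wNorm s (𝓕 w) ≤ C := by
  induction n with
  | zero =>
    intro s hs hs1 g hg R
    obtain ⟨C, hC⟩ := wNorm_comp_le_of_lt_one hs (by simpa using hs1) (by simpa using hg) R
    exact ⟨C, fun u w _ hw hu => hC u w hw hu⟩
  | succ n ih =>
    intro s hs hs1 g hg R
    push_cast at hs1
    rcases lt_or_ge s (n + 1) with h | h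
    · exact ih s hs h g (hg.of_le (by exact_mod_cast (by omega : n + 1 ≤ n + 1 + 1))) R
    · exact wNorm_comp_le_succ h (by linarith) hg ih R

/-! ### Sobolev balls as closed convex subsets of `L²`, and the truncated nonlinearity -/

/-- The continuous real-linear map `F ↦ Im (𝓕⁻ F)`. Its kernel consists of the functions with Hermitian
symmetry, which therefore form a closed real subspace. -/
def imFourierInv : L2 →L[ℝ] Lp ℝ 2 (volume : Measure ℝ) :=
  (Complex.imCLM.compLpL 2 volume).comp
    ((FourierTransform.fourierInvCLM ℂ L2).restrictScalars ℝ)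

theorem hermitian_iff_imFourierInv (F : L2) : Hermitian F ↔ imFourierInv F = 0 := by
  have h := hermitian_fourier_iff (𝓕⁻ F)
  rw [FourierTransform.fourier_fourierInv_eq] at h
  have h1 : ∀ᵐ x, imFourierInv F x = ((𝓕⁻ F : L2) x).im :=
    ContinuousLinearMap.coeFn_compLpL Complex.imCLM (𝓕⁻ F : L2)
  rw [h, Lp.eq_zero_iff_ae_eq_zero]
  constructor
  · intro h2
    filter_upwards [h1, h2] with x e1 e2
    rw [e1, e2]; rfl
  · intro h2
    filter_upwards [h1, h2] with x e1 e2
    rw [← e1, e2]; rfl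

/-- The real functions `u` of Sobolev norm at most `R` of order `s`, in terms of `𝓕 u`. -/
def wBall (s : ℝ) (R : ℝ≥0) : Set L2 := {F | Hermitian F ∧ wNorm s F ≤ R}

/-- Sobolev balls are closed in `L²`: a convergent sequence has an almost everywhere convergent
subsequence, to which the lemma of Fatou applies. -/
theorem isClosed_wBall (s : ℝ) (R : ℝ≥0) : IsClosed (wBall s R) := by
  have h1 : IsClosed {F : L2 | Hermitian F} := by
    simp only [hermitian_iff_imFourierInv]
    exact isClosed_singleton.preimage imFourierInv.continuous
  suffices h2 : IsClosed {F : L2 | wNorm s F ≤ R} from h1.inter h2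
  rw [← isSeqClosed_iff_isClosed]
  intro F F₀ hF hlim
  obtain ⟨ns, -, hns⟩ := (tendstoInMeasure_of_tendsto_Lp hlim).exists_seq_tendsto_ae
  have hj := Complex.measurable_ofReal.comp (measurable_jb s)
  refine (Lp.eLpNorm_lim_le_liminf_eLpNorm
    (f := fun n η => (jb s η : ℂ) * F (ns n) η)
    (fun n => (hj.mul (measurable_L2 _)).aestronglyMeasurable) _ ?_).trans ?_
  · filter_upwards [hns] with x hx
    exact hx.const_mul _
  · exact liminf_le_of_frequently_le' (Frequently.of_forall fun n => hF (ns n))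

theorem wBall_mono {s : ℝ} {R R' : ℝ≥0} (h : R ≤ R') : wBall s R ⊆ wBall s R' :=
  fun _ hF => ⟨hF.1, hF.2.trans (by exact_mod_cast h)⟩

theorem add_mem_wBall {s : ℝ} {R R' : ℝ≥0} {F G : L2} (hF : F ∈ wBall s R)
    (hG : G ∈ wBall s R') : F + G ∈ wBall s (R + R') := by
  refine ⟨?_, (wNorm_add_le s F G).trans ?_⟩
  · rw [hermitian_iff_imFourierInv, map_add, (hermitian_iff_imFourierInv F).mp hF.1,
      (hermitian_iff_imFourierInv G).mp hG.1, add_zero]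
  · push_cast
    exact add_le_add hF.2 hG.2

theorem smul_mem_wBall {s : ℝ} {R : ℝ≥0} {F : L2} (hF : F ∈ wBall s R) (c : ℝ) :
    c • F ∈ wBall s (‖c‖₊ * R) := by
  refine ⟨?_, ?_⟩
  · rw [hermitian_iff_imFourierInv, map_smul, (hermitian_iff_imFourierInv F).mp hF.1, smul_zero]
  · have h := wNorm_smul_le s (c : ℂ) F
    have e : (c : ℂ) • F = c • F := algebraMap_smul ℂ c F
    rw [e] at h
    refine h.trans ?_
    rw [ENNReal.coe_mul, Complex.nnnorm_real]
    gcongr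
    exact hF.2

theorem sub_mem_wBall {s : ℝ} {R R' : ℝ≥0} {F G : L2} (hF : F ∈ wBall s R)
    (hG : G ∈ wBall s R') : F - G ∈ wBall s (R + R') := by
  have h := add_mem_wBall hF (smul_mem_wBall hG (-1))
  simpa [← sub_eq_add_neg] using h

theorem convex_wBall (s : ℝ) (R : ℝ≥0) : Convex ℝ (wBall s R) := by
  intro F hF G hG a b ha hb hab
  refine wBall_mono ?_ (add_mem_wBall (smul_mem_wBall hF a) (smul_mem_wBall hG b))
  rw [← add_mul, ← NNReal.coe_le_coe]
  push_cast
  rw [Real.norm_of_nonneg ha, Real.norm_of_nonneg hb, hab, one_mul]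

theorem mulL_mem_wBall {s : ℝ} {R C : ℝ≥0} {m : ℝ → ℝ} (hm : Measurable m)
    (hC : ∀ x, |m x| ≤ C) (he : ∀ x, m (-x) = m x) {F : L2} (hF : F ∈ wBall s R) :
    mulL (fun x => (m x : ℂ)) F ∈ wBall s (C * R) := by
  refine ⟨hF.1.mulL (.ofReal hm hC) he, ?_⟩
  refine (wNorm_mulL_le s (Complex.measurable_ofReal.comp hm) (C := C) (fun x => ?_) F).trans ?_
  · simpa using hC x
  · push_cast
    gcongr
    exact hF.2

/-- The integral of a function which has its values in a Sobolev ball, but is only continuous in `L²`.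
The average stays in the ball, which is convex and closed in `L²`. -/
theorem integral_mem_wBall {s : ℝ} {R : ℝ≥0} {f : ℝ → L2} (hf : Continuous f) {a b : ℝ}
    (hfR : ∀ t ∈ Icc a b, f t ∈ wBall s R) (hab : a ≤ b) :
    ∫ t in a..b, f t ∈ wBall s (‖b - a‖₊ * R) := by
  rcases hab.eq_or_lt with rfl | h
  · simp only [intervalIntegral.integral_same, sub_self, nnnorm_zero, zero_mul]
    exact ⟨by rw [hermitian_iff_imFourierInv, map_zero], by simpa using wNorm_smul_le s 0 0⟩
  have h1 : ⨍ t in Ioc a b, f t ∈ wBall s R := by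
    refine (convex_wBall s R).set_average_mem (isClosed_wBall s R) ?_ ?_ ?_ ?_
    · simp [h]
    · simp
    · exact (ae_restrict_mem measurableSet_Ioc).mono fun t ht => hfR t (Ioc_subset_Icc_self ht)
    · exact hf.integrableOn_Ioc
  have h2 := smul_mem_wBall h1 (b - a)
  have h3 : (⨍ t in a..b, f t) = (b - a)⁻¹ • ∫ t in a..b, f t := interval_average_eq f a b
  rw [uIoc_of_le hab] at h3
  rwa [h3, smul_smul, mul_inv_cancel₀ (sub_pos.mpr h).ne', one_smul] at h2

theorem jb_neg_mul_self_mem_wBall {s : ℝ} (hs : 0 ≤ s) {Z : L2} (hZ : Hermitian Z) :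
    mulL (fun η => (jb (-s) η : ℂ)) Z ∈ wBall s ‖Z‖₊ :=
  ⟨hZ.mulL (bddMeas_jb (neg_nonpos.mpr hs)) (jb_even _), (wNorm_mulL_jb hs Z).le⟩

theorem hermitian_of_mulL_jb {s : ℝ} (hs : 0 ≤ s) {Z : L2}
    (h : Hermitian (mulL (fun η => (jb (-s) η : ℂ)) Z)) : Hermitian Z := by
  rw [← isReal_distOf_iff (0 + s), ← distOf_mulL_jb hs 0 Z, isReal_distOf_iff]
  exact h

/-- The elements of a Sobolev ball in terms of their weighted Fourier transforms. -/
theorem exists_of_mem_wBall {s : ℝ} (hs : 0 ≤ s) {R : ℝ≥0} {F : L2} (hF : F ∈ wBall s R) :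
    ∃ Z : L2, Hermitian Z ∧ F = mulL (fun η => (jb (-s) η : ℂ)) Z ∧ ‖Z‖ ≤ R := by
  obtain ⟨Z, h1, h2⟩ := exists_mulL_jb_eq hs (F := F) (ne_top_of_le_ne_top coe_ne_top hF.2)
  refine ⟨Z, hermitian_of_mulL_jb hs (h1 ▸ hF.1), h1, ?_⟩
  have h3 := hF.2
  rw [← h2, enorm_le_coe] at h3
  exact h3

/-- The Fourier side of the map `u ↦ g(u) - g(0)` on bounded sets of `H^s`, extended
to a Lipschitz map of `L²` by truncating the argument of `g`: by the Sobolev embedding the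
truncation does not affect the ball. -/
theorem exists_nonlinearity {s : ℝ} (hs : 1 / 2 < s) {g : ℝ → ℝ}
    (hg : ContDiff ℝ ((⌊s⌋₊ + 1 : ℕ) : ℕ∞) g) (R : ℝ≥0) :
    ∃ (N : L2 → L2) (Λ C : ℝ≥0), LipschitzWith Λ N ∧
      (∀ U ∈ wBall s R, N U ∈ wBall s C) ∧
      ∀ U ∈ wBall s R, IsComp g (𝓕⁻ U) (𝓕⁻ (N U)) := by
  have hg1 : ContDiff ℝ 1 g := hg.of_le (by exact_mod_cast Nat.le_add_left 1 _)
  obtain ⟨C₁, hC₁⟩ := exists_norm_crep_le hs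
  obtain ⟨C, hC⟩ := wNorm_comp_le ⌊s⌋₊ s hs (Nat.lt_floor_add_one s) g hg R
  set K : ℝ := C₁ * R with hK
  have hK0 : 0 ≤ K := by positivity
  obtain ⟨M, hM⟩ := exists_lipschitzOnWith hg1 K
  -- The projection of `ℝ` onto `[-K, K]`, where `K` bounds the functions in the ball.
  let c : ℝ → ℝ := fun x => max (-K) (min K x)
  have hc : LipschitzWith 1 c := (LipschitzWith.id.const_min K).const_max (-K)
  have hcm : ∀ x, c x ∈ Icc (-K) K := fun x =>
    ⟨le_max_left _ _, max_le (by linarith) (min_le_left _ _)⟩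
  have hci : ∀ x, |x| ≤ K → c x = x := fun x hx => by
    rw [abs_le] at hx
    simp only [c]
    rw [min_eq_right hx.2, max_eq_right hx.1]
  let φ : ℂ → ℂ := fun z => ((g (c z.re) - g 0 : ℝ) : ℂ)
  have hφ : LipschitzWith M φ := by
    refine LipschitzWith.of_dist_le_mul fun z w => ?_
    have h1 := hM.dist_le_mul _ (hcm z.re) _ (hcm w.re)
    have h2 := hc.dist_le_mul z.re w.re
    rw [dist_eq_norm, ← Complex.ofReal_sub, sub_sub_sub_cancel_right, Complex.norm_real,
      ← dist_eq_norm]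
    refine h1.trans ?_
    gcongr
    refine h2.trans ?_
    rw [NNReal.coe_one, one_mul, Real.dist_eq, ← Complex.sub_re, dist_eq_norm]
    exact Complex.abs_re_le_norm _
  have hφ0 : φ 0 = 0 := by simp [φ, hci 0 (by simpa using hK0)]
  let N : L2 → L2 := fun U => 𝓕 (hφ.compLp hφ0 (𝓕⁻ U))
  have key : ∀ U ∈ wBall s R, IsComp g (𝓕⁻ U) (𝓕⁻ (N U)) := by
    intro U hU
    obtain ⟨hi, hb⟩ := hC₁ R (𝓕⁻ U) (by
      rw [FourierTransform.fourier_fourierInv_eq]; exact hU.2)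
    have e : (𝓕⁻ (N U) : L2) = hφ.compLp hφ0 (𝓕⁻ U) := FourierTransform.fourierInv_fourier_eq _
    rw [e]
    filter_upwards [hφ.coeFn_compLp hφ0 (𝓕⁻ U : L2), ae_eq_crep hi] with x h1 h2
    rw [h1]
    simp only [Function.comp_apply, φ]
    rw [hci]
    rw [h2]
    exact (Complex.abs_re_le_norm _).trans (hb x)
  have hre : ∀ u : L2, IsComp g (𝓕⁻ u) (𝓕⁻ (N u)) → Hermitian (N u) := fun u hu => by
    have h := hermitian_fourier_iff (𝓕⁻ (N u))
    rw [FourierTransform.fourier_fourierInv_eq] at h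
    rw [h]
    filter_upwards [hu] with x hx
    rw [hx, Complex.ofReal_im]
  refine ⟨N, M, C, ?_, fun U hU => ⟨hre U (key U hU), ?_⟩, key⟩
  · refine LipschitzWith.of_dist_le_mul fun U V => ?_
    have h1 := (hφ.lipschitzWith_compLp hφ0 (p := 2) (μ := volume)).dist_le_mul
      (𝓕⁻ U : L2) (𝓕⁻ V)
    have h2 : dist (𝓕⁻ U : L2) (𝓕⁻ V) = dist U V :=
      (Lp.fourierTransformₗᵢ ℝ ℂ).symm.isometry.dist_eq U V
    have h3 : dist (N U) (N V) = dist (hφ.compLp hφ0 (𝓕⁻ U : L2)) (hφ.compLp hφ0 (𝓕⁻ V : L2)) :=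
      (Lp.fourierTransformₗᵢ ℝ ℂ).isometry.dist_eq _ _
    rw [h3, ← h2]
    exact h1
  · have h := hermitian_fourier_iff (𝓕⁻ U)
    have h2 := hC (𝓕⁻ U) (𝓕⁻ (N U)) (by
      rw [← h, FourierTransform.fourier_fourierInv_eq]; exact hU.1) (key U hU)
    rw [FourierTransform.fourier_fourierInv_eq, FourierTransform.fourier_fourierInv_eq] at h2
    exact h2 hU.2

/-! ### The linear equation: phases and mild solutions -/

/-- Multiplication by a real symbol. -/
def rmul (f : ℝ → ℝ) : L2 →L[ℂ] L2 := mulL fun η => (f η : ℂ)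

/-- Real symbols `f` for which `rmul f` is the bounded operator of multiplication by `f`. -/
def BddR (f : ℝ → ℝ) : Prop := BddMeas fun η => (f η : ℂ)

theorem BddR.of_le {f : ℝ → ℝ} (hf : Measurable f) {A : ℝ} (h : ∀ η, |f η| ≤ A) : BddR f :=
  BddMeas.ofReal hf h

theorem BddR.mul {f g : ℝ → ℝ} (hf : BddR f) (hg : BddR g) : BddR fun η => f η * g η := by
  have h := BddMeas.mul hf hg
  unfold BddR
  push_cast
  exact h

theorem BddR.neg {f : ℝ → ℝ} (hf : BddR f) : BddR fun η => -f η := by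
  have h := (BddR.of_le (measurable_const (a := (-1 : ℝ))) (A := 1) (by simp)).mul hf
  simpa using h

theorem BddR.const_mul {f : ℝ → ℝ} (hf : BddR f) (c : ℝ) : BddR fun η => c * f η :=
  (BddR.of_le (measurable_const (a := c)) (A := |c|) (by simp)).mul hf

theorem rmul_rmul {f g : ℝ → ℝ} (hf : BddR f) (hg : BddR g) (F : L2) :
    rmul f (rmul g F) = rmul (fun η => f η * g η) F := by
  rw [rmul, rmul, rmul, mulL_mulL hf hg]
  push_cast
  rfl

theorem rmul_ae {f : ℝ → ℝ} (hf : BddR f) (F : L2) : ∀ᵐ η, rmul f F η = (f η : ℂ) * F η :=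
  mulL_ae hf F

theorem rmul_add {f g : ℝ → ℝ} (hf : BddR f) (hg : BddR g) (h : BddR fun η => f η + g η) (F : L2) :
    rmul f F + rmul g F = rmul (fun η => f η + g η) F := by
  apply Lp.ext
  filter_upwards [rmul_ae hf F, rmul_ae hg F, rmul_ae h F, Lp.coeFn_add (rmul f F) (rmul g F)]
    with η h1 h2 h3 h4
  rw [h4, Pi.add_apply, h1, h2, h3, Complex.ofReal_add, add_mul]

theorem rmul_neg {f : ℝ → ℝ} (hf : BddR f) (F : L2) :
    rmul (fun η => -f η) F = -rmul f F := by
  apply Lp.ext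
  filter_upwards [rmul_ae hf F, rmul_ae hf.neg F, Lp.coeFn_neg (rmul f F)] with η h1 h2 h3
  rw [h3, Pi.neg_apply, h1, h2, Complex.ofReal_neg, neg_mul]

theorem rmul_one (F : L2) : rmul (fun _ => 1) F = F := by
  apply Lp.ext
  filter_upwards [rmul_ae (.of_le (measurable_const (a := (1 : ℝ))) (A := 1) (by simp)) F] with η h1
  simpa using h1

theorem rmul_zero (F : L2) : rmul (fun _ => 0) F = 0 := by
  apply Lp.ext
  filter_upwards [rmul_ae (.of_le (measurable_const (a := 0)) (A := 0) (by simp)) F,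
    Lp.coeFn_zero ℂ 2 (volume : Measure ℝ)] with η h1 h2
  rw [h1, h2]; simp

theorem norm_rmul_le {f : ℝ → ℝ} (hf : Measurable f) {A : ℝ} (h : ∀ η, |f η| ≤ A) (F : L2) :
    ‖rmul f F‖ ≤ A * ‖F‖ :=
  norm_mulL_le (Complex.measurable_ofReal.comp hf) (fun η => by simpa using h η) F

theorem rmul_injective {f : ℝ → ℝ} (hf : BddR f) (h0 : ∀ η, f η ≠ 0) :
    Function.Injective (rmul f) :=
  mulL_injective hf fun η => by simpa using h0 η

theorem continuousOn_rmul {S : Set ℝ} {m : ℝ → ℝ → ℝ} {A : ℝ}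
    (hm : ∀ t ∈ S, Measurable (m t) ∧ ∀ η, |m t η| ≤ A) (hc : ∀ η, Continuous fun t => m t η)
    {F : ℝ → L2} (hF : ContinuousOn F S) : ContinuousOn (fun t => rmul (m t) (F t)) S :=
  continuousOn_mulL (fun t ht => ⟨Complex.measurable_ofReal.comp (hm t ht).1,
    fun η => by simpa using (hm t ht).2 η⟩) (fun η => Complex.continuous_ofReal.comp (hc η)) hF

theorem hasDerivWithinAt_rmul {S : Set ℝ} {t₀ : ℝ} (ht₀ : t₀ ∈ S) {m : ℝ → ℝ → ℝ} {m' : ℝ → ℝ}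
    {A : ℝ} (hm : ∀ t ∈ S, Measurable (m t) ∧ ∀ η, |m t η| ≤ A)
    (hlip : ∀ t ∈ S, ∀ η, |m t η - m t₀ η| ≤ A * |t - t₀|) (hm' : BddR m')
    (hd : ∀ η, HasDerivAt (fun t => m t η) (m' η) t₀)
    {F : ℝ → L2} {F' : L2} (hF : HasDerivWithinAt F F' S t₀) :
    HasDerivWithinAt (fun t => rmul (m t) (F t)) (rmul m' (F t₀) + rmul (m t₀) F') S t₀ :=
  hasDerivWithinAt_mulL ht₀ (fun t ht => ⟨Complex.measurable_ofReal.comp (hm t ht).1,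
    fun η => by simpa using (hm t ht).2 η⟩)
    (fun t ht η => by
      simp only [Function.comp_apply, ← Complex.ofReal_sub, Complex.norm_real]
      exact hlip t ht η) hm' (fun η => (hd η).ofReal_comp) hF

theorem abs_mul_le_of_le {a b A : ℝ} (ha : |a| ≤ A) (hb : |b| ≤ 1) : |a * b| ≤ A := by
  rw [abs_mul]
  exact (mul_le_of_le_one_right (abs_nonneg _) hb).trans ha

section Phase

/-! In the product rules below the time enters the phases through `θ`, with derivative `e = ±1` in the
applications: forward time in the mild solution, and backward time in the proof of uniqueness. The
weight `w` makes up for the unboundedness of `k`. -/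

variable {S : Set ℝ} {t₀ e A : ℝ} {θ : ℝ → ℝ} {k w : ℝ → ℝ} {F : ℝ → L2} {F' : L2}

theorem hasDerivWithinAt_rmul_cos (ht₀ : t₀ ∈ S) (hθ : HasDerivAt θ e t₀)
    (hθl : ∀ t, |θ t - θ t₀| ≤ |t - t₀|) (hk : Measurable k) (hw : Measurable w)
    (hA : ∀ η, |w η| ≤ A) (hkA : ∀ η, |w η * k η| ≤ A) (hF : HasDerivWithinAt F F' S t₀) :
    HasDerivWithinAt (fun t => rmul (fun η => w η * Real.cos (k η * θ t)) (F t))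
      (rmul (fun η => -(e * (w η * k η * Real.sin (k η * θ t₀)))) (F t₀) +
        rmul (fun η => w η * Real.cos (k η * θ t₀)) F') S t₀ := by
  have hA0 : 0 ≤ A := (abs_nonneg _).trans (hA 0)
  refine hasDerivWithinAt_rmul (A := A) ht₀ (fun t _ => ⟨by fun_prop, fun η => ?_⟩)
    (fun t _ η => ?_) (BddR.neg (.const_mul (.of_le (A := A) (by fun_prop) fun η => ?_) e))
    (fun η => ?_) hF
  · exact abs_mul_le_of_le (hA η) (Real.abs_cos_le_one _)
  · rw [← mul_sub, abs_mul]
    calc _ ≤ |w η| * |k η * θ t - k η * θ t₀| := by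
          exact mul_le_mul_of_nonneg_left (Real.abs_cos_sub_cos_le _ _) (abs_nonneg _)
      _ = |w η * k η| * |θ t - θ t₀| := by rw [← mul_sub, abs_mul, abs_mul, mul_assoc]
      _ ≤ _ := mul_le_mul (hkA η) (hθl t) (abs_nonneg _) hA0
  · exact abs_mul_le_of_le (hkA η) (Real.abs_sin_le_one _)
  · exact (((hθ.const_mul (k η)).cos).const_mul (w η)).congr_deriv (by ring)

theorem hasDerivWithinAt_rmul_sin (ht₀ : t₀ ∈ S) (hθ : HasDerivAt θ e t₀)
    (hθl : ∀ t, |θ t - θ t₀| ≤ |t - t₀|) (hk : Measurable k) (hw : Measurable w)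
    (hA : ∀ η, |w η| ≤ A) (hkA : ∀ η, |w η * k η| ≤ A) (hF : HasDerivWithinAt F F' S t₀) :
    HasDerivWithinAt (fun t => rmul (fun η => w η * Real.sin (k η * θ t)) (F t))
      (rmul (fun η => e * (w η * k η * Real.cos (k η * θ t₀))) (F t₀) +
        rmul (fun η => w η * Real.sin (k η * θ t₀)) F') S t₀ := by
  have hA0 : 0 ≤ A := (abs_nonneg _).trans (hA 0)
  refine hasDerivWithinAt_rmul (A := A) ht₀ (fun t _ => ⟨by fun_prop, fun η => ?_⟩)
    (fun t _ η => ?_) (.const_mul (.of_le (A := A) (by fun_prop) fun η => ?_) e)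
    (fun η => ?_) hF
  · exact abs_mul_le_of_le (hA η) (Real.abs_sin_le_one _)
  · rw [← mul_sub, abs_mul]
    calc _ ≤ |w η| * |k η * θ t - k η * θ t₀| := by
          exact mul_le_mul_of_nonneg_left (Real.abs_sin_sub_sin_le _ _) (abs_nonneg _)
      _ = |w η * k η| * |θ t - θ t₀| := by rw [← mul_sub, abs_mul, abs_mul, mul_assoc]
      _ ≤ _ := mul_le_mul (hkA η) (hθl t) (abs_nonneg _) hA0
  · exact abs_mul_le_of_le (hkA η) (Real.abs_cos_le_one _)
  · exact (((hθ.const_mul (k η)).sin).const_mul (w η)).congr_deriv (by ring)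

/-- The function `sin(k x)/k` is written as `x sinc(k x)` to include `k = 0`. -/
theorem mul_mul_sinc (k x : ℝ) : k * (x * Real.sinc (k * x)) = Real.sin (k * x) := by
  rcases eq_or_ne (k * x) 0 with h | h
  · rw [← mul_assoc, h]; simp
  · rw [Real.sinc_of_ne_zero h, ← mul_assoc, mul_div_cancel₀ _ h]

theorem hasDerivAt_mul_sinc (k x : ℝ) :
    HasDerivAt (fun x => x * Real.sinc (k * x)) (Real.cos (k * x)) x := by
  rcases eq_or_ne k 0 with rfl | h
  · simpa using hasDerivAt_id' x
  · have h1 : HasDerivAt (fun x => k⁻¹ * Real.sin (k * x)) (Real.cos (k * x)) x := by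
      exact ((((hasDerivAt_id' x).const_mul k).sin).const_mul k⁻¹).congr_deriv (by field_simp)
    convert h1 using 2
    rw [← mul_mul_sinc, inv_mul_cancel_left₀ h]

theorem abs_mul_sinc_sub_le (k x y : ℝ) :
    |x * Real.sinc (k * x) - y * Real.sinc (k * y)| ≤ |x - y| := by
  have h := convex_univ.norm_image_sub_le_of_norm_hasDerivWithin_le (C := 1)
    (fun z _ => (hasDerivAt_mul_sinc k z).hasDerivWithinAt (s := univ))
    (fun z _ => Real.abs_cos_le_one _) (mem_univ y) (mem_univ x)
  simpa using h

theorem hasDerivWithinAt_rmul_sinc (ht₀ : t₀ ∈ S) (hθ : HasDerivAt θ e t₀)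
    (hθl : ∀ t, |θ t - θ t₀| ≤ |t - t₀|) (hθA : ∀ t ∈ S, |θ t| ≤ 1) (hk : Measurable k)
    (hF : HasDerivWithinAt F F' S t₀) :
    HasDerivWithinAt (fun t => rmul (fun η => θ t * Real.sinc (k η * θ t)) (F t))
      (rmul (fun η => e * Real.cos (k η * θ t₀)) (F t₀) +
        rmul (fun η => θ t₀ * Real.sinc (k η * θ t₀)) F') S t₀ := by
  have hs : Measurable Real.sinc := Real.continuous_sinc.measurable
  refine hasDerivWithinAt_rmul (A := 1) ht₀ (fun t ht => ⟨by fun_prop, fun η => ?_⟩)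
    (fun t _ η => ?_) (.const_mul (.of_le (A := 1) (by fun_prop) fun η => Real.abs_cos_le_one _) e)
    (fun η => ?_) hF
  · rw [abs_mul]
    exact mul_le_one₀ (hθA t ht) (abs_nonneg _) (Real.abs_sinc_le_one _)
  · rw [one_mul]
    exact (abs_mul_sinc_sub_le _ _ _).trans (hθl t)
  · have h := (hasDerivAt_mul_sinc (k η) (θ t₀)).comp t₀ hθ
    rw [mul_comm e]
    exact h

end Phase

/-- The data of the linear equation `u_tt + k(D)² u = - k(D) m(D) n`: a dispersion relation `k ≥ 0`
comparable at infinity to the weight of order `κ`, and a bounded symbol `m`, both even so that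
Hermitian symmetry is preserved. A single constant `C` serves for all the bounds. -/
structure Dispersion (k m : ℝ → ℝ) (κ : ℝ) (C : ℝ≥0) : Prop where
  order_nonneg : 0 ≤ κ
  measurable : Measurable k
  measurable_source : Measurable m
  even : ∀ η, k (-η) = k η
  even_source : ∀ η, m (-η) = m η
  nonneg : ∀ η, 0 ≤ k η
  le : ∀ η, k η ≤ C * jb κ η
  abs_source_le : ∀ η, |m η| ≤ C
  jb_le : ∀ η, jb κ η ≤ C * (1 + k η)

/-- The symbol `(1 + η²)^(-κ/2) k(η)`, bounded for a dispersion relation `k` of order `κ`. -/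
def nk (κ : ℝ) (k : ℝ → ℝ) (η : ℝ) : ℝ := jb (-κ) η * k η

section Duhamel

variable {k m : ℝ → ℝ} {κ : ℝ} {C : ℝ≥0}

theorem Dispersion.one_le (D : Dispersion k m κ C) : ∀ η, jb (-κ) η ≤ 1 :=
  jb_le_one (neg_nonpos.mpr D.order_nonneg)

theorem Dispersion.bddR_jb (D : Dispersion k m κ C) : BddR (jb (-κ)) :=
  bddMeas_jb (neg_nonpos.mpr D.order_nonneg)

theorem Dispersion.abs_nk_le (D : Dispersion k m κ C) (η : ℝ) : |nk κ k η| ≤ C := by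
  rw [nk, abs_of_nonneg (mul_nonneg (jb_pos _ _).le (D.nonneg η))]
  calc _ ≤ jb (-κ) η * (C * jb κ η) := by gcongr; exacts [(jb_pos _ _).le, D.le η]
    _ = C * (jb (-κ) η * jb κ η) := by ring
    _ = C := by rw [jb_neg_mul, mul_one]

theorem Dispersion.measurable_nk (D : Dispersion k m κ C) : Measurable (nk κ k) :=
  (measurable_jb _).mul D.measurable

theorem Dispersion.bddR_nk (D : Dispersion k m κ C) : BddR (nk κ k) :=
  .of_le D.measurable_nk D.abs_nk_le

theorem Dispersion.bddR_source (D : Dispersion k m κ C) : BddR m :=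
  .of_le D.measurable_source D.abs_source_le

theorem Dispersion.bddR_cos (D : Dispersion k m κ C) (t : ℝ) :
    BddR fun η => Real.cos (k η * t) := by
  have := D.measurable
  exact .of_le (by fun_prop) (A := 1) fun η => Real.abs_cos_le_one _

theorem Dispersion.bddR_sin (D : Dispersion k m κ C) (t : ℝ) :
    BddR fun η => Real.sin (k η * t) := by
  have := D.measurable
  exact .of_le (by fun_prop) (A := 1) fun η => Real.abs_sin_le_one _

theorem Dispersion.bddR_sinc (D : Dispersion k m κ C) (t : ℝ) :
    BddR fun η => t * Real.sinc (k η * t) := by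
  have := D.measurable
  have hs : Measurable Real.sinc := Real.continuous_sinc.measurable
  refine .of_le (by fun_prop) (A := |t|) fun η => ?_
  rw [abs_mul]
  exact mul_le_of_le_one_right (abs_nonneg _) (Real.abs_sinc_le_one _)

/-- The symbol `(1 + η²)^(κ/2) sin(k t)/k` of the propagator of the initial velocity. -/
def velSym (k : ℝ → ℝ) (κ t η : ℝ) : ℝ := jb κ η * (t * Real.sinc (k η * t))

theorem Dispersion.measurable_velSym (D : Dispersion k m κ C) (t : ℝ) :
    Measurable (velSym k κ t) := by
  have := D.measurable
  have hs : Measurable Real.sinc := Real.continuous_sinc.measurable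
  have := measurable_jb κ
  unfold velSym
  fun_prop

/-- The lower bound for `k` at high frequencies, `(1 + η²)^(κ/2) ≤ C (1 + k)`, is what allows initial
velocities of order `s - κ`. -/
theorem Dispersion.abs_velSym_le (D : Dispersion k m κ C) {t : ℝ} (ht : t ∈ Icc (0 : ℝ) 1) (η : ℝ) :
    |velSym k κ t η| ≤ 2 * C := by
  have ht' : |t| ≤ 1 := by rw [abs_of_nonneg ht.1]; exact ht.2
  rw [velSym, abs_mul, abs_of_pos (jb_pos _ _)]
  calc _ ≤ (C * (1 + k η)) * |t * Real.sinc (k η * t)| := by gcongr; exact D.jb_le η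
    _ = C * (|t * Real.sinc (k η * t)| + |k η * (t * Real.sinc (k η * t))|) := by
        rw [abs_mul (k η), abs_of_nonneg (D.nonneg η)]; ring
    _ ≤ C * (1 + 1) := by
        gcongr
        · rw [abs_mul]; exact mul_le_one₀ ht' (abs_nonneg _) (Real.abs_sinc_le_one _)
        · rw [mul_mul_sinc]; exact Real.abs_sin_le_one _
    _ = 2 * C := by ring

theorem Dispersion.bddR_velSym (D : Dispersion k m κ C) {t : ℝ} (ht : t ∈ Icc (0 : ℝ) 1) :
    BddR (velSym k κ t) :=
  .of_le (D.measurable_velSym t) (D.abs_velSym_le ht)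

theorem velSym_even (D : Dispersion k m κ C) (t η : ℝ) : velSym k κ t (-η) = velSym k κ t η := by
  rw [velSym, velSym, jb_even, D.even]

/-- The Duhamel integral `∫₀ᵗ sin(k τ) m n(τ) dτ`. By the addition theorem,
`∫₀ᵗ sin(k (t - τ)) m n(τ) dτ` is a combination of `sinI` and `cosI`, whose integrands do not depend
on `t`. -/
def sinI (k m : ℝ → ℝ) (n : ℝ → L2) (t : ℝ) : L2 :=
  ∫ τ in 0..t, rmul (fun η => m η * Real.sin (k η * τ)) (n τ)

/-- The Duhamel integral `∫₀ᵗ cos(k τ) m n(τ) dτ`. -/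
def cosI (k m : ℝ → ℝ) (n : ℝ → L2) (t : ℝ) : L2 :=
  ∫ τ in 0..t, rmul (fun η => m η * Real.cos (k η * τ)) (n τ)

theorem Dispersion.abs_sin_le (D : Dispersion k m κ C) (τ η : ℝ) :
    |m η * Real.sin (k η * τ)| ≤ C := by
  exact abs_mul_le_of_le (D.abs_source_le η) (Real.abs_sin_le_one _)

theorem Dispersion.abs_cos_le (D : Dispersion k m κ C) (τ η : ℝ) :
    |m η * Real.cos (k η * τ)| ≤ C := by
  exact abs_mul_le_of_le (D.abs_source_le η) (Real.abs_cos_le_one _)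

theorem Dispersion.continuous_sin (D : Dispersion k m κ C) {n : ℝ → L2} (hn : Continuous n) :
    Continuous fun τ => rmul (fun η => m η * Real.sin (k η * τ)) (n τ) := by
  have := D.measurable
  have := D.measurable_source
  rw [← continuousOn_univ]
  exact continuousOn_rmul (A := C) (fun t _ => ⟨by fun_prop, D.abs_sin_le t⟩)
    (fun η => by fun_prop) hn.continuousOn

theorem Dispersion.continuous_cos (D : Dispersion k m κ C) {n : ℝ → L2} (hn : Continuous n) :
    Continuous fun τ => rmul (fun η => m η * Real.cos (k η * τ)) (n τ) := by
  have := D.measurable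
  have := D.measurable_source
  rw [← continuousOn_univ]
  exact continuousOn_rmul (A := C) (fun t _ => ⟨by fun_prop, D.abs_cos_le t⟩)
    (fun η => by fun_prop) hn.continuousOn

theorem Dispersion.hasDerivAt_sinI (D : Dispersion k m κ C) {n : ℝ → L2} (hn : Continuous n)
    (t : ℝ) : HasDerivAt (sinI k m n) (rmul (fun η => m η * Real.sin (k η * t)) (n t)) t :=
  ((D.continuous_sin hn).integral_hasStrictDerivAt 0 t).hasDerivAt

theorem Dispersion.hasDerivAt_cosI (D : Dispersion k m κ C) {n : ℝ → L2} (hn : Continuous n)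
    (t : ℝ) : HasDerivAt (cosI k m n) (rmul (fun η => m η * Real.cos (k η * t)) (n t)) t :=
  ((D.continuous_cos hn).integral_hasStrictDerivAt 0 t).hasDerivAt

/-- The mild solution of `u_tt + k² u = - k m n` on the Fourier side, with `u(0) = U₀` and
`(1 + η²)^(-κ/2) u_t(0) = y₀`:
`u(t) = cos(k t) U₀ + sin(k t)/k u_t(0) - ∫₀ᵗ sin(k (t - τ)) m n(τ) dτ`. -/
def mild (k m : ℝ → ℝ) (κ : ℝ) (U₀ y₀ : L2) (n : ℝ → L2) (t : ℝ) : L2 :=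
  rmul (fun η => Real.cos (k η * t)) (U₀ + sinI k m n t) -
    rmul (fun η => Real.sin (k η * t)) (cosI k m n t) + rmul (velSym k κ t) y₀

/-- The velocity `(1 + η²)^(-κ/2) u_t` of the mild solution. -/
def mildVel (k m : ℝ → ℝ) (κ : ℝ) (U₀ y₀ : L2) (n : ℝ → L2) (t : ℝ) : L2 :=
  rmul (fun η => Real.cos (k η * t)) y₀ -
    rmul (nk κ k) (rmul (fun η => Real.sin (k η * t)) (U₀ + sinI k m n t) +
      rmul (fun η => Real.cos (k η * t)) (cosI k m n t))

theorem abs_id_sub_id_le (t₀ t : ℝ) : |id t - id t₀| ≤ |t - t₀| := le_rfl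

/-- The derivative of the mild solution exists in `L²` after the loss of `κ` orders. -/
theorem Dispersion.hasDerivWithinAt_mild (D : Dispersion k m κ C) (U₀ y₀ : L2) {n : ℝ → L2}
    (hn : Continuous n) {t : ℝ} (ht : t ∈ Icc (0 : ℝ) 1) :
    HasDerivWithinAt (fun t => rmul (jb (-κ)) (mild k m κ U₀ y₀ n t))
      (mildVel k m κ U₀ y₀ n t) (Icc 0 1) t := by
  have hmul : ∀ η, |jb (-κ) η * k η| ≤ C := D.abs_nk_le
  have hj : ∀ η, |jb (-κ) η| ≤ max 1 C := fun η => by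
    rw [abs_of_pos (jb_pos _ _)]; exact (D.one_le η).trans (le_max_left _ _)
  have hmul' : ∀ η, |jb (-κ) η * k η| ≤ max 1 C := fun η => (hmul η).trans (le_max_right _ _)
  have h1 := hasDerivWithinAt_rmul_cos ht (hasDerivAt_id t) (abs_id_sub_id_le t)
    D.measurable (measurable_jb _) hj hmul'
    (((D.hasDerivAt_sinI hn t).const_add U₀).hasDerivWithinAt (s := Icc 0 1))
  have h2 := hasDerivWithinAt_rmul_sin ht (hasDerivAt_id t) (abs_id_sub_id_le t)
    D.measurable (measurable_jb _) hj hmul'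
    ((D.hasDerivAt_cosI hn t).hasDerivWithinAt (s := Icc 0 1))
  have h3 := hasDerivWithinAt_rmul_sinc ht (hasDerivAt_id t) (abs_id_sub_id_le t)
    (fun t ht => by rw [id, abs_of_nonneg ht.1]; exact ht.2) D.measurable
    (hasDerivWithinAt_const t (Icc 0 1) y₀)
  have h := (h1.sub h2).add h3
  have bm := D.bddR_source
  have bj := D.bddR_jb
  have bc := D.bddR_cos t
  have bs := D.bddR_sin t
  have bq : BddR fun η => jb (-κ) η * k η := D.bddR_nk
  refine (h.congr_deriv ?_).congr_of_mem (fun τ hτ => ?_) ht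
  · simp only [mildVel, id, one_mul, map_zero, add_zero]
    change _ = _ - rmul (fun η => jb (-κ) η * k η) _
    -- The derivatives of the two Duhamel integrals cancel.
    have e : rmul (fun η => jb (-κ) η * Real.cos (k η * t))
          (rmul (fun η => m η * Real.sin (k η * t)) (n t)) =
        rmul (fun η => jb (-κ) η * Real.sin (k η * t))
          (rmul (fun η => m η * Real.cos (k η * t)) (n t)) := by
      rw [rmul_rmul (bj.mul bc) (bm.mul bs), rmul_rmul (bj.mul bs) (bm.mul bc)]
      congr 2
      ext η
      ring
    rw [rmul_neg (bq.mul bs), map_add (rmul fun η => jb (-κ) η * k η), rmul_rmul bq bs,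
      rmul_rmul bq bc, e]
    abel
  · have bv : BddR (velSym k κ τ) := D.bddR_velSym hτ
    simp only [mild, id, Pi.add_apply, Pi.sub_apply]
    rw [map_add, map_sub, rmul_rmul bj (D.bddR_cos τ), rmul_rmul bj (D.bddR_sin τ), rmul_rmul bj bv]
    congr 3
    ext η
    rw [velSym, ← mul_assoc, jb_neg_mul, one_mul]

/-- The mild solution solves `u_tt = -k² u - k m n`, an equation in `L²` after the loss of `2κ` orders. -/
theorem Dispersion.hasDerivWithinAt_mildVel (D : Dispersion k m κ C) (U₀ y₀ : L2) {n : ℝ → L2}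
    (hn : Continuous n) {t : ℝ} (ht : t ∈ Icc (0 : ℝ) 1) :
    HasDerivWithinAt (fun t => rmul (jb (-κ)) (mildVel k m κ U₀ y₀ n t))
      (-(rmul (fun η => nk κ k η * nk κ k η) (mild k m κ U₀ y₀ n t) +
        rmul (fun η => jb (-κ) η * (nk κ k η * m η)) (n t))) (Icc 0 1) t := by
  have hjn : ∀ η, jb (-κ) η * nk κ k η * k η = nk κ k η * nk κ k η := fun η => by
    simp only [nk]; ring
  have h0 : ∀ η, |jb (-κ) η| ≤ 1 := fun η => by
    rw [abs_of_pos (jb_pos _ _)]; exact D.one_le η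
  have hq2 : ∀ η, |nk κ k η * nk κ k η| ≤ (C : ℝ) * C := fun η => by
    rw [abs_mul]; exact mul_le_mul (D.abs_nk_le η) (D.abs_nk_le η) (abs_nonneg _) C.2
  have hj : ∀ η, |jb (-κ) η * nk κ k η| ≤ max (C : ℝ) (C * C) := fun η => by
    rw [abs_mul]
    exact (mul_le_of_le_one_left (abs_nonneg _) (h0 η)).trans
      ((D.abs_nk_le η).trans (le_max_left _ _))
  have hmul : ∀ η, |jb (-κ) η * nk κ k η * k η| ≤ max (C : ℝ) (C * C) := fun η => by
    rw [hjn]; exact (hq2 η).trans (le_max_right _ _)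
  have h1 := hasDerivWithinAt_rmul_sin ht (hasDerivAt_id t) (abs_id_sub_id_le t)
    D.measurable ((measurable_jb _).mul D.measurable_nk) hj hmul
    (((D.hasDerivAt_sinI hn t).const_add U₀).hasDerivWithinAt (s := Icc 0 1))
  have h2 := hasDerivWithinAt_rmul_cos ht (hasDerivAt_id t) (abs_id_sub_id_le t)
    D.measurable ((measurable_jb _).mul D.measurable_nk) hj hmul
    ((D.hasDerivAt_cosI hn t).hasDerivWithinAt (s := Icc 0 1))
  have h3 := hasDerivWithinAt_rmul_cos (A := max 1 C) ht (hasDerivAt_id t)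
    (abs_id_sub_id_le t) D.measurable (measurable_jb (-κ))
    (fun η => (h0 η).trans (le_max_left _ _)) (fun η => (D.abs_nk_le η).trans (le_max_right _ _))
    (hasDerivWithinAt_const t (Icc 0 1) y₀)
  have h := (h3.sub h1).sub h2
  have bm := D.bddR_source
  have bj := D.bddR_jb
  have bc := D.bddR_cos t
  have bs := D.bddR_sin t
  have bq := D.bddR_nk
  have bjq := bj.mul bq
  have bqq := bq.mul bq
  refine (h.congr_deriv ?_).congr_of_mem (fun τ hτ => ?_) ht
  · simp only [id, one_mul, map_zero, add_zero, Pi.mul_apply, hjn, mild]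
    have bv : BddR (velSym k κ t) := D.bddR_velSym ht
    have e1 : rmul (fun η => jb (-κ) η * nk κ k η * Real.sin (k η * t))
          (rmul (fun η => m η * Real.sin (k η * t)) (n t)) +
        rmul (fun η => jb (-κ) η * nk κ k η * Real.cos (k η * t))
          (rmul (fun η => m η * Real.cos (k η * t)) (n t)) =
        rmul (fun η => jb (-κ) η * (nk κ k η * m η)) (n t) := by
      have e : (fun η => jb (-κ) η * nk κ k η * Real.sin (k η * t) * (m η * Real.sin (k η * t)) +
          jb (-κ) η * nk κ k η * Real.cos (k η * t) * (m η * Real.cos (k η * t))) =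
          fun η => jb (-κ) η * (nk κ k η * m η) := by
        ext η
        linear_combination jb (-κ) η * (nk κ k η * m η) * Real.sin_sq_add_cos_sq (k η * t)
      rw [rmul_rmul (bjq.mul bs) (bm.mul bs), rmul_rmul (bjq.mul bc) (bm.mul bc),
        rmul_add ((bjq.mul bs).mul (bm.mul bs)) ((bjq.mul bc).mul (bm.mul bc)) _, e]
      rw [e]
      exact bj.mul (bq.mul bm)
    have e2 : rmul (fun η => nk κ k η * nk κ k η) (rmul (velSym k κ t) y₀) =
        rmul (fun η => jb (-κ) η * k η * Real.sin (k η * t)) y₀ := by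
      rw [rmul_rmul bqq bv]
      congr 2
      ext η
      rw [velSym, ← mul_mul_sinc, nk]
      linear_combination jb (-κ) η * k η * k η * t * Real.sinc (k η * t) * jb_neg_mul κ η
    rw [← e1, rmul_neg (bqq.mul bs), map_add (rmul fun η => nk κ k η * nk κ k η),
      map_sub (rmul fun η => nk κ k η * nk κ k η), e2, rmul_rmul bqq bc, rmul_rmul bqq bs,
      rmul_neg (BddR.mul (f := fun η => jb (-κ) η * k η) bq bs)]
    abel
  · simp only [mildVel, id, Pi.mul_apply, Pi.sub_apply]
    rw [map_sub, rmul_rmul bj (D.bddR_cos τ), rmul_rmul bj bq, map_add,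
      rmul_rmul bjq (D.bddR_cos τ), rmul_rmul bjq (D.bddR_sin τ)]
    abel

end Duhamel

/-! ### Existence by contraction and regularity of mild solutions -/

/-- If a separating family of continuous linear maps `L i` satisfies `(L i f)' = L i Y` and `Y` is
continuous, then `f' = Y`: apply the `L i` to the difference of `f` and the primitive of `Y`. -/
theorem hasDerivWithinAt_of_separating {ι V E : Type*} [NormedAddCommGroup V] [NormedSpace ℝ V]
    [CompleteSpace V] [NormedAddCommGroup E] [NormedSpace ℝ E] (L : ι → V →L[ℝ] E)
    (hL : ∀ x y, (∀ i, L i x = L i y) → x = y) {a b : ℝ} (hab : a ≤ b) {f Y : ℝ → V}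
    (hY : ContinuousOn Y (Icc a b))
    (h : ∀ i, ∀ t ∈ Icc a b, HasDerivWithinAt (fun t => L i (f t)) (L i (Y t)) (Icc a b) t) :
    ∀ t ∈ Icc a b, HasDerivWithinAt f (Y t) (Icc a b) t := by
  let Y' : ℝ → V := fun t => Y (projIcc a b hab t)
  have hY' : Continuous Y' := (continuousOn_iff_continuous_domRestrict.mp hY).comp continuous_projIcc
  have hYe : ∀ t ∈ Icc a b, Y' t = Y t := fun t ht => by simp [Y', projIcc_of_mem hab ht]
  let P : ℝ → V := fun t => f a + ∫ τ in a..t, Y' τ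
  have hP : ∀ t, HasDerivAt P (Y' t) t := fun t =>
    ((hY'.integral_hasStrictDerivAt a t).hasDerivAt).const_add (f a)
  have key : ∀ t ∈ Icc a b, f t = P t := by
    intro t ht
    refine hL _ _ fun i => ?_
    have h1 : ∀ t ∈ Icc a b,
        HasDerivWithinAt (fun t => L i (f t) - L i (P t)) 0 (Icc a b) t := fun t ht => by
      have h2 := (h i t ht).sub (((L i).hasFDerivAt.comp_hasDerivAt t (hP t)).hasDerivWithinAt)
      rw [hYe t ht, sub_self] at h2
      exact h2
    have h3 := constant_of_has_deriv_right_zero (fun t ht => (h1 t ht).continuousWithinAt)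
      (fun t ht => (h1 t (Ico_subset_Icc_self ht)).mono_of_mem_nhdsWithin
        (Icc_mem_nhdsGE_of_mem ht)) t ht
    have h4 : P a = f a := by simp [P]
    rw [h4, sub_self, sub_eq_zero] at h3
    exact h3
  intro t ht
  rw [← hYe t ht]
  exact (hP t).hasDerivWithinAt.congr_of_mem key ht

/-- The integral of a function which is bounded in a Sobolev norm and continuous in `L²` is Lipschitz
continuous in the Sobolev norm. -/
theorem exists_integral_eq {s : ℝ} (hs : 0 ≤ s) {R : ℝ≥0} {f : ℝ → L2} (hf : Continuous f)
    (hR : ∀ t, f t ∈ wBall s R) : ∃ A : ℝ → L2, ContinuousOn A (Ici 0) ∧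
      ∀ t ∈ Ici (0 : ℝ), ∫ τ in 0..t, f τ = rmul (jb (-s)) (A t) := by
  have h1 : ∀ t : ℝ, ∃ A : L2, t ∈ Ici (0 : ℝ) → ∫ τ in 0..t, f τ = rmul (jb (-s)) A := fun t => by
    by_cases ht : t ∈ Ici (0 : ℝ)
    · obtain ⟨A, -, hA, -⟩ := exists_of_mem_wBall hs
        (integral_mem_wBall hf (fun t _ => hR t) (mem_Ici.mp ht))
      exact ⟨A, fun _ => hA⟩
    · exact ⟨0, fun h => absurd h ht⟩
  choose A hA using h1
  refine ⟨A, ?_, hA⟩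
  have hinj : Function.Injective (rmul (jb (-s))) :=
    rmul_injective (bddMeas_jb (neg_nonpos.mpr hs)) fun η => (jb_pos _ _).ne'
  have hl : ∀ x ∈ Ici (0 : ℝ), ∀ y ∈ Ici (0 : ℝ), x ≤ y → dist (A x) (A y) ≤ R * dist x y := by
    intro x hx y hy hxy
    obtain ⟨W, -, hW, hWn⟩ := exists_of_mem_wBall hs
      (integral_mem_wBall hf (fun t _ => hR t) hxy)
    have e : A y - A x = W := by
      apply hinj
      rw [map_sub, ← hA y hy, ← hA x hx, intervalIntegral.integral_interval_sub_left
        (hf.intervalIntegrable _ _) (hf.intervalIntegrable _ _)]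
      exact hW
    rw [dist_comm, dist_eq_norm, e, dist_comm, dist_eq_norm, mul_comm]
    exact hWn
  refine LipschitzOnWith.continuousOn (K := R) (LipschitzOnWith.of_dist_le_mul fun x hx y hy => ?_)
  rcases le_total x y with h | h
  · exact hl x hx y hy h
  · rw [dist_comm, dist_comm x]; exact hl y hy x hx h

section Existence

variable {k m : ℝ → ℝ} {κ : ℝ} {C : ℝ≥0}

theorem Dispersion.sin_mem_wBall (D : Dispersion k m κ C) {s : ℝ} {R : ℝ≥0} {n : ℝ → L2}
    (hR : ∀ t, n t ∈ wBall s R) (t : ℝ) :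
    rmul (fun η => m η * Real.sin (k η * t)) (n t) ∈ wBall s (C * R) := by
  have := D.measurable
  have := D.measurable_source
  exact mulL_mem_wBall (by fun_prop) (D.abs_sin_le t)
    (fun η => by rw [D.even, D.even_source]) (hR t)

theorem Dispersion.cos_mem_wBall (D : Dispersion k m κ C) {s : ℝ} {R : ℝ≥0} {n : ℝ → L2}
    (hR : ∀ t, n t ∈ wBall s R) (t : ℝ) :
    rmul (fun η => m η * Real.cos (k η * t)) (n t) ∈ wBall s (C * R) := by
  have := D.measurable
  have := D.measurable_source
  exact mulL_mem_wBall (by fun_prop) (D.abs_cos_le t)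
    (fun η => by rw [D.even, D.even_source]) (hR t)

theorem Dispersion.continuousOn_cos (D : Dispersion k m κ C) {S : Set ℝ} {F : ℝ → L2}
    (hF : ContinuousOn F S) :
    ContinuousOn (fun t => rmul (fun η => Real.cos (k η * t)) (F t)) S := by
  have := D.measurable
  exact continuousOn_rmul (A := 1) (fun t _ => ⟨by fun_prop, fun η => Real.abs_cos_le_one _⟩)
    (fun η => by fun_prop) hF

theorem Dispersion.continuousOn_sin (D : Dispersion k m κ C) {S : Set ℝ} {F : ℝ → L2}
    (hF : ContinuousOn F S) :
    ContinuousOn (fun t => rmul (fun η => Real.sin (k η * t)) (F t)) S := by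
  have := D.measurable
  exact continuousOn_rmul (A := 1) (fun t _ => ⟨by fun_prop, fun η => Real.abs_sin_le_one _⟩)
    (fun η => by fun_prop) hF

theorem Dispersion.continuousOn_velSym (D : Dispersion k m κ C) (F : L2) :
    ContinuousOn (fun t => rmul (velSym k κ t) F) (Icc 0 1) := by
  refine continuousOn_rmul (A := 2 * C) (fun t ht => ⟨D.measurable_velSym t, D.abs_velSym_le ht⟩)
    (fun η => ?_) continuousOn_const
  have hs := Real.continuous_sinc
  unfold velSym
  fun_prop

theorem Dispersion.continuousOn_mild (D : Dispersion k m κ C) (U₀ y₀ : L2) {n : ℝ → L2}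
    (hn : Continuous n) : ContinuousOn (mild k m κ U₀ y₀ n) (Icc 0 1) := by
  have h1 : Continuous (sinI k m n) := continuous_iff_continuousAt.mpr fun t =>
    (D.hasDerivAt_sinI hn t).continuousAt
  have h2 : Continuous (cosI k m n) := continuous_iff_continuousAt.mpr fun t =>
    (D.hasDerivAt_cosI hn t).continuousAt
  exact ((D.continuousOn_cos (continuous_const.add h1).continuousOn).sub
    (D.continuousOn_sin h2.continuousOn)).add (D.continuousOn_velSym y₀)

/-- The mild solution in a Sobolev ball. No order is lost, as the source `m n` has the order of `n`. -/
theorem Dispersion.mild_mem_wBall (D : Dispersion k m κ C) {s : ℝ} {R₀ R₁ R : ℝ≥0} {U₀ y₀ : L2}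
    (hU : U₀ ∈ wBall s R₀) (hy : y₀ ∈ wBall s R₁) {n : ℝ → L2} (hn : Continuous n)
    (hR : ∀ t, n t ∈ wBall s R) {t : ℝ} (ht : t ∈ Icc (0 : ℝ) 1) :
    mild k m κ U₀ y₀ n t ∈ wBall s (R₀ + 2 * (‖t‖₊ * (C * R)) + 2 * C * R₁) := by
  have := D.measurable
  have h1 := integral_mem_wBall (D.continuous_sin hn) (fun t _ => D.sin_mem_wBall hR t) ht.1
  have h2 := integral_mem_wBall (D.continuous_cos hn) (fun t _ => D.cos_mem_wBall hR t) ht.1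
  have h3 : rmul (fun η => Real.cos (k η * t)) (U₀ + sinI k m n t) ∈ wBall s _ :=
    mulL_mem_wBall (C := 1) (by fun_prop)
    (fun η => Real.abs_cos_le_one (k η * t)) (fun η => by rw [D.even]) (add_mem_wBall hU h1)
  have h4 : rmul (fun η => Real.sin (k η * t)) (cosI k m n t) ∈ wBall s _ :=
    mulL_mem_wBall (C := 1) (by fun_prop)
    (fun η => Real.abs_sin_le_one (k η * t)) (fun η => by rw [D.even]) h2
  have h5 : rmul (velSym k κ t) y₀ ∈ wBall s _ := mulL_mem_wBall (C := 2 * C)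
    (D.measurable_velSym t) (by exact_mod_cast D.abs_velSym_le ht) (velSym_even D t) hy
  refine wBall_mono (le_of_eq ?_) (add_mem_wBall (sub_mem_wBall h3 h4) h5)
  rw [sub_zero]
  ring

theorem Dispersion.norm_mild_sub_le (D : Dispersion k m κ C) (U₀ y₀ : L2) {n n' : ℝ → L2}
    (hn : Continuous n) (hn' : Continuous n') {B : ℝ} (hB : ∀ t, ‖n t - n' t‖ ≤ B) {t : ℝ}
    (ht : 0 ≤ t) : ‖mild k m κ U₀ y₀ n t - mild k m κ U₀ y₀ n' t‖ ≤ 2 * (C * B * t) := by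
  have := D.measurable
  have := D.measurable_source
  have e : mild k m κ U₀ y₀ n t - mild k m κ U₀ y₀ n' t =
      rmul (fun η => Real.cos (k η * t)) (sinI k m n t - sinI k m n' t) -
        rmul (fun η => Real.sin (k η * t)) (cosI k m n t - cosI k m n' t) := by
    simp only [mild, map_add, map_sub]
    abel
  have h1 : ‖sinI k m n t - sinI k m n' t‖ ≤ C * B * t := by
    rw [sinI, sinI, ← intervalIntegral.integral_sub ((D.continuous_sin hn).intervalIntegrable _ _)
      ((D.continuous_sin hn').intervalIntegrable _ _)]
    have h := intervalIntegral.norm_integral_le_of_norm_le_const (a := 0) (b := t) (C := C * B)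
      (f := fun τ => rmul (fun η => m η * Real.sin (k η * τ)) (n τ) -
        rmul (fun η => m η * Real.sin (k η * τ)) (n' τ)) fun τ _ => by
        rw [← map_sub]
        exact (norm_rmul_le (by fun_prop) (D.abs_sin_le τ) _).trans
          (mul_le_mul_of_nonneg_left (hB τ) C.2)
    rwa [sub_zero, abs_of_nonneg ht] at h
  have h2 : ‖cosI k m n t - cosI k m n' t‖ ≤ C * B * t := by
    rw [cosI, cosI, ← intervalIntegral.integral_sub ((D.continuous_cos hn).intervalIntegrable _ _)
      ((D.continuous_cos hn').intervalIntegrable _ _)]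
    have h := intervalIntegral.norm_integral_le_of_norm_le_const (a := 0) (b := t) (C := C * B)
      (f := fun τ => rmul (fun η => m η * Real.cos (k η * τ)) (n τ) -
        rmul (fun η => m η * Real.cos (k η * τ)) (n' τ)) fun τ _ => by
        rw [← map_sub]
        exact (norm_rmul_le (by fun_prop) (D.abs_cos_le τ) _).trans
          (mul_le_mul_of_nonneg_left (hB τ) C.2)
    rwa [sub_zero, abs_of_nonneg ht] at h
  rw [e, two_mul]
  refine (norm_sub_le _ _).trans (add_le_add ?_ ?_)
  · exact ((norm_rmul_le (by fun_prop) (fun η => Real.abs_cos_le_one (k η * t)) _).trans_eq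
      (one_mul _)).trans h1
  · exact ((norm_rmul_le (by fun_prop) (fun η => Real.abs_sin_le_one (k η * t)) _).trans_eq
      (one_mul _)).trans h2

/-- Local existence for the mild equation `n = N(u)`, with `u` the mild solution of source `n`. The
contraction principle applies in `C([0,T], L²)`, on the closed set of functions with values in a ball
of `H^s`, so that `N` only has to be Lipschitz in `L²` and bounded on this ball. -/
theorem Dispersion.exists_mild_eq (D : Dispersion k m κ C) {s : ℝ} {R₀ R₁ R' Λ : ℝ≥0} {U₀ y₀ : L2}
    (hU : U₀ ∈ wBall s R₀) (hy : y₀ ∈ wBall s R₁) {N : L2 → L2} (hN : LipschitzWith Λ N)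
    (hNR : ∀ U ∈ wBall s (R₀ + 1 + 2 * C * R₁), N U ∈ wBall s R') :
    ∃ T : ℝ, 0 < T ∧ T ≤ 1 ∧ ∃ n : ℝ → L2, Continuous n ∧ (∀ t, n t ∈ wBall s R') ∧
      ∀ t ∈ Icc 0 T, mild k m κ U₀ y₀ n t ∈ wBall s (R₀ + 1 + 2 * C * R₁) ∧
        n t = N (mild k m κ U₀ y₀ n t) := by
  set R : ℝ≥0 := R₀ + 1 + 2 * C * R₁
  -- The time `T = 1/Q` satisfies `2 T C R' ≤ 1`, which keeps the iteration in the ball, and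
  -- `2 T C Λ ≤ 1/2`, which makes it a contraction.
  set Q : ℝ≥0 := 1 + 2 * C * R' + 4 * C * Λ with hQ
  have hQ1 : 1 ≤ Q := by rw [hQ, add_assoc]; exact le_self_add
  have hQ0 : 0 < Q := zero_lt_one.trans_le hQ1
  set T : ℝ := ((Q⁻¹ : ℝ≥0) : ℝ) with hT
  have hT0 : 0 < T := by exact_mod_cast inv_pos.mpr hQ0
  have hT1 : T ≤ 1 := by exact_mod_cast inv_le_one_of_one_le₀ hQ1
  have hTQ : T * Q = 1 := by
    rw [hT, NNReal.coe_inv]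
    exact inv_mul_cancel₀ (by exact_mod_cast hQ0.ne')
  have hQr : (Q : ℝ) = 1 + 2 * C * R' + 4 * C * Λ := by rw [hQ]; push_cast; ring
  rw [hQr] at hTQ
  have hTI : ∀ t ∈ Icc 0 T, t ∈ Icc (0 : ℝ) 1 := fun t ht => ⟨ht.1, ht.2.trans hT1⟩
  refine ⟨T, hT0, hT1, ?_⟩
  -- Sources are extended constantly beyond `[0, T]`, to be continuous on the whole line.
  let src : C(Icc 0 T, L2) → ℝ → L2 := fun U t => N (U (projIcc 0 T hT0.le t))
  have hsrc : ∀ U, Continuous (src U) := fun U =>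
    hN.continuous.comp (U.continuous.comp continuous_projIcc)
  let Φ : C(Icc 0 T, L2) → C(Icc 0 T, L2) := fun U =>
    ⟨fun t => mild k m κ U₀ y₀ (src U) t, by
      have h := (D.continuousOn_mild U₀ y₀ (hsrc U)).mono (s := Icc 0 1) (t := Icc 0 T) hTI
      exact continuousOn_iff_continuous_domRestrict.mp h⟩
  let S : Set C(Icc 0 T, L2) := {U | ∀ t, U t ∈ wBall s R}
  have hS : IsClosed S := by
    have : S = ⋂ t, {U : C(Icc 0 T, L2) | U t ∈ wBall s R} := by ext; simp [S]
    rw [this]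
    exact isClosed_iInter fun t =>
      (isClosed_wBall s R).preimage (continuous_eval_const t)
  have hsR : ∀ U ∈ S, ∀ t, src U t ∈ wBall s R' := fun U hU t => hNR _ (hU _)
  have hmaps : MapsTo Φ S S := by
    intro U hU' t
    refine wBall_mono ?_ (D.mild_mem_wBall hU hy (hsrc U) (hsR U hU') (hTI t t.2))
    have h1 : 2 * (‖(t : ℝ)‖₊ * (C * R')) ≤ 1 := by
      rw [← NNReal.coe_le_coe]
      push_cast
      rw [Real.norm_of_nonneg t.2.1]
      have h2 : (t : ℝ) * (C * R') ≤ T * (C * R') := by gcongr; exact t.2.2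
      have h3 : 0 ≤ T * (C * Λ : ℝ) := by positivity
      nlinarith
    exact add_le_add (add_le_add le_rfl h1) le_rfl
  have hcontr : ContractingWith (1 / 2) (hmaps.restrict Φ S S) := by
    refine ⟨by rw [← NNReal.coe_lt_coe]; norm_num, LipschitzWith.of_dist_le_mul fun U V => ?_⟩
    rw [Subtype.dist_eq, Subtype.dist_eq]
    refine (ContinuousMap.dist_le (by positivity)).mpr fun t => ?_
    have h1 := D.norm_mild_sub_le U₀ y₀ (hsrc U) (hsrc V) (B := Λ * dist U.1 V.1) (fun τ => by
      rw [← dist_eq_norm]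
      exact (hN.dist_le_mul _ _).trans (by gcongr; exact ContinuousMap.dist_apply_le_dist _)) t.2.1
    rw [dist_eq_norm]
    refine h1.trans ?_
    have h2 : 2 * (C * (Λ * dist U.1 V.1) * (t : ℝ)) ≤ 2 * (C * (Λ * dist U.1 V.1) * T) := by
      gcongr; exact t.2.2
    refine h2.trans ?_
    have h3 : 2 * (C * Λ * T : ℝ) ≤ 1 / 2 := by
      have h3 : 0 ≤ T * (C * R' : ℝ) := by positivity
      nlinarith
    calc _ = 2 * (C * Λ * T : ℝ) * dist U.1 V.1 := by ring
      _ ≤ 1 / 2 * dist U.1 V.1 := by gcongr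
      _ = _ := by push_cast; rfl
  obtain ⟨U, hUS, hfix, -⟩ := hcontr.exists_fixedPoint' hS.isComplete hmaps
    (x := ContinuousMap.const _ U₀)
    (fun _ => wBall_mono (le_self_add.trans le_self_add) hU) (edist_ne_top _ _)
  refine ⟨src U, hsrc U, hsR U hUS, fun t ht => ?_⟩
  have h1 : U ⟨t, ht⟩ = mild k m κ U₀ y₀ (src U) t :=
    (congrArg (fun V : C(Icc 0 T, L2) => V ⟨t, ht⟩) hfix).symm
  rw [← h1]
  refine ⟨hUS _, ?_⟩
  simp only [src]
  rw [projIcc_of_mem hT0.le ht]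

/-- The mild solution and its velocity are continuous in the norms of order `s` and `s - κ`, and the
derivative exists in the norm of order `s - κ`. Here `Z` and `Y` are the weighted Fourier transforms.
The source `n` is only continuous in `L²`, but its Duhamel integrals are Lipschitz in the norm of
order `s`. -/
theorem Dispersion.exists_regular (D : Dispersion k m κ C) {s : ℝ} (hs : 0 ≤ s) {R : ℝ≥0}
    (Φ Ψ : L2) {n : ℝ → L2} (hn : Continuous n) (hR : ∀ t, n t ∈ wBall s R) :
    ∃ Z Y : ℝ → L2, ContinuousOn Z (Icc 0 1) ∧ ContinuousOn Y (Icc 0 1) ∧ Z 0 = Φ ∧ Y 0 = Ψ ∧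
      (∀ t ∈ Icc (0 : ℝ) 1,
        mild k m κ (rmul (jb (-s)) Φ) (rmul (jb (-s)) Ψ) n t = rmul (jb (-s)) (Z t) ∧
        mildVel k m κ (rmul (jb (-s)) Φ) (rmul (jb (-s)) Ψ) n t = rmul (jb (-s)) (Y t)) ∧
      ∀ t ∈ Icc (0 : ℝ) 1,
        HasDerivWithinAt (fun t => rmul (jb (-κ)) (Z t)) (Y t) (Icc 0 1) t := by
  obtain ⟨A, hA, hA'⟩ := exists_integral_eq hs (D.continuous_sin hn) (D.sin_mem_wBall hR)
  obtain ⟨B, hB, hB'⟩ := exists_integral_eq hs (D.continuous_cos hn) (D.cos_mem_wBall hR)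
  have hI : Icc (0 : ℝ) 1 ⊆ Ici 0 := Icc_subset_Ici_self
  have bJ : BddR (jb (-s)) := bddMeas_jb (neg_nonpos.mpr hs)
  have hinj : Function.Injective (rmul (jb (-s))) := rmul_injective bJ fun η => (jb_pos _ _).ne'
  have comm : ∀ {f : ℝ → ℝ}, BddR f → ∀ F, rmul f (rmul (jb (-s)) F) =
      rmul (jb (-s)) (rmul f F) := fun {f} hf F => by
    rw [rmul_rmul hf bJ, rmul_rmul bJ hf]
    simp only [mul_comm]
  let Z : ℝ → L2 := fun t => rmul (fun η => Real.cos (k η * t)) (Φ + A t) -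
    rmul (fun η => Real.sin (k η * t)) (B t) + rmul (velSym k κ t) Ψ
  let Y : ℝ → L2 := fun t => rmul (fun η => Real.cos (k η * t)) Ψ -
    rmul (nk κ k) (rmul (fun η => Real.sin (k η * t)) (Φ + A t) +
      rmul (fun η => Real.cos (k η * t)) (B t))
  have hZ : ContinuousOn Z (Icc 0 1) :=
    ((D.continuousOn_cos (continuousOn_const.add (hA.mono hI))).sub
      (D.continuousOn_sin (hB.mono hI))).add (D.continuousOn_velSym Ψ)
  have hY : ContinuousOn Y (Icc 0 1) := (D.continuousOn_cos continuousOn_const).sub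
    ((rmul (nk κ k)).continuous.comp_continuousOn
      ((D.continuousOn_sin (continuousOn_const.add (hA.mono hI))).add
        (D.continuousOn_cos (hB.mono hI))))
  have key : ∀ t ∈ Icc (0 : ℝ) 1,
        mild k m κ (rmul (jb (-s)) Φ) (rmul (jb (-s)) Ψ) n t = rmul (jb (-s)) (Z t) ∧
        mildVel k m κ (rmul (jb (-s)) Φ) (rmul (jb (-s)) Ψ) n t = rmul (jb (-s)) (Y t) := by
    intro t ht
    have e1 : sinI k m n t = rmul (jb (-s)) (A t) := hA' t (hI ht)
    have e2 : cosI k m n t = rmul (jb (-s)) (B t) := hB' t (hI ht)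
    constructor
    · rw [mild, e1, e2, ← map_add, comm (D.bddR_cos t), comm (D.bddR_sin t),
        comm (D.bddR_velSym ht), ← map_sub, ← map_add]
    · rw [mildVel, e1, e2, ← map_add, comm (D.bddR_cos t), comm (D.bddR_sin t),
        comm (D.bddR_cos t), ← map_add, comm D.bddR_nk, ← map_sub]
  have h0 : (0 : ℝ) ∈ Icc (0 : ℝ) 1 := ⟨le_rfl, zero_le_one⟩
  refine ⟨Z, Y, hZ, hY, hinj ?_, hinj ?_, key, ?_⟩
  · rw [← (key 0 h0).1]
    have : (fun η => Real.cos (k η * 0)) = fun _ => 1 := by ext; simp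
    have h3 : velSym k κ 0 = fun _ => 0 := by ext; simp [velSym]
    simp only [mild, sinI, cosI, this, h3, rmul_one, rmul_zero, intervalIntegral.integral_same,
      map_zero, add_zero, sub_zero]
  · rw [← (key 0 h0).2]
    have : (fun η => Real.cos (k η * 0)) = fun _ => 1 := by ext; simp
    have h3 : (fun η => Real.sin (k η * 0)) = fun _ => 0 := by ext; simp
    simp only [mildVel, sinI, cosI, this, h3, rmul_one, rmul_zero, intervalIntegral.integral_same,
      map_zero, add_zero, sub_zero]
  · refine hasDerivWithinAt_of_separating (fun _ : Unit => (rmul (jb (-s))).restrictScalars ℝ)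
      (fun x y h => hinj (h ())) zero_le_one hY fun _ t ht => ?_
    have h := D.hasDerivWithinAt_mild (rmul (jb (-s)) Φ) (rmul (jb (-s)) Ψ) hn ht
    rw [(key t ht).2] at h
    refine h.congr_of_mem (fun τ hτ => ?_) ht
    rw [(key τ hτ).1, comm D.bddR_jb]
    rfl

end Existence

/-! ### Uniqueness on the Fourier side -/

section Uniqueness

variable {k m : ℝ → ℝ} {κ : ℝ} {C : ℝ≥0}

/-- Duhamel's formula for the linear equation with vanishing initial values, derived by testing with
the solution of the backward homogeneous equation. Here `y` is `(1 + η²)^(-κ/2) U_t`. -/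
theorem Dispersion.eq_neg_integral (D : Dispersion k m κ C) {t : ℝ} (ht : t ∈ Icc (0 : ℝ) 1)
    {U y ν : ℝ → L2} (hν : Continuous ν)
    (hU : ∀ τ ∈ Icc 0 t, HasDerivWithinAt (fun τ => rmul (jb (-κ)) (U τ)) (y τ) (Icc 0 t) τ)
    (hy : ∀ τ ∈ Icc 0 t, HasDerivWithinAt (fun τ => rmul (jb (-κ)) (y τ))
      (-(rmul (fun η => nk κ k η * nk κ k η) (U τ) +
        rmul (fun η => jb (-κ) η * (nk κ k η * m η)) (ν τ))) (Icc 0 t) τ)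
    (hU0 : U 0 = 0) (hy0 : y 0 = 0) :
    U t = -∫ τ in 0..t, rmul (fun η => m η * Real.sin (k η * (t - τ))) (ν τ) := by
  have hmk := D.measurable
  have hmm := D.measurable_source
  have bm := D.bddR_source
  have bj := D.bddR_jb
  have bq := D.bddR_nk
  have hc : Continuous fun τ => rmul (fun η => m η * Real.sin (k η * (t - τ))) (ν τ) := by
    rw [← continuousOn_univ]
    exact continuousOn_rmul (A := C) (fun τ _ => ⟨by fun_prop, D.abs_sin_le _⟩)
      (fun η => by fun_prop) hν.continuousOn
  -- `(1 + η²)^(-κ)` times `cos(k (t-τ)) U(τ) + sin(k (t-τ))/k U_t(τ) + ∫₀^τ sin(k (t-τ')) m ν(τ') dτ'`,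
  -- which is constant in `τ`, vanishes at `τ = 0`, and shows `U(t)` at `τ = t`.
  let G : ℝ → L2 := fun τ =>
    rmul (fun η => jb (-κ) η * Real.cos (k η * (t - τ))) (rmul (jb (-κ)) (U τ)) +
      rmul (fun η => (t - τ) * Real.sinc (k η * (t - τ))) (rmul (jb (-κ)) (y τ)) +
      rmul (fun η => jb (-κ) η * jb (-κ) η)
        (∫ τ' in 0..τ, rmul (fun η => m η * Real.sin (k η * (t - τ'))) (ν τ'))
  have hG : ∀ τ ∈ Icc 0 t, HasDerivWithinAt G 0 (Icc 0 t) τ := by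
    intro τ hτ
    have hθ : HasDerivAt (fun τ => t - τ) (-1) τ := by
      simpa using (hasDerivAt_id' τ).const_sub t
    have hθl : ∀ τ', |(t - τ') - (t - τ)| ≤ |τ' - τ| := fun τ' => by
      have e : t - τ' - (t - τ) = -(τ' - τ) := by ring
      rw [e, abs_neg]
    have h1 := hasDerivWithinAt_rmul_cos (A := max 1 C) hτ hθ hθl hmk (measurable_jb (-κ))
      (fun η => by
        rw [abs_of_pos (jb_pos _ _)]; exact (D.one_le η).trans (le_max_left _ _))
      (fun η => (D.abs_nk_le η).trans (le_max_right _ _)) (hU τ hτ)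
    have h2 := hasDerivWithinAt_rmul_sinc hτ hθ hθl (fun τ' hτ' => by
      rw [abs_of_nonneg (sub_nonneg.mpr hτ'.2)]
      linarith [hτ'.1, ht.2]) hmk (hy τ hτ)
    have h3 := ((rmul fun η => jb (-κ) η * jb (-κ) η).restrictScalars ℝ).hasFDerivAt.comp_hasDerivAt
      τ (hc.integral_hasStrictDerivAt 0 τ).hasDerivAt
    have h := (h1.add h2).add (h3.hasDerivWithinAt (s := Icc 0 t))
    refine h.congr_deriv ?_
    have bs := D.bddR_sin (t - τ)
    have bc := D.bddR_cos (t - τ)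
    have bi := D.bddR_sinc (t - τ)
    have e1 : rmul (fun η => -(-1 * (jb (-κ) η * k η * Real.sin (k η * (t - τ)))))
        (rmul (jb (-κ)) (U τ)) =
        rmul (fun η => (t - τ) * Real.sinc (k η * (t - τ)))
          (rmul (fun η => nk κ k η * nk κ k η) (U τ)) := by
      have e : (fun η => -(-1 * (jb (-κ) η * k η * Real.sin (k η * (t - τ))))) =
          fun η => nk κ k η * Real.sin (k η * (t - τ)) := by ext η; simp [nk]
      rw [e, rmul_rmul (bq.mul bs) bj, rmul_rmul bi (bq.mul bq)]
      congr 2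
      ext η
      rw [← mul_mul_sinc, nk]
      ring
    have e2 : rmul (fun η => -1 * Real.cos (k η * (t - τ))) (rmul (jb (-κ)) (y τ)) =
        -rmul (fun η => jb (-κ) η * Real.cos (k η * (t - τ))) (y τ) := by
      rw [rmul_rmul (bc.const_mul _) bj, ← rmul_neg (bj.mul bc)]
      congr 2
      ext η
      ring
    have e3 : rmul (fun η => jb (-κ) η * jb (-κ) η)
        (rmul (fun η => m η * Real.sin (k η * (t - τ))) (ν τ)) =
        rmul (fun η => (t - τ) * Real.sinc (k η * (t - τ)))
          (rmul (fun η => jb (-κ) η * (nk κ k η * m η)) (ν τ)) := by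
      rw [rmul_rmul (bj.mul bj) (bm.mul bs), rmul_rmul bi (bj.mul (bq.mul bm))]
      congr 2
      ext η
      rw [← mul_mul_sinc, nk]
      ring
    change _ + _ + (_ + _) + rmul (fun η => jb (-κ) η * jb (-κ) η)
        (rmul (fun η => m η * Real.sin (k η * (t - τ))) (ν τ)) = 0
    rw [e1, e2, e3, map_neg, map_add]
    abel
  have h0 := constant_of_has_deriv_right_zero (fun τ hτ => (hG τ hτ).continuousWithinAt)
    (fun τ hτ => (hG τ (Ico_subset_Icc_self hτ)).mono_of_mem_nhdsWithin
      (Icc_mem_nhdsGE_of_mem hτ)) t (right_mem_Icc.mpr ht.1)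
  have hG0 : G 0 = 0 := by simp [G, hU0, hy0]
  have hGt : G t = rmul (fun η => jb (-κ) η * jb (-κ) η)
      (U t + ∫ τ in 0..t, rmul (fun η => m η * Real.sin (k η * (t - τ))) (ν τ)) := by
    have e : (fun η => jb (-κ) η * Real.cos (k η * (t - t))) = jb (-κ) := by ext; simp
    have e' : (fun η => (t - t) * Real.sinc (k η * (t - t))) = fun _ => 0 := by ext; simp
    simp only [G]
    rw [e, e', rmul_zero, add_zero, rmul_rmul bj bj, map_add]
  rw [hG0, hGt] at h0
  have h1 := rmul_injective (bj.mul bj) (fun η => (mul_pos (jb_pos _ _) (jb_pos _ _)).ne')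
    (h0.trans (map_zero _).symm)
  exact eq_neg_of_add_eq_zero_left h1

/-- Uniqueness for the semilinear equation with an `L²` Lipschitz nonlinearity. -/
theorem Dispersion.eqOn_of_hasDeriv (D : Dispersion k m κ C) {T : ℝ} (hT0 : 0 ≤ T) (hT1 : T ≤ 1)
    {Λ : ℝ≥0} {N : L2 → L2} (hN : LipschitzWith Λ N) {U V y z : ℝ → L2}
    (hUc : ContinuousOn U (Icc 0 T)) (hVc : ContinuousOn V (Icc 0 T))
    (hU : ∀ t ∈ Icc 0 T, HasDerivWithinAt (fun t => rmul (jb (-κ)) (U t)) (y t) (Icc 0 T) t)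
    (hV : ∀ t ∈ Icc 0 T, HasDerivWithinAt (fun t => rmul (jb (-κ)) (V t)) (z t) (Icc 0 T) t)
    (hy : ∀ t ∈ Icc 0 T, HasDerivWithinAt (fun t => rmul (jb (-κ)) (y t))
      (-(rmul (fun η => nk κ k η * nk κ k η) (U t) +
        rmul (fun η => jb (-κ) η * (nk κ k η * m η)) (N (U t)))) (Icc 0 T) t)
    (hz : ∀ t ∈ Icc 0 T, HasDerivWithinAt (fun t => rmul (jb (-κ)) (z t))
      (-(rmul (fun η => nk κ k η * nk κ k η) (V t) +
        rmul (fun η => jb (-κ) η * (nk κ k η * m η)) (N (V t)))) (Icc 0 T) t)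
    (h0 : U 0 = V 0) (h0' : y 0 = z 0) : EqOn U V (Icc 0 T) := by
  have hmk := D.measurable
  have hmm := D.measurable_source
  have ext_cont : ∀ {F : ℝ → L2}, ContinuousOn F (Icc 0 T) →
      Continuous fun t => F (projIcc 0 T hT0 t) := fun h =>
    (continuousOn_iff_continuous_domRestrict.mp h).comp continuous_projIcc
  have hp : ∀ t ∈ Icc 0 T, (projIcc 0 T hT0 t : ℝ) = t := fun t ht => by rw [projIcc_of_mem hT0 ht]
  let δ : ℝ → L2 := fun t => U (projIcc 0 T hT0 t) - V (projIcc 0 T hT0 t)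
  let ν : ℝ → L2 := fun t => N (U (projIcc 0 T hT0 t)) - N (V (projIcc 0 T hT0 t))
  have hδ : Continuous δ := (ext_cont hUc).sub (ext_cont hVc)
  have hν : Continuous ν :=
    (hN.continuous.comp (ext_cont hUc)).sub (hN.continuous.comp (ext_cont hVc))
  have hνδ : ∀ t, ‖ν t‖ ≤ Λ * ‖δ t‖ := fun t => hN.norm_sub_le _ _
  have hform : ∀ t ∈ Icc 0 T,
      δ t = -∫ τ in 0..t, rmul (fun η => m η * Real.sin (k η * (t - τ))) (ν τ) := by
    intro t ht
    have hsub : Icc 0 t ⊆ Icc 0 T := Icc_subset_Icc_right ht.2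
    have h := D.eq_neg_integral (U := fun t => U t - V t) (y := fun t => y t - z t)
      ⟨ht.1, ht.2.trans hT1⟩ hν
      (fun τ hτ => by
        simp only [map_sub]
        exact ((hU τ (hsub hτ)).sub (hV τ (hsub hτ))).mono hsub)
      (fun τ hτ => by
        simp only [map_sub]
        refine (((hy τ (hsub hτ)).sub (hz τ (hsub hτ))).mono hsub).congr_deriv ?_
        simp only [ν, hp τ (hsub hτ), map_sub]
        abel) (by simp [h0]) (by simp [h0'])
    rw [← h]
    simp only [δ, hp t ht]
  let f : ℝ → ℝ := fun t => ∫ τ in 0..t, ‖δ τ‖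
  have hf : ∀ t, HasDerivAt f ‖δ t‖ t := fun t =>
    (hδ.norm.integral_hasStrictDerivAt 0 t).hasDerivAt
  have hbound : ∀ t ∈ Icc 0 T, ‖δ t‖ ≤ C * Λ * f t := by
    intro t ht
    rw [hform t ht, norm_neg]
    have h1 := intervalIntegral.norm_integral_le_of_norm_le (μ := volume) ht.1
      (f := fun τ => rmul (fun η => m η * Real.sin (k η * (t - τ))) (ν τ))
      (g := fun τ => C * Λ * ‖δ τ‖) (ae_of_all _ fun τ _ => by
        rw [mul_assoc]
        exact (norm_rmul_le (by fun_prop) (D.abs_sin_le (t - τ)) _).trans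
          (mul_le_mul_of_nonneg_left (hνδ τ) C.2))
      ((continuous_const.mul hδ.norm).intervalIntegrable _ _)
    rwa [intervalIntegral.integral_const_mul] at h1
  have hf0 : ∀ t ∈ Icc 0 T, f t = 0 :=
    eq_zero_of_abs_deriv_le_mul_abs_self_of_eq_zero_right (f' := fun t => ‖δ t‖) (K := C * Λ)
      (fun t _ => (hf t).continuousAt.continuousWithinAt) (fun t _ => (hf t).hasDerivWithinAt)
      (by simp [f]) (fun t ht => by
        rw [norm_norm]
        refine (hbound t (Ico_subset_Icc_self ht)).trans ?_
        exact mul_le_mul_of_nonneg_left (le_abs_self _) (by positivity))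
  intro t ht
  have h1 := hbound t ht
  rw [hf0 t ht, mul_zero] at h1
  have h2 : δ t = 0 := norm_le_zero_iff.mp h1
  simp only [δ, hp t ht] at h2
  exact sub_eq_zero.mp h2

end Uniqueness

/-! ### Second derivatives, constants and superposition as distributions -/

theorem derivCLM_fourier (χ : 𝓢(ℝ, ℂ)) : SchwartzMap.derivCLM ℂ ℂ (𝓕 χ) =
    𝓕 (-(2 * Real.pi * Complex.I) • SchwartzMap.smulLeftCLM ℂ (inner ℝ · (1 : ℝ)) χ) := by
  rw [← SchwartzMap.lineDerivOp_fourier_eq]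
  ext x
  rw [SchwartzMap.derivCLM_apply, SchwartzMap.lineDerivOp_apply_eq_fderiv]
  rfl

theorem dxx_apply (v : 𝓢'(ℝ, ℂ)) (χ : 𝓢(ℝ, ℂ)) :
    dxx v χ = v (SchwartzMap.derivCLM ℂ ℂ (SchwartzMap.derivCLM ℂ ℂ χ)) := by
  rw [dxx, TemperedDistribution.derivCLM_apply_apply, TemperedDistribution.derivCLM_apply_apply,
    map_neg, map_neg, map_neg, neg_neg]

/-- The second derivative multiplies the Fourier transform by `-(2πη)²`. -/
theorem IsRegular.fourier_dxx {v : 𝓢'(ℝ, ℂ)} {f : ℝ → ℂ} (h : IsRegular (𝓕 v) f) :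
    IsRegular (𝓕 (dxx v)) (fun η => -(2 * Real.pi * η : ℂ) ^ 2 * f η) := by
  intro χ
  let M : 𝓢(ℝ, ℂ) → 𝓢(ℝ, ℂ) := fun χ =>
    -(2 * Real.pi * Complex.I) • SchwartzMap.smulLeftCLM ℂ (inner ℝ · (1 : ℝ)) χ
  have hg : (inner ℝ · (1 : ℝ)).HasTemperateGrowth := by fun_prop
  have hM : ∀ χ η, M χ η = -(2 * Real.pi * Complex.I) * (η * χ η) := fun χ η => by
    change -(2 * Real.pi * Complex.I) * (SchwartzMap.smulLeftCLM ℂ (inner ℝ · (1 : ℝ)) χ) η = _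
    rw [SchwartzMap.smulLeftCLM_apply_apply hg]
    simp
  have hMM : ∀ η, f η * M (M χ) η = -(2 * Real.pi * η : ℂ) ^ 2 * f η * χ η := fun η => by
    rw [hM, hM]
    linear_combination (4 * Real.pi ^ 2 * η ^ 2 * f η * χ η : ℂ) * Complex.I_sq
  obtain ⟨h1, h2⟩ := h (M (M χ))
  simp only [hMM] at h1 h2
  refine ⟨h1, ?_⟩
  rw [← h2, TemperedDistribution.fourier_apply, dxx_apply, derivCLM_fourier, derivCLM_fourier]
  rfl

theorem IsRegular.add {v w : 𝓢'(ℝ, ℂ)} {f h : ℝ → ℂ} (hv : IsRegular v f) (hw : IsRegular w h) :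
    IsRegular (v + w) (fun x => f x + h x) := fun χ => by
  simp only [add_mul]
  refine ⟨(hv χ).1.add (hw χ).1, ?_⟩
  rw [integral_add (hv χ).1 (hw χ).1, ← (hv χ).2, ← (hw χ).2]
  rfl

theorem eq_of_isRegular_fourier {v w : 𝓢'(ℝ, ℂ)} {f h : ℝ → ℂ} (hv : IsRegular (𝓕 v) f)
    (hw : IsRegular (𝓕 w) h) (hfh : f =ᵐ[volume] h) : v = w := by
  have h1 : (𝓕 v : 𝓢'(ℝ, ℂ)) = 𝓕 w := by
    ext χ
    rw [((hv.congr hfh) χ).2, (hw χ).2]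
  have h2 := congrArg (𝓕⁻ : 𝓢'(ℝ, ℂ) → 𝓢'(ℝ, ℂ)) h1
  simpa using h2

/-- The constant functions as tempered distributions. -/
def constDist (c : ℂ) : 𝓢'(ℝ, ℂ) := c • (volume : Measure ℝ).toTemperedDistribution

theorem isRegular_constDist (c : ℂ) : IsRegular (constDist c) fun _ => c := fun χ =>
  ⟨χ.integrable.const_mul c, by
    rw [integral_const_mul]
    rfl⟩

theorem dxx_constDist (c : ℂ) : dxx (constDist c) = 0 := by
  ext χ
  rw [dxx_apply, ((isRegular_constDist c) _).2, integral_const_mul]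
  have h : ∫ x, (SchwartzMap.derivCLM ℂ ℂ (SchwartzMap.derivCLM ℂ ℂ χ)) x = 0 := by
    simp only [SchwartzMap.derivCLM_apply ℂ (SchwartzMap.derivCLM ℂ ℂ χ)]
    refine integral_eq_zero_of_hasDerivAt_of_integrable
      (f := SchwartzMap.derivCLM ℂ ℂ χ) (fun x => ?_) ?_
      (SchwartzMap.derivCLM ℂ ℂ χ).integrable
    · exact (SchwartzMap.differentiable _ x).hasDerivAt
    · exact (SchwartzMap.derivCLM ℂ ℂ (SchwartzMap.derivCLM ℂ ℂ χ)).integrable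
  rw [h, mul_zero]
  rfl

theorem dxx_add (v w : 𝓢'(ℝ, ℂ)) : dxx (v + w) = dxx v + dxx w := by
  rw [dxx, map_add, map_add]; rfl

theorem isRegular_distOf_zero (U : L2) : IsRegular (distOf 0 U) (𝓕⁻ U : L2) := by
  have h := isRegular_toTemperedDistribution (𝓕⁻ U)
  rwa [toTemperedDistribution_eq_distOf, FourierTransform.fourier_fourierInv_eq] at h

theorem isRegular_fourier_distOf_zero (U : L2) : IsRegular (𝓕 (distOf 0 U)) U := by
  simpa using isRegular_fourier_distOf 0 U

/-- The constant `g(0)` is invisible in `g(u)_xx`. -/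
theorem IsSuperposition.dxx_eq {g : ℝ → ℝ} {U n : L2} {gu : 𝓢'(ℝ, ℂ)}
    (h : IsSuperposition g (distOf 0 U) gu) (hn : IsComp g (𝓕⁻ U) (𝓕⁻ n)) :
    dxx gu = dxx (distOf 0 n) := by
  obtain ⟨f, hf, hgf⟩ := h
  have h1 : (fun x => (f x : ℂ)) =ᵐ[volume] (𝓕⁻ U : L2) := hf.ae_eq (isRegular_distOf_zero U)
  have h2 := (isRegular_distOf_zero n).add (isRegular_constDist (g 0 : ℂ))
  have h3 : gu = distOf 0 n + constDist (g 0 : ℂ) := by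
    ext χ
    rw [(hgf χ).2, (h2 χ).2]
    refine integral_congr_ae ?_
    filter_upwards [h1, hn] with x e1 e2
    rw [e2, ← e1, Complex.ofReal_re]
    push_cast
    ring
  rw [h3, dxx_add, dxx_constDist, add_zero]

/-- A real `u ∈ L²` and `n = 𝓕 (g(u) - g(0))` give `g(u)` as a distribution, with the constant `g(0)`
added back. -/
theorem exists_isSuperposition {g : ℝ → ℝ} {U n : L2} (hU : Hermitian U)
    (hn : IsComp g (𝓕⁻ U) (𝓕⁻ n)) : ∃ gu, IsSuperposition g (distOf 0 U) gu := by
  have h := hermitian_fourier_iff (𝓕⁻ U)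
  rw [FourierTransform.fourier_fourierInv_eq] at h
  refine ⟨distOf 0 n + constDist (g 0 : ℂ), fun x => ((𝓕⁻ U : L2) x).re, ?_, ?_⟩
  · refine (isRegular_distOf_zero U).congr ?_
    filter_upwards [h.mp hU] with x hx
    apply Complex.ext <;> simp [hx]
  · refine ((isRegular_distOf_zero n).add (isRegular_constDist (g 0 : ℂ))).congr ?_
    filter_upwards [hn] with x hx
    rw [hx]
    push_cast
    ring

/-- Testing `distOf a F` against `χ`, as a functional of `F`. -/
def evalL (a : ℝ) (χ : 𝓢(ℝ, ℂ)) : L2 →L[ℝ] ℂ :=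
  ({ toFun := fun F => distOf a F χ
     map_add' := fun F G => by rw [map_add]; rfl
     map_smul' := fun c F => by rw [map_smul]; rfl
     cont := (PointwiseConvergenceCLM.evalCLM (RingHom.id ℂ) ℂ χ).continuous.comp
       (distOf a).continuous } : L2 →L[ℂ] ℂ).restrictScalars ℝ

theorem evalL_apply (a : ℝ) (χ : 𝓢(ℝ, ℂ)) (F : L2) : evalL a χ F = distOf a F χ := rfl

/-! ### The dispersion relation of `L`, and the equation on the Fourier side -/

/-- The dispersion relation `|ξ| √l(ξ)` at `ξ = 2πη`. -/
def symK (l : ℝ → ℝ) (η : ℝ) : ℝ := |2 * Real.pi * η| * √(l (2 * Real.pi * η))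

/-- The symbol `|ξ| / √l(ξ)` at `ξ = 2πη`. -/
def symM (l : ℝ → ℝ) (η : ℝ) : ℝ := |2 * Real.pi * η| / √(l (2 * Real.pi * η))

theorem symK_mul_symM {l : ℝ → ℝ} (hl : ∀ ξ, 0 < l ξ) (η : ℝ) :
    symK l η * symM l η = (2 * Real.pi * η) ^ 2 := by
  have h : √(l (2 * Real.pi * η)) ≠ 0 := (Real.sqrt_pos.mpr (hl _)).ne'
  rw [symK, symM, ← sq_abs]
  field_simp

theorem symK_sq {l : ℝ → ℝ} (hl : ∀ ξ, 0 < l ξ) (η : ℝ) :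
    symK l η * symK l η = (2 * Real.pi * η) ^ 2 * l (2 * Real.pi * η) := by
  have h : √(l (2 * Real.pi * η)) ^ 2 = l (2 * Real.pi * η) := Real.sq_sqrt (hl _).le
  rw [symK, ← sq_abs (2 * Real.pi * η), ← h, Real.sqrt_sq (Real.sqrt_nonneg _)]
  ring

/-- The symbol `l` of order `ρ` gives the dispersion relation `|ξ| √l(ξ)` of order `1 + ρ/2`. The symbol
`|ξ| / √l(ξ)` is bounded because `ρ ≥ 2`. -/
theorem exists_dispersion {ρ c₁ c₂ : ℝ} (hρ : 2 ≤ ρ) {l : ℝ → ℝ} (hl : Measurable l)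
    (hl_even : ∀ ξ, l (-ξ) = l ξ) (hc₁ : 0 < c₁) (hc₂ : 0 < c₂)
    (hl_lower : ∀ ξ, c₁ ^ 2 * (1 + ξ ^ 2) ^ (ρ / 2) ≤ l ξ)
    (hl_upper : ∀ ξ, l ξ ≤ c₂ ^ 2 * (1 + ξ ^ 2) ^ (ρ / 2)) :
    ∃ C : ℝ≥0, Dispersion (symK l) (symM l) (1 + ρ / 2) C := by
  have hjj : ∀ ξ, (1 + ξ ^ 2) ^ (ρ / 2) = jb (ρ / 2) ξ ^ 2 := fun ξ => by
    rw [← jb_eq, sq, ← jb_add, add_halves]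
  have hlow : ∀ ξ, c₁ * jb (ρ / 2) ξ ≤ √(l ξ) := fun ξ => by
    refine Real.le_sqrt_of_sq_le ?_
    rw [mul_pow, ← hjj]
    exact hl_lower ξ
  have hup : ∀ ξ, √(l ξ) ≤ c₂ * jb (ρ / 2) ξ := fun ξ => by
    refine Real.sqrt_le_iff.mpr ⟨mul_nonneg hc₂.le (jb_pos _ _).le, ?_⟩
    rw [mul_pow, ← hjj]
    exact hl_upper ξ
  have hπ : 1 ≤ 2 * Real.pi := by linarith [Real.pi_gt_three]
  have habs : ∀ η : ℝ, |2 * Real.pi * η| = 2 * Real.pi * |η| := fun η => by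
    rw [abs_mul, abs_of_pos (by positivity)]
  have hη : ∀ η : ℝ, |η| ≤ |2 * Real.pi * η| := fun η => by
    rw [habs]
    exact le_mul_of_one_le_left (abs_nonneg _) hπ
  have hρ0 : 0 ≤ ρ / 2 / 2 := by linarith
  have hj1 : ∀ η, jb (ρ / 2) η ≤ jb (ρ / 2) (2 * Real.pi * η) := fun η => by
    rw [jb_eq, jb_eq]
    refine Real.rpow_le_rpow (by positivity) ?_ hρ0
    gcongr 1 + ?_
    exact sq_le_sq.mpr (hη η)
  set B : ℝ := ((2 * Real.pi) ^ 2) ^ (ρ / 2 / 2) with hB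
  have hB0 : 0 ≤ B := by positivity
  have hj2 : ∀ η, jb (ρ / 2) (2 * Real.pi * η) ≤ B * jb (ρ / 2) η := fun η => by
    rw [jb_eq, jb_eq, hB, ← Real.mul_rpow (by positivity) (by positivity)]
    refine Real.rpow_le_rpow (by positivity) ?_ hρ0
    nlinarith [sq_nonneg η]
  have hsplit : ∀ η, jb (1 + ρ / 2) η = jb 1 η * jb (ρ / 2) η := fun η => jb_add _ _ _
  have hsq : ∀ η, 0 < √(l (2 * Real.pi * η)) := fun η =>
    (mul_pos hc₁ (jb_pos _ _)).trans_le (hlow _)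
  have hknn : ∀ η, 0 ≤ symK l η := fun η => mul_nonneg (abs_nonneg _) (Real.sqrt_nonneg _)
  -- The first two summands bound `k` and `m`. The last two give the lower bound for `k`: the weight is
  -- bounded for `|η| ≤ 1`, and `(1 + η²)^(1/2) ≤ 2 |η|` for `|η| ≥ 1`.
  set C : ℝ := 2 * Real.pi * c₂ * B + 1 / c₁ + 2 ^ ((1 + ρ / 2) / 2) + 2 / c₁ with hC
  have t1 : 0 ≤ 2 * Real.pi * c₂ * B := by positivity
  have t2 : 0 < 1 / c₁ := by positivity
  have t3 : 0 ≤ (2 : ℝ) ^ ((1 + ρ / 2) / 2) := by positivity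
  have t4 : 0 < 2 / c₁ := by positivity
  have hC0 : 0 ≤ C := by positivity
  refine ⟨⟨C, hC0⟩, ⟨by linarith, ?_, ?_, fun η => ?_, fun η => ?_, hknn, fun η => ?_, fun η => ?_,
    fun η => ?_⟩⟩
  · unfold symK; fun_prop
  · unfold symM; fun_prop
  · rw [symK, symK, mul_neg, abs_neg, hl_even]
  · rw [symM, symM, mul_neg, abs_neg, hl_even]
  · calc symK l η ≤ (2 * Real.pi * jb 1 η) * (c₂ * (B * jb (ρ / 2) η)) := by
          rw [symK, habs]
          refine mul_le_mul ?_ ((hup _).trans ?_) (Real.sqrt_nonneg _)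
            (mul_nonneg (by positivity) (jb_pos _ _).le)
          · exact mul_le_mul_of_nonneg_left (abs_le_jb_one η) (by positivity)
          · exact mul_le_mul_of_nonneg_left (hj2 η) hc₂.le
      _ = 2 * Real.pi * c₂ * B * jb (1 + ρ / 2) η := by rw [hsplit]; ring
      _ ≤ C * jb (1 + ρ / 2) η := mul_le_mul_of_nonneg_right (by linarith) (jb_pos _ _).le
  · rw [symM, abs_div, abs_abs, abs_of_pos (hsq η)]
    have h1 : |2 * Real.pi * η| ≤ 1 / c₁ * √(l (2 * Real.pi * η)) := by
      rw [one_div_mul_eq_div, le_div_iff₀ hc₁, mul_comm]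
      refine le_trans ?_ (hlow _)
      -- This is where `ρ ≥ 2` enters: `|ξ| ≤ (1 + ξ²)^(ρ/4)`.
      gcongr
      exact (abs_le_jb_one _).trans (jb_mono (by linarith) _)
    calc _ ≤ 1 / c₁ := (div_le_iff₀ (hsq η)).mpr h1
      _ ≤ C := by linarith
  · have hk : jb (ρ / 2) η * |η| ≤ 1 / c₁ * symK l η := by
      rw [symK, one_div_mul_eq_div, le_div_iff₀ hc₁]
      calc _ = |η| * (c₁ * jb (ρ / 2) η) := by ring
        _ ≤ |2 * Real.pi * η| * (c₁ * jb (ρ / 2) (2 * Real.pi * η)) :=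
            mul_le_mul (hη η) (mul_le_mul_of_nonneg_left (hj1 η) hc₁.le)
              (mul_nonneg hc₁.le (jb_pos _ _).le) (abs_nonneg _)
        _ ≤ _ := by gcongr; exact hlow _
    have hgoal : jb (1 + ρ / 2) η ≤ 2 ^ ((1 + ρ / 2) / 2) + 2 / c₁ * symK l η := by
      rcases le_total |η| 1 with h | h
      · have h1 : jb (1 + ρ / 2) η ≤ 2 ^ ((1 + ρ / 2) / 2) := by
          rw [jb_eq]
          refine Real.rpow_le_rpow (by positivity) ?_ (by linarith)
          have := (sq_le_one_iff_abs_le_one η).mpr h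
          linarith
        have h2 := mul_nonneg t4.le (hknn η)
        linarith
      · have h1 : jb (1 + ρ / 2) η ≤ 2 * (jb (ρ / 2) η * |η|) := by
          rw [hsplit]
          have := mul_le_mul_of_nonneg_right ((jb_one_le η).trans (by linarith : _ ≤ 2 * |η|))
            (jb_pos (ρ / 2) η).le
          linarith
        have h2 : 2 / c₁ * symK l η = 2 * (1 / c₁ * symK l η) := by ring
        linarith
    have h1 : 2 / c₁ * symK l η ≤ C * symK l η :=
      mul_le_mul_of_nonneg_right (by linarith) (hknn η)
    change _ ≤ C * (1 + symK l η)
    linarith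

section Equation

variable {l : ℝ → ℝ} {κ : ℝ} {C : ℝ≥0}

/-- The right-hand side `L u_xx + g(u)_xx` in terms of `U = 𝓕 u` and `n = 𝓕 (g(u) - g(0))`, multiplied
by the weight of order `-2κ` to bring it into `L²`. -/
def waveRhs (l : ℝ → ℝ) (κ : ℝ) (U n : L2) : L2 :=
  -(rmul (fun η => nk κ (symK l) η * nk κ (symK l) η) U +
    rmul (fun η => jb (-κ) η * (nk κ (symK l) η * symM l η)) n)

theorem jb_two_mul_mul (κ η : ℝ) : jb (2 * κ) η * (jb (-κ) η * jb (-κ) η) = 1 := by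
  rw [← jb_add, ← jb_add]
  have : 2 * κ + (-κ + -κ) = 0 := by ring
  rw [this, jb_zero]

theorem weight_mul_nk_sq (hl : ∀ ξ, 0 < l ξ) (κ η : ℝ) :
    jb (2 * κ) η * (nk κ (symK l) η * nk κ (symK l) η) =
      (2 * Real.pi * η) ^ 2 * l (2 * Real.pi * η) := by
  rw [← symK_sq hl, nk]
  linear_combination symK l η * symK l η * jb_two_mul_mul κ η

theorem weight_mul_source (hl : ∀ ξ, 0 < l ξ) (κ η : ℝ) :
    jb (2 * κ) η * (jb (-κ) η * (nk κ (symK l) η * symM l η)) = (2 * Real.pi * η) ^ 2 := by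
  rw [← symK_mul_symM hl, nk]
  linear_combination symK l η * symM l η * jb_two_mul_mul κ η

/-- `L u_xx` exists for `u ∈ L²`: its Fourier transform is an `L²` function with the weight of order `2κ`. -/
theorem exists_isMultiplier (D : Dispersion (symK l) (symM l) κ C) (hl : ∀ ξ, 0 < l ξ) (U : L2) :
    ∃ Luxx, IsMultiplier l (dxx (distOf 0 U)) Luxx := by
  refine ⟨distOf (-(2 * κ)) (rmul (fun η => -(nk κ (symK l) η * nk κ (symK l) η)) U), _,
    (isRegular_fourier_distOf_zero U).fourier_dxx, (isRegular_fourier_distOf _ _).congr ?_⟩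
  filter_upwards [rmul_ae (D.bddR_nk.mul D.bddR_nk).neg U] with η h
  have h1 : (jb (2 * κ) η : ℂ) * (nk κ (symK l) η * nk κ (symK l) η) =
      (2 * Real.pi * η) ^ 2 * l (2 * Real.pi * η) := by exact_mod_cast weight_mul_nk_sq hl κ η
  rw [h, neg_neg]
  push_cast
  linear_combination -(U η) * h1

/-- The right-hand side of the equation does not depend on the choice of `L u_xx` and `g(u)`, and its
Fourier transform is given by `waveRhs`. -/
theorem add_dxx_eq_distOf (D : Dispersion (symK l) (symM l) κ C) (hl : ∀ ξ, 0 < l ξ) {U n : L2}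
    {Luxx gu : 𝓢'(ℝ, ℂ)} (hL : IsMultiplier l (dxx (distOf 0 U)) Luxx)
    (hgu : dxx gu = dxx (distOf 0 n)) :
    Luxx + dxx gu = distOf (-(2 * κ)) (waveRhs l κ U n) := by
  obtain ⟨f, hf, hLf⟩ := hL
  have hfU := hf.ae_eq (isRegular_fourier_distOf_zero U).fourier_dxx
  have h1 := hLf.add (isRegular_fourier_distOf_zero n).fourier_dxx
  rw [← hgu, ← FourierTransform.fourier_add] at h1
  refine eq_of_isRegular_fourier h1 (isRegular_fourier_distOf _ _) ?_
  have b1 := D.bddR_nk.mul D.bddR_nk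
  have b2 := D.bddR_jb.mul (D.bddR_nk.mul D.bddR_source)
  filter_upwards [hfU, rmul_ae b1 U, rmul_ae b2 n, Lp.coeFn_add
    (rmul (fun η => nk κ (symK l) η * nk κ (symK l) η) U)
    (rmul (fun η => jb (-κ) η * (nk κ (symK l) η * symM l η)) n), Lp.coeFn_neg
    (rmul (fun η => nk κ (symK l) η * nk κ (symK l) η) U +
      rmul (fun η => jb (-κ) η * (nk κ (symK l) η * symM l η)) n)] with η e1 e2 e3 e4 e5
  have h1 : (jb (2 * κ) η : ℂ) * (nk κ (symK l) η * nk κ (symK l) η) =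
      (2 * Real.pi * η) ^ 2 * l (2 * Real.pi * η) := by exact_mod_cast weight_mul_nk_sq hl κ η
  have h2 : (jb (2 * κ) η : ℂ) * (jb (-κ) η * (nk κ (symK l) η * symM l η)) =
      (2 * Real.pi * η) ^ 2 := by exact_mod_cast weight_mul_source hl κ η
  rw [waveRhs, e5, Pi.neg_apply, e4, Pi.add_apply, e2, e3, e1, neg_neg]
  push_cast
  linear_combination (U η) * h1 + (n η) * h2

variable {s σ : ℝ}

theorem distOf_eq_zero_order (hs : 0 ≤ s) (Z : L2) :
    distOf s Z = distOf 0 (rmul (jb (-s)) Z) := by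
  have h := distOf_mulL_jb hs 0 Z
  rw [zero_add] at h
  exact h.symm

/-- A distribution of order `σ = s - κ`, written in the order `-2κ` of the right-hand side. -/
theorem distOf_eq_rhs_order (hs : 0 ≤ s) (hκ : 0 ≤ κ) (hσ : σ + κ = s) (Y : L2) :
    distOf σ Y = distOf (-(2 * κ)) (rmul (jb (-κ)) (rmul (jb (-s)) Y)) := by
  have h := distOf_mulL_jb hκ (-(2 * κ)) (rmul (jb (-s)) Y)
  have h' := distOf_mulL_jb hs (-(2 * κ) + κ) Y
  have e : -(2 * κ) + κ + s = σ := by linarith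
  rw [e] at h'
  rw [← h']
  exact h.symm

theorem rmul_jb_comm {a : ℝ} (hs : 0 ≤ s) (ha : 0 ≤ a) (F : L2) :
    rmul (jb (-s)) (rmul (jb (-a)) F) = rmul (jb (-a)) (rmul (jb (-s)) F) := by
  have b1 : BddR (jb (-s)) := bddMeas_jb (neg_nonpos.mpr hs)
  have b2 : BddR (jb (-a)) := bddMeas_jb (neg_nonpos.mpr ha)
  rw [rmul_rmul b1 b2, rmul_rmul b2 b1]
  simp only [mul_comm]

/-- The Fourier side of a solution solves the second order equation in `L²`. By definition the second
time derivative exists in the sense of distributions only. The right-hand side is continuous in `L²`,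
and the evaluations at test functions separate `L²`, so that the derivative exists in `L²` as well. -/
theorem IsSolution.exists_velocity (D : Dispersion (symK l) (symM l) κ C) (hl : ∀ ξ, 0 < l ξ)
    (hs : 0 ≤ s) (hσ : σ + κ = s) {g : ℝ → ℝ} {φ : H s} {ψ : H σ} {T : ℝ} (hT : 0 < T)
    {u : ℝ → H s} (h : IsSolution l g φ ψ T u) :
    ∃ y : ℝ → L2,
      (∀ t ∈ Icc 0 T, HasDerivWithinAt (fun t => rmul (jb (-κ)) (rmul (jb (-s)) (hat s (u t))))
        (y t) (Icc 0 T) t) ∧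
      y 0 = rmul (jb (-s)) (hat σ ψ) ∧
      ∀ (R : ℝ≥0) (Λ : ℝ≥0) (N : L2 → L2), LipschitzWith Λ N →
        (∀ U ∈ wBall s R, IsComp g (𝓕⁻ U) (𝓕⁻ (N U))) →
        (∀ t ∈ Icc 0 T, ‖u t‖ ≤ R) →
        ∀ t ∈ Icc 0 T, HasDerivWithinAt (fun t => rmul (jb (-κ)) (y t))
          (waveRhs l κ (rmul (jb (-s)) (hat s (u t))) (N (rmul (jb (-s)) (hat s (u t)))))
          (Icc 0 T) t := by
  obtain ⟨hu, w, hwu, hw, -, hw0, heq⟩ := h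
  have hκ := D.order_nonneg
  have hud : UniqueDiffOn ℝ (Icc 0 T) := uniqueDiffOn_Icc hT
  obtain ⟨hwd, hwc⟩ := (contDiffOn_one_iff_derivWithin hud).mp hw
  have hwhat : ∀ t ∈ Icc 0 T, hat σ (w t) = rmul (jb (-κ)) (hat s (u t)) := fun t ht => by
    apply distOf_injective σ
    have e := distOf_mulL_jb hκ σ (hat s (u t))
    rw [hσ, ← dist_eq_distOf, ← hwu t ht, dist_eq_distOf] at e
    exact e.symm
  let J : L2 →L[ℝ] L2 := (rmul (jb (-s))).restrictScalars ℝ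
  let y : ℝ → L2 := fun t => rmul (jb (-s)) (hat σ (derivWithin w (Icc 0 T) t))
  have hyc : ContinuousOn y (Icc 0 T) :=
    J.continuous.comp_continuousOn ((hat σ).continuous.comp_continuousOn hwc)
  refine ⟨y, fun t ht => ?_, by simp only [y, hw0], ?_⟩
  · have h1 := (J.comp (hat σ).toContinuousLinearMap).hasFDerivAt.comp_hasDerivWithinAt t
      (hwd t ht).hasDerivWithinAt
    refine h1.congr_of_mem (fun τ hτ => ?_) ht
    change _ = rmul (jb (-s)) (hat σ (w τ))
    rw [hwhat τ hτ, rmul_jb_comm hs hκ]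
  · intro R Λ N hN hNg hR
    have hUc : ContinuousOn (fun t => rmul (jb (-s)) (hat s (u t))) (Icc 0 T) :=
      J.continuous.comp_continuousOn ((hat s).continuous.comp_continuousOn hu)
    have hball : ∀ t ∈ Icc 0 T, rmul (jb (-s)) (hat s (u t)) ∈ wBall s R := fun t ht =>
      wBall_mono (by
        rw [← NNReal.coe_le_coe, coe_nnnorm, (hat s).norm_map]
        exact hR t ht) (jb_neg_mul_self_mem_wBall hs (hermitian_hat (u t)))
    -- The equation at each test function is upgraded to one in `L²`.
    refine hasDerivWithinAt_of_separating (evalL (-(2 * κ)))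
      (fun F G hFG => distOf_injective (-(2 * κ)) ?_) hT.le ?_ fun χ t ht => ?_
    · ext χ
      exact hFG χ
    · exact (((rmul _).continuous.comp_continuousOn hUc).add
        ((rmul _).continuous.comp_continuousOn (hN.continuous.comp_continuousOn hUc))).neg
    · obtain ⟨Luxx, gu, hL, hgu, hd⟩ := heq t ht
      rw [dist_eq_distOf, distOf_eq_zero_order hs] at hL hgu
      have e := add_dxx_eq_distOf D hl hL (hgu.dxx_eq (hNg _ (hball t ht)))
      have hd' := hd χ
      have e' : Luxx χ + dxx gu χ = evalL (-(2 * κ)) χ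
          (waveRhs l κ (rmul (jb (-s)) (hat s (u t))) (N (rmul (jb (-s)) (hat s (u t))))) := by
        rw [evalL_apply, ← e]; rfl
      rw [e'] at hd'
      refine hd'.congr_of_mem (fun τ _ => ?_) ht
      rw [evalL_apply, dist_eq_distOf, distOf_eq_rhs_order hs hκ hσ]

end Equation

/-! ### Solutions of the Cauchy problem -/

section Solution

variable {l : ℝ → ℝ} {κ : ℝ} {C : ℝ≥0} {s σ : ℝ}

/-- The isometry `hat σ` reflects derivatives which lie in its range. -/
theorem hasDerivWithinAt_of_hat {w : ℝ → H σ} {w' : H σ} {S : Set ℝ} {t : ℝ}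
    (h : HasDerivWithinAt (fun t => hat σ (w t)) (hat σ w') S t) : HasDerivWithinAt w w' S t := by
  rw [hasDerivWithinAt_iff_tendsto_slope] at h ⊢
  rw [(hat σ).isometry.isEmbedding.isInducing.tendsto_nhds_iff]
  refine h.congr fun τ => ?_
  simp only [Function.comp_apply, slope_def_module, map_smul, map_sub]

/-- The derivative of a function with Hermitian values is Hermitian. -/
theorem Hermitian.of_hasDerivWithinAt {F : ℝ → L2} {F' : L2} {a b t : ℝ} (hab : a < b)
    (ht : t ∈ Icc a b) (hF : ∀ t ∈ Icc a b, Hermitian (F t))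
    (h : HasDerivWithinAt F F' (Icc a b) t) : Hermitian F' := by
  rw [hermitian_iff_imFourierInv]
  have h1 : HasDerivWithinAt (fun _ : ℝ => (0 : Lp ℝ 2 (volume : Measure ℝ)))
      (imFourierInv F') (Icc a b) t :=
    (imFourierInv.hasFDerivAt.comp_hasDerivWithinAt t h).congr_of_mem
      (fun τ hτ => ((hermitian_iff_imFourierInv _).mp (hF τ hτ)).symm) ht
  exact (uniqueDiffOn_Icc hab t ht).eq_deriv _ h1 (hasDerivWithinAt_const _ _ _)

/-- A pair of functions on the Fourier side which solves the equation there comes from a solution. -/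
theorem exists_isSolution (D : Dispersion (symK l) (symM l) κ C) (hl : ∀ ξ, 0 < l ξ)
    (hs : 0 ≤ s) (hσ : σ + κ = s) {g : ℝ → ℝ} (φ : H s) (ψ : H σ) {T : ℝ} (hT : 0 < T)
    {Z Y n : ℝ → L2} (hZ : ContinuousOn Z (Icc 0 T)) (hY : ContinuousOn Y (Icc 0 T))
    (hZ0 : Z 0 = hat s φ) (hY0 : Y 0 = hat σ ψ) (hZh : ∀ t ∈ Icc 0 T, Hermitian (Z t))
    (hZY : ∀ t ∈ Icc 0 T, HasDerivWithinAt (fun t => rmul (jb (-κ)) (Z t)) (Y t) (Icc 0 T) t)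
    (hYn : ∀ t ∈ Icc 0 T, HasDerivWithinAt (fun t => rmul (jb (-κ)) (rmul (jb (-s)) (Y t)))
      (waveRhs l κ (rmul (jb (-s)) (Z t)) (n t)) (Icc 0 T) t)
    (hn : ∀ t ∈ Icc 0 T, IsComp g (𝓕⁻ (rmul (jb (-s)) (Z t))) (𝓕⁻ (n t))) :
    ∃ u : ℝ → H s, IsSolution l g φ ψ T u := by
  have hκ := D.order_nonneg
  have hud : UniqueDiffOn ℝ (Icc 0 T) := uniqueDiffOn_Icc hT
  have h0 : (0 : ℝ) ∈ Icc 0 T := ⟨le_rfl, hT.le⟩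
  have hpZ : ∀ t ∈ Icc 0 T, Hermitian (rmul (jb (-κ)) (Z t)) := fun t ht =>
    (hZh t ht).mulL D.bddR_jb (jb_even _)
  have lift : ∀ (a : ℝ) (F : ℝ → L2), (∀ t ∈ Icc 0 T, Hermitian (F t)) →
      ∃ v : ℝ → H a, ∀ t ∈ Icc 0 T, hat a (v t) = F t := fun a F hF => by
    have : ∀ t, ∃ v : H a, t ∈ Icc 0 T → hat a v = F t := fun t => by
      by_cases ht : t ∈ Icc 0 T
      · obtain ⟨v, hv⟩ := exists_hat_eq a (hF t ht)
        exact ⟨v, fun _ => hv⟩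
      · exact ⟨0, fun h => absurd h ht⟩
    choose v hv using this
    exact ⟨v, hv⟩
  obtain ⟨u, hu⟩ := lift s Z hZh
  obtain ⟨w, hw⟩ := lift σ _ hpZ
  obtain ⟨w', hw'⟩ := lift σ Y fun t ht => (Hermitian.of_hasDerivWithinAt hT ht hpZ (hZY t ht))
  have hder : ∀ t ∈ Icc 0 T, HasDerivWithinAt w (w' t) (Icc 0 T) t := fun t ht => by
    refine hasDerivWithinAt_of_hat ?_
    rw [hw' t ht]
    exact (hZY t ht).congr_of_mem hw ht
  have hdw : ∀ t ∈ Icc 0 T, derivWithin w (Icc 0 T) t = w' t := fun t ht =>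
    (hder t ht).derivWithin (hud t ht)
  have hcont : ∀ {a : ℝ} {v : ℝ → H a} {F : ℝ → L2}, ContinuousOn F (Icc 0 T) →
      (∀ t ∈ Icc 0 T, hat a (v t) = F t) → ContinuousOn v (Icc 0 T) := fun {a v F} hF hv => by
    rw [(hat a).isometry.isEmbedding.isInducing.continuousOn_iff]
    exact hF.congr hv
  refine ⟨u, hcont hZ hu, w, fun t ht => ?_, ?_, ?_, ?_, fun t ht => ?_⟩
  · have e := distOf_mulL_jb hκ σ (Z t)
    rw [hσ] at e
    rw [dist_eq_distOf, dist_eq_distOf, hw t ht, hu t ht]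
    exact e
  · exact (contDiffOn_one_iff_derivWithin hud).mpr
      ⟨fun t ht => (hder t ht).differentiableWithinAt, (hcont hY hw').congr hdw⟩
  · apply (hat s).injective
    rw [hu 0 h0, hZ0]
  · apply (hat σ).injective
    rw [hdw 0 h0, hw' 0 h0, hY0]
  · have hU : (u t).dist = distOf 0 (rmul (jb (-s)) (Z t)) := by
      rw [dist_eq_distOf, hu t ht, distOf_eq_zero_order hs]
    obtain ⟨Luxx, hL⟩ := exists_isMultiplier D hl (rmul (jb (-s)) (Z t))
    obtain ⟨gu, hgu⟩ := exists_isSuperposition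
      ((hZh t ht).mulL (m := jb (-s)) (bddMeas_jb (neg_nonpos.mpr hs)) (jb_even _)) (hn t ht)
    have e := add_dxx_eq_distOf D hl hL (hgu.dxx_eq (hn t ht))
    refine ⟨Luxx, gu, by rwa [hU], by rwa [hU], fun χ => ?_⟩
    have h1 := (evalL (-(2 * κ)) χ).hasFDerivAt.comp_hasDerivWithinAt t (hYn t ht)
    have e' : Luxx χ + dxx gu χ = evalL (-(2 * κ)) χ
        (waveRhs l κ (rmul (jb (-s)) (Z t)) (n t)) := by
      rw [evalL_apply, ← e]; rfl
    rw [e']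
    refine h1.congr_of_mem (fun τ hτ => ?_) ht
    rw [hdw τ hτ, dist_eq_distOf, hw' τ hτ, distOf_eq_rhs_order hs hκ hσ]
    rfl

/-- Two solutions of the Cauchy problem on the same short interval agree: both are bounded in `H^s`, and
on the larger ball the nonlinearity is a Lipschitz map of `L²`. -/
theorem IsSolution.eqOn (D : Dispersion (symK l) (symM l) κ C) (hl : ∀ ξ, 0 < l ξ)
    (hs : 1 / 2 < s) (hσ : σ + κ = s) {g : ℝ → ℝ} (hg : ContDiff ℝ ((⌊s⌋₊ + 1 : ℕ) : ℕ∞) g)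
    {φ : H s} {ψ : H σ} {T : ℝ} (hT : 0 < T) (hT1 : T ≤ 1) {u v : ℝ → H s}
    (hu : IsSolution l g φ ψ T u) (hv : IsSolution l g φ ψ T v) : EqOn v u (Icc 0 T) := by
  have hs0 : 0 ≤ s := by linarith
  obtain ⟨y, hy1, hy0, hy2⟩ := hu.exists_velocity D hl hs0 hσ hT
  obtain ⟨z, hz1, hz0, hz2⟩ := hv.exists_velocity D hl hs0 hσ hT
  obtain ⟨R₁, hR₁⟩ := isCompact_Icc.exists_bound_of_continuousOn hu.1
  obtain ⟨R₂, hR₂⟩ := isCompact_Icc.exists_bound_of_continuousOn hv.1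
  set R : ℝ≥0 := (max R₁ R₂).toNNReal
  have hR : max R₁ R₂ ≤ R := Real.le_coe_toNNReal _
  obtain ⟨N, Λ, -, hN, -, hNg⟩ := exists_nonlinearity hs hg R
  have hcont : ∀ {v : ℝ → H s}, ContinuousOn v (Icc 0 T) →
      ContinuousOn (fun t => rmul (jb (-s)) (hat s (v t))) (Icc 0 T) := fun h =>
    (rmul _).continuous.comp_continuousOn ((hat s).continuous.comp_continuousOn h)
  have key := D.eqOn_of_hasDeriv hT.le hT1 hN (hcont hv.1) (hcont hu.1) hz1 hy1
    (hz2 R Λ N hN hNg fun t ht => (hR₂ t ht).trans ((le_max_right _ _).trans hR))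
    (hy2 R Λ N hN hNg fun t ht => (hR₁ t ht).trans ((le_max_left _ _).trans hR))
    (by
      obtain ⟨-, _, -, -, hu0, -⟩ := hu
      obtain ⟨-, _, -, -, hv0, -⟩ := hv
      simp only [hu0, hv0]) (hz0.trans hy0.symm)
  intro t ht
  exact (hat s).injective (rmul_injective (f := jb (-s)) (bddMeas_jb (neg_nonpos.mpr hs0))
    (fun η => (jb_pos _ _).ne') (key ht))

/-- Local existence: the mild solution found by contraction is a solution. -/
theorem exists_isSolution_of_dispersion (D : Dispersion (symK l) (symM l) κ C)
    (hl : ∀ ξ, 0 < l ξ) (hs : 1 / 2 < s) (hσ : σ + κ = s) {g : ℝ → ℝ}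
    (hg : ContDiff ℝ ((⌊s⌋₊ + 1 : ℕ) : ℕ∞) g) (φ : H s) (ψ : H σ) :
    ∃ T : ℝ, 0 < T ∧ T ≤ 1 ∧ ∃ u : ℝ → H s, IsSolution l g φ ψ T u := by
  have hs0 : 0 ≤ s := by linarith
  obtain ⟨N, Λ, R', hN, hNR, hNg⟩ := exists_nonlinearity hs hg
    (‖hat s φ‖₊ + 1 + 2 * C * ‖hat σ ψ‖₊)
  obtain ⟨T, hT0, hT1, n, hn, hnR, hfix⟩ := D.exists_mild_eq
    (jb_neg_mul_self_mem_wBall hs0 (hermitian_hat φ))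
    (jb_neg_mul_self_mem_wBall hs0 (hermitian_hat ψ)) hN hNR
  obtain ⟨Z, Y, hZ, hY, hZ0, hY0, hmild, hZY⟩ :=
    D.exists_regular hs0 (hat s φ) (hat σ ψ) hn hnR
  have hsub : Icc 0 T ⊆ Icc 0 1 := Icc_subset_Icc_right hT1
  have hmem : ∀ t ∈ Icc 0 T, rmul (jb (-s)) (Z t) ∈ wBall s _ := fun t ht => by
    rw [← (hmild t (hsub ht)).1]
    exact (hfix t ht).1
  have hnN : ∀ t ∈ Icc 0 T, n t = N (rmul (jb (-s)) (Z t)) := fun t ht => by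
    rw [← (hmild t (hsub ht)).1]
    exact (hfix t ht).2
  obtain ⟨u, hu⟩ := exists_isSolution (g := g) (n := n) D hl hs0 hσ φ ψ hT0 (hZ.mono hsub)
    (hY.mono hsub) hZ0 hY0 (fun t ht => hermitian_of_mulL_jb hs0 (hmem t ht).1)
    (fun t ht => (hZY t (hsub ht)).mono hsub)
    (fun t ht => by
      have h := (D.hasDerivWithinAt_mildVel (rmul (jb (-s)) (hat s φ))
        (rmul (jb (-s)) (hat σ ψ)) hn (hsub ht)).mono hsub
      rw [(hmild t (hsub ht)).1] at h
      exact h.congr_of_mem (fun τ hτ => by rw [(hmild τ (hsub hτ)).2]) ht)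
    (fun t ht => by
      rw [hnN t ht]
      exact hNg _ (hmem t ht))
  exact ⟨T, hT0, hT1, u, hu⟩

end Solution

end NonlocalWave

end

theorem theorem3p4 (ρ s : ℝ) (hρ : 2 ≤ ρ) (hs : 1 / 2 < s)
    (l : ℝ → ℝ) (hl : Measurable l) (hl_even : ∀ ξ, l (-ξ) = l ξ)
    (c₁ c₂ : ℝ) (hc₁ : 0 < c₁) (hc₂ : 0 < c₂)
    (hl_lower : ∀ ξ, c₁ ^ 2 * (1 + ξ ^ 2) ^ (ρ / 2) ≤ l ξ)
    (hl_upper : ∀ ξ, l ξ ≤ c₂ ^ 2 * (1 + ξ ^ 2) ^ (ρ / 2))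
    (g : ℝ → ℝ) (hg : ContDiff ℝ ((⌊s⌋₊ + 1 : ℕ) : ℕ∞) g)
    (φ : NonlocalWave.H s) (ψ : NonlocalWave.H (s - 1 - ρ / 2)) :
    ∃ T : ℝ, 0 < T ∧ ∃ u : ℝ → NonlocalWave.H s,
      NonlocalWave.IsSolution l g φ ψ T u ∧
      ∀ v : ℝ → NonlocalWave.H s, NonlocalWave.IsSolution l g φ ψ T v →
        Set.EqOn v u (Set.Icc 0 T) := by
  have hσ : s - 1 - ρ / 2 + (1 + ρ / 2) = s := by ring
  have hlpos : ∀ ξ, 0 < l ξ := fun ξ => lt_of_lt_of_le (by positivity) (hl_lower ξ)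
  obtain ⟨C, D⟩ := NonlocalWave.exists_dispersion hρ hl hl_even hc₁ hc₂ hl_lower hl_upper
  obtain ⟨T, hT0, hT1, u, hu⟩ :=
    NonlocalWave.exists_isSolution_of_dispersion D hlpos hs hσ hg φ ψ
  exact ⟨T, hT0, u, hu, fun v hv => hu.eqOn D hlpos hs hσ hg hT0 hT1 hv⟩
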